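/- Let $M$ be a smooth manifold of dimension $d$, $\mathbb k\in\{\mathbb R,\mathbb C\}$, and $\Omega(M)=\bigoplus_n\Omega^n(M)$ the algebra of smooth $\mathbb k$-valued differential forms with wedge product $\wedge$ and exterior derivative $\mathrm d$. Let $\omega$ be a smooth antisymmetric bivector and $\nabla$ a smooth linear connection on $M$. In local coordinates write $\nabla_{\partial_j}\partial_k=\Gamma^i_{jk}\partial_i$, equivalently $\nabla_j\mathrm dx^i=-\Gamma^i_{jk}\mathrm dx^k$, and extend $\nabla_j$ to forms as a derivation of $\wedge$; let $T^i_{jk}=\Gamma^i_{jk}-\Gamma^i_{kj}$ be the torsion, $T^i_{jk;s}$ its covariant derivative, and $R^k{}_{mij}$ the curvature, $[\nabla_i,\nabla_j]\mathrm dx^k=-R^k{}_{mij}\mathrm dx^m$ (summation convention throughout). Assume Poisson-compatibility: in all local coordinates $$\mathrm d(\omega^{ij})-\omega^{kj}\nabla_k(\mathrm dx^i)-\omega^{ik}\nabla_k(\mathrm dx^j)=0\qquad\text{for all } i,j.$$ In local coordinates define the $2$-forms $$H^{ij}=\tfrac14\,\omega^{is}\bigl(T^j_{nm;s}-2R^j{}_{nms}\bigr)\,\mathrm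 dx^m\wedge \mathrm dx^n .$$ Then the following hold. 1. In all local coordinates, $H^{ij}=H^{ji}$ and $\mathrm dH^{ij}+\Gamma^i_{rp}\,\mathrm dx^p\wedge H^{rj}+\Gamma^j_{rp}\,\mathrm dx^p\wedge H^{ir}=0$ for all $i,j$. 2. Over $\mathbb k[\lambda]/(\lambda^2)$, there is a unique bilinear product $\wedge_1$ on $\mathbb k[\lambda]/(\lambda^2)\otimes_{\mathbb k}\Omega(M)$ such that, for $\xi\in\Omega^p(M)$ and $\eta\in\Omega(M)$, in all local coordinates, $$\xi\wedge_1\eta=\xi\wedge\eta+\tfrac{\lambda}{2}\,\omega^{ij}\,\nabla_i\xi\wedge\nabla_j\eta+\lambda\,(-1)^{p+1}H^{ij}\wedge(\partial_i\lrcorner\,\xi)\wedge(\partial_j\lrcorner\,\eta).$$ With this product, the unit $1$, the grading by form degree and the undeformed $\mathrm d$ (extended $\lambda$-linearly), $\mathbb k[\lambda]/(\lambda^2)\otimes_{\mathbb k}\Omega(M)$ is a differential graded algebra over $\mathbb k[\lambda]/(\lambda^2)$: the product is associative, unital and additive in degrees, $\mathrm d$ raises degrees by one, $\mathrm d^2=0$,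 and $\mathrm d(\xi\wedge_1\eta)=\mathrm d\xi\wedge_1\eta+(-1)^{n}\xi\wedge_1\mathrm d\eta$ for $\xi$ of degree $n$. If the undeformed algebra $\Omega(M)$ is generated by its elements of degrees $0$ and $1$, then so is the deformed one. -/

import Mathlib

open scoped Manifold ContDiff TensorProduct

noncomputable section

namespace Semiquant

/-! ## Forms on an open subset of coordinate space

The algebra `Lam d 𝕜` is the Grassmann algebra over `𝕜` (the real or the complex numbers) on the
symbols `dx⁰, …, dx^{d-1}`.  A differential form on an open subset of `ℝᵈ`, possibly of mixed
degree, is a function with values in it, and the wedge product is the multiplication. -/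

section Local

variable {d : ℕ} {𝕜 : Type*} [RCLike 𝕜]

/-- Coordinate space. -/
abbrev Coord (d : ℕ) : Type := EuclideanSpace ℝ (Fin d)

/-- The Grassmann algebra on `dx⁰, …, dx^{d-1}`. -/
abbrev Lam (d : ℕ) (𝕜 : Type*) [RCLike 𝕜] : Type _ := ExteriorAlgebra 𝕜 (Fin d → 𝕜)

/-- The basis of monomials `dx^{i₁} ∧ … ∧ dx^{iₚ}`, `i₁ < … < iₚ`, indexed by `{i₁, …, iₚ}`. -/
def monomials (d : ℕ) (𝕜 : Type*) [RCLike 𝕜] : Module.Basis (Finset (Fin d)) 𝕜 (Lam d 𝕜) :=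
  (Pi.basisFun 𝕜 (Fin d)).ExteriorAlgebra

/-- The `S`-th coefficient function `f_S` of a form `f = ∑ f_S dx^S`. -/
def coeffFn (f : Coord d → Lam d 𝕜) (S : Finset (Fin d)) (y : Coord d) : 𝕜 :=
  (monomials d 𝕜).repr (f y) S

/-- A form is smooth on `s` if its coefficient functions are. -/
def SmoothOn (f : Coord d → Lam d 𝕜) (s : Set (Coord d)) : Prop :=
  ∀ S, ContDiffOn ℝ ∞ (coeffFn f S) s

/-- The coordinate `1`-form `dxⁱ`. -/
def dx (i : Fin d) : Lam d 𝕜 := ExteriorAlgebra.ι 𝕜 (Pi.single i 1)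

/-- The partial derivative `∂ₖ g` of a function. -/
def partialDeriv {F : Type*} [NormedAddCommGroup F] [NormedSpace ℝ F]
    (k : Fin d) (g : Coord d → F) (y : Coord d) : F :=
  fderiv ℝ g y (EuclideanSpace.single k 1)

/-- The partial derivative of a form, coefficient by coefficient: `∑ (∂ₖ f_S) dx^S`. -/
def partialForm (k : Fin d) (f : Coord d → Lam d 𝕜) (y : Coord d) : Lam d 𝕜 :=
  ∑ S, partialDeriv k (coeffFn f S) y • monomials d 𝕜 S

/-- The exterior derivative `d f = ∑ ∂ₖ f_S dxᵏ ∧ dx^S`. -/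
def extD (f : Coord d → Lam d 𝕜) (y : Coord d) : Lam d 𝕜 :=
  ∑ k, dx k * partialForm k f y

/-- The interior product `∂ₖ ⌟ ·`: the antiderivation with `∂ₖ ⌟ dxⁱ = δₖⁱ`. -/
def intProd (k : Fin d) : Lam d 𝕜 →ₗ[𝕜] Lam d 𝕜 :=
  CliffordAlgebra.contractLeft (Q := (0 : QuadraticForm 𝕜 (Fin d → 𝕜))) (LinearMap.proj k)

/-- A system of Christoffel symbols; `Γ i j k y` is `Γⁱⱼₖ` at `y`. -/
abbrev ChristoffelSystem (d : ℕ) : Type := Fin d → Fin d → Fin d → Coord d → ℝ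

/-- The covariant derivative `∇ₖ` of forms: the derivation of the wedge product which is `∂ₖ` on
functions and satisfies `∇ₖ dxˢ = - Γˢₖₜ dxᵗ`. -/
def nablaForm (Γ : ChristoffelSystem d) (k : Fin d) (f : Coord d → Lam d 𝕜) (y : Coord d) :
    Lam d 𝕜 :=
  partialForm k f y - ∑ s, ∑ t, ((Γ s k t y : ℝ) : 𝕜) • (dx t * intProd s (f y))

/-- The torsion `Tⁱⱼₖ = Γⁱⱼₖ - Γⁱₖⱼ`. -/
def torsion (Γ : ChristoffelSystem d) (i j k : Fin d) (y : Coord d) : ℝ :=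
  Γ i j k y - Γ i k j y

/-- The covariant derivative `Tʲₙₘ;ₛ` of the torsion tensor. -/
def torsionDeriv (Γ : ChristoffelSystem d) (j n m s : Fin d) (y : Coord d) : ℝ :=
  partialDeriv s (torsion Γ j n m) y + ∑ r, Γ j s r y * torsion Γ r n m y
    - ∑ r, Γ r s n y * torsion Γ j r m y - ∑ r, Γ r s m y * torsion Γ j n r y

/-- The curvature `Rᵏₘᵢⱼ`, where `[∇ᵢ, ∇ⱼ] dxᵏ = - Rᵏₘᵢⱼ dxᵐ`. -/
def curvature (Γ : ChristoffelSystem d) (k m i j : Fin d) (y : Coord d) : ℝ :=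
  partialDeriv i (Γ k j m) y - partialDeriv j (Γ k i m) y
    + ∑ s, Γ k i s y * Γ s j m y - ∑ s, Γ k j s y * Γ s i m y

/-- A matrix of functions; `w i j y` is the component `ωⁱʲ` at `y` of a bivector. -/
abbrev BivectorComponents (d : ℕ) : Type := Fin d → Fin d → Coord d → ℝ

/-- Poisson-compatibility at `y`: `d(ωⁱʲ) - ωᵏʲ ∇ₖ(dxⁱ) - ωⁱᵏ ∇ₖ(dxʲ) = 0` for all `i, j`. -/
def CompatibleAt (w : BivectorComponents d) (Γ : ChristoffelSystem d) (y : Coord d) : Prop :=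
  ∀ i j, extD (𝕜 := ℝ) (fun z => algebraMap ℝ (Lam d ℝ) (w i j z)) y
    - ∑ k, w k j y • nablaForm Γ k (fun _ => dx i) y
    - ∑ k, w i k y • nablaForm Γ k (fun _ => dx j) y = 0

variable (𝕜) in
/-- The `2`-forms `Hⁱʲ = ¼ ωⁱˢ (Tʲₙₘ;ₛ - 2 Rʲₙₘₛ) dxᵐ ∧ dxⁿ`. -/
def hForm (w : BivectorComponents d) (Γ : ChristoffelSystem d) (i j : Fin d) (y : Coord d) :
    Lam d 𝕜 :=
  ∑ s, ∑ m, ∑ n,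
    ((1 / 4 * (w i s y * (torsionDeriv Γ j n m s y - 2 * curvature Γ j n m s y)) : ℝ) : 𝕜) •
      (dx m * dx n)

/-- The coefficient of `λ` in `f ∧_Q g = f ∧ g + (λ/2) ωⁱʲ ∇ᵢ f ∧ ∇ⱼ g`. -/
def wedgeQCoeff (w : BivectorComponents d) (Γ : ChristoffelSystem d) (f g : Coord d → Lam d 𝕜)
    (y : Coord d) : Lam d 𝕜 :=
  ∑ i, ∑ j, ((1 / 2 * w i j y : ℝ) : 𝕜) • (nablaForm Γ i f y * nablaForm Γ j g y)

/-- The coefficient of `λ` in `f ∧₁ g = f ∧_Q g + λ (-1)^{p+1} Hⁱʲ ∧ (∂ᵢ ⌟ f) ∧ (∂ⱼ ⌟ g)`, where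
`p` is the degree of `f`. -/
def wedgeOneCoeff (w : BivectorComponents d) (Γ : ChristoffelSystem d) (p : ℕ)
    (f g : Coord d → Lam d 𝕜) (y : Coord d) : Lam d 𝕜 :=
  wedgeQCoeff w Γ f g y
    + (-1 : 𝕜) ^ (p + 1) • ∑ i, ∑ j, hForm 𝕜 w Γ i j y * intProd i (f y) * intProd j (g y)

lemma SmoothOn.add {f g : Coord d → Lam d 𝕜} {s : Set (Coord d)} (hf : SmoothOn f s)
    (hg : SmoothOn g s) : SmoothOn (fun y => f y + g y) s := by
  intro S
  have : coeffFn (fun y => f y + g y) S = fun y => coeffFn f S y + coeffFn g S y := by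
    funext y; simp [coeffFn]
  rw [this]
  exact (hf S).add (hg S)

lemma smoothOn_const (a : Lam d 𝕜) (s : Set (Coord d)) : SmoothOn (fun _ => a) s :=
  fun _ => contDiffOn_const

lemma SmoothOn.mul {f g : Coord d → Lam d 𝕜} {s : Set (Coord d)} (hf : SmoothOn f s)
    (hg : SmoothOn g s) : SmoothOn (fun y => f y * g y) s := by
  intro S
  have : coeffFn (fun y => f y * g y) S = fun y => ∑ A, ∑ B, coeffFn f A y * coeffFn g B y *
      (monomials d 𝕜).repr (monomials d 𝕜 A * monomials d 𝕜 B) S := by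
    funext y
    have h : f y * g y = ∑ A, ∑ B, (coeffFn f A y * coeffFn g B y) •
        (monomials d 𝕜 A * monomials d 𝕜 B) := by
      conv_lhs => rw [← (monomials d 𝕜).sum_repr (f y), ← (monomials d 𝕜).sum_repr (g y)]
      rw [Finset.sum_mul_sum]
      simp only [smul_mul_smul_comm]
      rfl
    simp [coeffFn, h, Finsupp.finsetSum_apply]
  rw [this]
  exact ContDiffOn.sum fun A _ => ContDiffOn.sum fun B _ =>
    ((hf A).mul (hg B)).mul contDiffOn_const

end Local

/-! ## Objects on a manifold and their expressions in coordinates -/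

section Manifold

variable {d : ℕ} {M : Type*} [TopologicalSpace M] [ChartedSpace (Coord d) M]
  [IsManifold (𝓡 d) ∞ M]

/-- A local coordinate system: a chart of the maximal smooth atlas. -/
def IsCoordSystem (φ : OpenPartialHomeomorph M (Coord d)) : Prop :=
  φ ∈ IsManifold.maximalAtlas (𝓡 d) ∞ M

/-- The coordinate vector field `∂ₖ` of `φ` (meaningful on the domain of `φ`). -/
def coordVec (φ : OpenPartialHomeomorph M (Coord d)) (k : Fin d) (x : M) :
    TangentSpace (𝓡 d) x :=
  (mfderiv (𝓡 d) (𝓡 d) φ x).inverse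
    ((NormedSpace.fromTangentSpace (𝕜 := ℝ) (φ x)).symm (EuclideanSpace.single k 1))

/-- The coordinate covector field `dxⁱ` of `φ` (meaningful on the domain of `φ`). -/
def coordCovec (φ : OpenPartialHomeomorph M (Coord d)) (i : Fin d) (x : M) :
    TangentSpace (𝓡 d) x →L[ℝ] ℝ :=
  (EuclideanSpace.proj i : Coord d →L[ℝ] ℝ) ∘L
    (NormedSpace.fromTangentSpace (𝕜 := ℝ) (φ x)).toContinuousLinearMap ∘L
      mfderiv (𝓡 d) (𝓡 d) φ x

/-- The Christoffel symbols of a linear connection in the coordinates `φ`: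
`∇_{∂ⱼ} ∂ₖ = Γⁱⱼₖ ∂ᵢ`, equivalently `∇ⱼ dxⁱ = - Γⁱⱼₖ dxᵏ`. -/
def christoffel (conn : CovariantDerivative (𝓡 d) (Coord d) (TangentSpace (𝓡 d) : M → Type _))
    (φ : OpenPartialHomeomorph M (Coord d)) : ChristoffelSystem d :=
  fun i j k y => coordCovec φ i (φ.symm y)
    (conn (coordVec φ k) (φ.symm y) (coordVec φ j (φ.symm y)))

/-- Smoothness of a connection: the Christoffel symbols are smooth in all coordinates. -/
def SmoothConnection
    (conn : CovariantDerivative (𝓡 d) (Coord d) (TangentSpace (𝓡 d) : M → Type _)) : Prop :=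
  ∀ φ, IsCoordSystem φ → ∀ i j k, ContDiffOn ℝ ∞ (christoffel conn φ i j k) φ.target

/-- A (not necessarily smooth) field of contravariant `2`-tensors. -/
abbrev Tensor20 (d : ℕ) (M : Type*) [TopologicalSpace M] [ChartedSpace (Coord d) M] : Type _ :=
  ∀ x : M, (TangentSpace (𝓡 d) x →L[ℝ] ℝ) →ₗ[ℝ] (TangentSpace (𝓡 d) x →L[ℝ] ℝ) →ₗ[ℝ] ℝ

/-- The components `ωⁱʲ = ω(dxⁱ, dxʲ)` in the coordinates `φ`. -/
def components (biv : Tensor20 d M) (φ : OpenPartialHomeomorph M (Coord d)) :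
    BivectorComponents d :=
  fun i j y => biv (φ.symm y) (coordCovec φ i (φ.symm y)) (coordCovec φ j (φ.symm y))

/-- Smooth antisymmetric bivectors. -/
structure IsBivector (biv : Tensor20 d M) : Prop where
  antisymm : ∀ x α β, biv x α β = -biv x β α
  smooth : ∀ φ, IsCoordSystem φ → ∀ i j, ContDiffOn ℝ ∞ (components biv φ i j) φ.target

/-- Poisson-compatibility of a bivector and a linear connection. -/
def PoissonCompatible (biv : Tensor20 d M)
    (conn : CovariantDerivative (𝓡 d) (Coord d) (TangentSpace (𝓡 d) : M → Type _)) : Prop :=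
  ∀ φ, IsCoordSystem φ → ∀ y ∈ φ.target, CompatibleAt (components biv φ) (christoffel conn φ) y

variable (𝕜 : Type*) [RCLike 𝕜]

/-- The (possibly complexified) cotangent space. -/
abbrev Cotangent (x : M) : Type _ := TangentSpace (𝓡 d) x →L[ℝ] 𝕜

/-- The components `αᵢ = α(∂ᵢ)` of covectors at `x` in the coordinates `φ`. -/
def covecComponents (φ : OpenPartialHomeomorph M (Coord d)) (x : M) :
    Cotangent (d := d) 𝕜 x →ₗ[𝕜] (Fin d → 𝕜) where
  toFun α i := α (coordVec φ i x)
  map_add' _ _ := rfl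
  map_smul' _ _ := rfl

/-- A (not necessarily smooth) section of the bundle `Λ T*M`. -/
abbrev RawForm (d : ℕ) (M : Type*) [TopologicalSpace M] [ChartedSpace (Coord d) M]
    (𝕜 : Type*) [RCLike 𝕜] : Type _ :=
  ∀ x : M, ExteriorAlgebra 𝕜 (Cotangent (d := d) 𝕜 x)

variable {𝕜}

/-- The expression of a form in the coordinates `φ`, obtained by writing every covector `α` as
`∑ αᵢ dxⁱ`. -/
def inCoords (φ : OpenPartialHomeomorph M (Coord d)) (ξ : RawForm d M 𝕜) (y : Coord d) :
    Lam d 𝕜 :=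
  ExteriorAlgebra.map (covecComponents 𝕜 φ (φ.symm y)) (ξ (φ.symm y))

variable (d M 𝕜) in
/-- The algebra `Ω(M)` of smooth differential forms with the (undeformed) wedge product. -/
def Forms : Subalgebra 𝕜 (RawForm d M 𝕜) where
  carrier := {ξ | ∀ φ, IsCoordSystem φ → SmoothOn (inCoords φ ξ) φ.target}
  mul_mem' {ξ η} hξ hη φ hφ := by
    have : inCoords φ (ξ * η) = fun y => inCoords φ ξ y * inCoords φ η y := by
      funext y; simp [inCoords]
    rw [this]
    exact (hξ φ hφ).mul (hη φ hφ)
  add_mem' {ξ η} hξ hη φ hφ := by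
    have : inCoords φ (ξ + η) = fun y => inCoords φ ξ y + inCoords φ η y := by
      funext y; simp [inCoords]
    rw [this]
    exact (hξ φ hφ).add (hη φ hφ)
  algebraMap_mem' r φ hφ := by
    have : inCoords φ (algebraMap 𝕜 (RawForm d M 𝕜) r) = fun _ => algebraMap 𝕜 (Lam d 𝕜) r := by
      funext y; simp [inCoords]
    rw [this]
    exact smoothOn_const _ _

variable (d M 𝕜) in
/-- The forms of degree `n`. -/
def homogeneous (n : ℕ) : Submodule 𝕜 (Forms d M 𝕜) where
  carrier := {ξ | ∀ x, ξ.1 x ∈ ⋀[𝕜]^n (Cotangent (d := d) 𝕜 x)}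
  add_mem' hξ hη x := add_mem (hξ x) (hη x)
  zero_mem' _ := zero_mem _
  smul_mem' c _ hξ x := Submodule.smul_mem _ c (hξ x)

/-- `D` is the exterior derivative of `M`: in all coordinates it is `extD`. -/
def IsExteriorDerivative (D : Forms d M 𝕜 →ₗ[𝕜] Forms d M 𝕜) : Prop :=
  ∀ φ, IsCoordSystem φ → ∀ ξ : Forms d M 𝕜, ∀ y ∈ φ.target,
    inCoords φ (D ξ).1 y = extD (inCoords φ ξ.1) y

/-! ## Deformation to first order

Over `𝕜[λ]/(λ²)`, realised as the dual numbers with `λ = DualNumber.eps`, the deformed forms are the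
elements of `𝕜[λ]/(λ²) ⊗ Ω(M)`. -/

variable (d M 𝕜) in
/-- The `𝕜[λ]/(λ²)`-module underlying the deformed forms. -/
abbrev FormsOne : Type _ := DualNumber 𝕜 ⊗[𝕜] Forms d M 𝕜

/-- `mul` is the `𝕜[λ]/(λ²)`-bilinear product `∧₁` on deformed forms: for undeformed forms `ξ` of
degree `p` and `η` arbitrary, it is `ξ ∧ η + λ ζ` where the form `ζ` on `M` is given in all coordinates by
`½ ωⁱʲ ∇ᵢ ξ ∧ ∇ⱼ η + (-1)^{p+1} Hⁱʲ ∧ (∂ᵢ ⌟ ξ) ∧ (∂ⱼ ⌟ η)`. -/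
def IsWedgeOne (biv : Tensor20 d M)
    (conn : CovariantDerivative (𝓡 d) (Coord d) (TangentSpace (𝓡 d) : M → Type _))
    (mul : FormsOne d M 𝕜 →ₗ[DualNumber 𝕜] FormsOne d M 𝕜 →ₗ[DualNumber 𝕜] FormsOne d M 𝕜) :
    Prop :=
  ∀ p, ∀ ξ ∈ homogeneous d M 𝕜 p, ∀ η : Forms d M 𝕜, ∃ ζ : Forms d M 𝕜,
    mul (1 ⊗ₜ ξ) (1 ⊗ₜ η) = 1 ⊗ₜ (ξ * η) + (DualNumber.eps : DualNumber 𝕜) ⊗ₜ[𝕜] ζ ∧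
    ∀ φ, IsCoordSystem φ → ∀ y ∈ φ.target,
      inCoords φ ζ.1 y = wedgeOneCoeff (components biv φ) (christoffel conn φ) p
        (inCoords φ ξ.1) (inCoords φ η.1) y

variable (d M 𝕜) in
/-- The deformed forms of degree `n`. -/
def homogeneousOne (n : ℕ) : Submodule (DualNumber 𝕜) (FormsOne d M 𝕜) :=
  (homogeneous d M 𝕜 n).baseChange (DualNumber 𝕜)

end Manifold

/-! ## Differential graded algebras -/

section DGA

variable {R V : Type*} [CommRing R] [AddCommGroup V] [Module R V]

/-- `V = ⨁ 𝒱 n` with the product `mul`, the unit `one` and the differential `D` is a (unital,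
associative, cochain) differential graded algebra over `R`. -/
structure IsDGA (𝒱 : ℕ → Submodule R V) (mul : V →ₗ[R] V →ₗ[R] V) (one : V) (D : V →ₗ[R] V) :
    Prop where
  graded : DirectSum.IsInternal 𝒱
  one_mem : one ∈ 𝒱 0
  mul_mem : ∀ m n, ∀ a ∈ 𝒱 m, ∀ b ∈ 𝒱 n, mul a b ∈ 𝒱 (m + n)
  one_mul : ∀ a, mul one a = a
  mul_one : ∀ a, mul a one = a
  assoc : ∀ a b c, mul (mul a b) c = mul a (mul b c)
  map_mem : ∀ n, ∀ a ∈ 𝒱 n, D a ∈ 𝒱 (n + 1)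
  square_zero : ∀ a, D (D a) = 0
  leibniz : ∀ n, ∀ a ∈ 𝒱 n, ∀ b, D (mul a b) = mul (D a) b + (-1 : R) ^ n • mul a (D b)

/-- Generation by the elements of degrees `0` and `1`. -/
def GeneratedInDegreesZeroOne (𝒱 : ℕ → Submodule R V) (mul : V →ₗ[R] V →ₗ[R] V) : Prop :=
  ∀ W : Submodule R V, 𝒱 0 ≤ W → 𝒱 1 ≤ W → (∀ a ∈ W, ∀ b ∈ W, mul a b ∈ W) → W = ⊤

end DGA

end Semiquant

end

/-!
On a coordinate patch put `θˢᵢ = Γˢᵢₜ dxᵗ`, so that `∇ᵢ = ∂ᵢ - θˢᵢ ∧ (∂ₛ ⌟ ·)`, and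
`Fʳᵢ = dθʳᵢ + θʳₛ ∧ θˢᵢ`. Since the form index of `θ` is the last index of `Γ`, `F` is the curvature
of the connection with opposite torsion. The combination of torsion and curvature in the definition
of `H` is just `F`: one has `Hⁱʲ = -½ ωⁱˢ Fʲₛ` (`LocalData.hform_apply`). Poisson-compatibility says
that `ω` is parallel for `θ`, that is `dωⁱʲ = -θⁱₖ ωᵏʲ - θʲₖ ωⁱᵏ`. Differentiating this once gives
`Hⁱʲ = Hʲⁱ` (`Compatible.hform_symm`), and the Bianchi identity for `F` gives the covariant
closedness of `H` (`Compatible.d_hform`).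

Let `B(f, g) = ½ ωⁱʲ ∇ᵢf ∧ ∇ⱼg + Hⁱʲ ∧ α(∂ᵢ ⌟ f) ∧ (∂ⱼ ⌟ g)`, with `α` the grade involution, be the
first-order term of the product.

* Associativity modulo `λ²` says that `B` is a Hochschild cocycle. This holds because the `∇ᵢ` are
  derivations, the `∂ᵢ ⌟ ·` antiderivations, and `ωⁱʲ`, `Hⁱʲ` are central
  (`Compatible.br_cocycle`).
* The Leibniz rule for `B` is `Compatible.leibniz`. The exterior derivative commutes with `∇ᵢ` up to
  terms with `θ` and `F` (`d_nabla`); those with `θ` cancel because `ω` is parallel, and those with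
  `F` leave exactly `Hⁱʲ ∧ (∂ᵢ ⌟ f ∧ ∇ⱼg - α(∇ᵢf) ∧ ∂ⱼ ⌟ g)` up to sign (`Compatible.leibnizQ`).
  By Cartan's formula for `∂ᵢ` this is cancelled by the failure of the Leibniz rule for the
  `H`-term.

These are identities between operators on the algebra of forms. They are proved for an abstract
`CartanCalculus`, in which the grade involution takes the place of all signs.

Both `d` and `B` are independent of coordinates. For the first term of `B` this is the tensoriality
of `∇` and `ω`. That `H` is a tensor then comes for free: the failure of the Leibniz rule for the
first term is an invariant expression, and evaluated at `f = dXᵃ`, `g = Xᵇ` it is `-Hᵃᵇ`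
(`MapsData.hform_T`). Hence the local expressions glue to operators on the forms on `M`
(`exists_form_of_local`, `PoissonGeometry.exists_bracket`).

The rest is formal. Over `𝕜[λ]/(λ²)` a product of the required kind can only be `ξη + λ B(ξ, η)`, since
forms are finite sums of homogeneous ones (`IsFiniteGrading.eq_deform_iff`), and the laws of a
differential graded algebra for it are those established for `B`
(`InfinitesimalDeformation.isDGA`). Generation in degrees `0` and `1` lifts along the nilpotent
ideal `(λ)` (`generatedInDegreesZeroOne_deform`).
-/

noncomputable section

namespace Semiquant

/-! ### Cartan calculi -/

/-- The algebraic structure of the algebra `A` of differential forms on a coordinate patch: the grade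
involution `inv`, the partial derivatives `pd k` acting on the coefficients, the interior products
`ip k` with the coordinate fields, and the coordinate forms `e k = dxᵏ`. The grading enters only
through `inv`, whose use in place of signs `(-1)ᵖ` lets all identities be stated for inhomogeneous
forms. -/
structure CartanCalculus (𝕜 : Type*) [Field 𝕜] (n : ℕ) (A : Type*) [Ring A] [Algebra 𝕜 A] where
  inv : A →ₐ[𝕜] A
  pd : Fin n → A →ₗ[𝕜] A
  ip : Fin n → A →ₗ[𝕜] A
  e : Fin n → A
  inv_inv : ∀ x, inv (inv x) = x
  inv_e : ∀ k, inv (e k) = -e k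
  e_mul : ∀ k x, e k * x = inv x * e k
  inv_pd : ∀ k x, inv (pd k x) = pd k (inv x)
  inv_ip : ∀ k x, inv (ip k x) = -ip k (inv x)
  pd_mul : ∀ k x y, pd k (x * y) = pd k x * y + x * pd k y
  pd_comm : ∀ k l x, pd k (pd l x) = pd l (pd k x)
  pd_e : ∀ k l, pd k (e l) = 0
  ip_mul : ∀ k x y, ip k (x * y) = ip k x * y + inv x * ip k y
  ip_e : ∀ k l, ip k (e l) = if k = l then 1 else 0
  ip_pd : ∀ k l x, ip k (pd l x) = pd l (ip k x)

namespace CartanCalculus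

variable {𝕜 : Type*} [Field 𝕜] {n : ℕ} {A : Type*} [Ring A] [Algebra 𝕜 A]
  (C : CartanCalculus 𝕜 n A)

/-- The properties of forms of degree `0` that are used. -/
structure IsFun (a : A) : Prop where
  comm : ∀ x, a * x = x * a
  inv : C.inv a = a
  ip : ∀ k, C.ip k a = 0

/-- The properties of forms of odd degree that are used. -/
structure IsOdd (a : A) : Prop where
  inv : C.inv a = -a
  comm : ∀ x, a * x = C.inv x * a

/-- The exterior derivative `∑ dxᵏ ∧ ∂ₖ`. -/
def d : A →ₗ[𝕜] A := ∑ k, LinearMap.mulLeft 𝕜 (C.e k) ∘ₗ C.pd k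

lemma d_apply (x : A) : C.d x = ∑ k, C.e k * C.pd k x := by simp [d]

variable {C} in
lemma IsOdd.add {a b : A} (ha : C.IsOdd a) (hb : C.IsOdd b) : C.IsOdd (a + b) :=
  ⟨by rw [map_add, ha.inv, hb.inv, neg_add], fun x => by rw [add_mul, mul_add, ha.comm, hb.comm]⟩

variable {C} in
lemma IsOdd.sum {ι : Type*} (s : Finset ι) {a : ι → A} (h : ∀ i, C.IsOdd (a i)) :
    C.IsOdd (∑ i ∈ s, a i) := by
  classical
  induction s using Finset.induction_on with
  | empty => exact ⟨by simp, by simp⟩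
  | insert i s hi ih => rw [Finset.sum_insert hi]; exact (h i).add ih

variable {C} in
lemma IsOdd.mul_self [CharZero 𝕜] {a : A} (ha : C.IsOdd a) : a * a = 0 := by
  have h1 : a * a = -(a * a) := by
    conv_lhs => rw [ha.comm, ha.inv, neg_mul]
  have h2 : (2 : 𝕜) • (a * a) = 0 := by
    rw [two_smul]; nth_rewrite 2 [h1]; exact add_neg_cancel _
  exact (smul_eq_zero_iff_right two_ne_zero).1 h2

variable {C} in
lemma IsOdd.smul {a : A} (ha : C.IsOdd a) (c : 𝕜) : C.IsOdd (c • a) :=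
  ⟨by rw [map_smul, ha.inv, smul_neg], fun x => by
    rw [smul_mul_assoc, ha.comm, mul_smul_comm]⟩

variable {C} in
lemma IsFun.pd {a : A} (ha : C.IsFun a) (k : Fin n) : C.IsFun (C.pd k a) where
  comm x := by
    have h := congrArg (C.pd k) (ha.comm x)
    rw [C.pd_mul, C.pd_mul, ha.comm] at h
    rwa [add_comm, add_left_cancel_iff] at h
  inv := by rw [C.inv_pd, ha.inv]
  ip l := by rw [C.ip_pd, ha.ip, map_zero]

lemma d_mul (x y : A) : C.d (x * y) = C.d x * y + C.inv x * C.d y := by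
  simp only [d_apply, C.pd_mul, mul_add, Finset.sum_add_distrib, Finset.sum_mul, Finset.mul_sum,
    ← mul_assoc, C.e_mul _ x]

lemma d_inv (x : A) : C.d (C.inv x) = -C.inv (C.d x) := by
  simp only [d_apply, map_sum, map_mul, C.inv_e, C.inv_pd, neg_mul, Finset.sum_neg_distrib, neg_neg]

lemma inv_d (x : A) : C.inv (C.d x) = -C.d (C.inv x) := by rw [d_inv, neg_neg]

/-- Cartan's formula for the coordinate fields. -/
lemma d_ip (s : Fin n) (x : A) : C.d (C.ip s x) + C.ip s (C.d x) = C.pd s x := by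
  simp only [d_apply, map_sum, C.ip_mul, C.ip_e, C.inv_e, C.ip_pd]
  rw [← Finset.sum_add_distrib]
  simp

lemma d_pd (i : Fin n) (x : A) : C.d (C.pd i x) = C.pd i (C.d x) := by
  simp only [d_apply, map_sum, C.pd_mul, C.pd_e, zero_mul, zero_add, C.pd_comm i]

lemma e_mul_e (k l : Fin n) : C.e k * C.e l = -(C.e l * C.e k) := by
  rw [C.e_mul, C.inv_e, neg_mul]

lemma sum_e_e_symm [CharZero 𝕜] {f : Fin n → Fin n → A} (h : ∀ k l, f k l = f l k) :
    ∑ k, ∑ l, C.e k * C.e l * f k l = 0 := by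
  have h1 : ∑ k, ∑ l, C.e k * C.e l * f k l = -∑ k, ∑ l, C.e k * C.e l * f k l := by
    conv_rhs => rw [Finset.sum_comm]
    rw [← Finset.sum_neg_distrib]
    refine Finset.sum_congr rfl fun k _ => ?_
    rw [← Finset.sum_neg_distrib]
    refine Finset.sum_congr rfl fun l _ => ?_
    rw [C.e_mul_e, h, neg_mul]
  have h2 : (2 : 𝕜) • ∑ k, ∑ l, C.e k * C.e l * f k l = 0 := by
    rw [two_smul]; nth_rewrite 2 [h1]; exact add_neg_cancel _
  exact (smul_eq_zero_iff_right two_ne_zero).1 h2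

lemma d_d [CharZero 𝕜] (x : A) : C.d (C.d x) = 0 := by
  rw [C.d_apply (C.d x)]
  simp only [← C.d_pd]
  simp only [d_apply, Finset.mul_sum, ← mul_assoc]
  exact C.sum_e_e_symm fun k l => C.pd_comm _ _ _

variable {C} in
lemma IsFun.isOdd_d {a : A} (ha : C.IsFun a) : C.IsOdd (C.d a) := by
  constructor
  · rw [C.inv_d, ha.inv]
  · intro x
    have h := congrArg C.d (ha.comm x)
    rw [C.d_mul, C.d_mul, ha.inv, ha.comm, add_comm (C.d x * a)] at h
    exact add_right_cancel h

variable {C} in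
/-- `da` is even and central for a `1`-form `a`. -/
lemma IsOdd.d_comm {a : A} (ha : C.IsOdd a) (x : A) : C.d a * x = x * C.d a := by
  have h := congrArg C.d (ha.comm x)
  rw [C.d_mul, C.d_mul, C.inv_inv, ha.inv, C.d_inv, neg_mul, neg_mul, ha.comm (C.d x),
    neg_add_eq_sub, sub_eq_add_neg, add_comm] at h
  exact add_left_cancel (h.trans (add_comm _ _))

variable {C} in
lemma IsOdd.d_inv {a : A} (ha : C.IsOdd a) : C.inv (C.d a) = C.d a := by
  rw [C.inv_d, ha.inv, map_neg, neg_neg]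

/-! ### Covariant derivatives and curvature -/

variable (θ : Fin n → Fin n → A)

/-- The covariant derivative `∇ᵢ = ∂ᵢ - θˢᵢ ∧ (∂ₛ ⌟ ·)` given by connection forms `θ s i = Γˢᵢₜ dxᵗ`. -/
def nabla (i : Fin n) : A →ₗ[𝕜] A := C.pd i - ∑ s, LinearMap.mulLeft 𝕜 (θ s i) ∘ₗ C.ip s

lemma nabla_apply (i : Fin n) (x : A) : C.nabla θ i x = C.pd i x - ∑ s, θ s i * C.ip s x := by
  simp [nabla]

/-- The curvature forms `Fʳᵢ = dθʳᵢ + θʳₛ ∧ θˢᵢ`. For `θʳᵢ = Γʳᵢₜ dxᵗ` the form index of `θ` is the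
last index of `Γ`, so these are the curvature forms of the connection with opposite torsion. -/
def curv (r i : Fin n) : A := C.d (θ r i) + ∑ s, θ r s * θ s i

lemma curv_comm (hθ : ∀ s i, C.IsOdd (θ s i)) (r i : Fin n) (x : A) :
    C.curv θ r i * x = x * C.curv θ r i := by
  rw [curv, add_mul, mul_add, (hθ _ _).d_comm, Finset.sum_mul, Finset.mul_sum]
  congr 1
  refine Finset.sum_congr rfl fun s _ => ?_
  rw [mul_assoc, (hθ s i).comm, ← mul_assoc, (hθ _ _).comm, C.inv_inv, mul_assoc]

lemma inv_curv (hθ : ∀ s i, C.IsOdd (θ s i)) (r i : Fin n) :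
    C.inv (C.curv θ r i) = C.curv θ r i := by
  simp only [curv, map_add, map_sum, map_mul, (hθ _ _).d_inv, (hθ _ _).inv, neg_mul_neg]

lemma theta_mul_theta (hθ : ∀ s i, C.IsOdd (θ s i)) (a b c e : Fin n) :
    θ a b * θ c e = -(θ c e * θ a b) := by
  rw [(hθ a b).comm, (hθ c e).inv, neg_mul]

lemma inv_nabla (hθ : ∀ s i, C.IsOdd (θ s i)) (i : Fin n) (x : A) :
    C.inv (C.nabla θ i x) = C.nabla θ i (C.inv x) := by
  simp only [nabla_apply, map_sub, C.inv_pd, map_sum, map_mul, (hθ _ _).inv, C.inv_ip, neg_mul_neg]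

lemma nabla_mul (hθ : ∀ s i, C.IsOdd (θ s i)) (i : Fin n) (x y : A) :
    C.nabla θ i (x * y) = C.nabla θ i x * y + x * C.nabla θ i y := by
  have h : ∀ s, θ s i * (C.inv x * C.ip s y) = x * (θ s i * C.ip s y) := fun s => by
    rw [← mul_assoc, (hθ s i).comm, C.inv_inv, mul_assoc]
  simp only [nabla_apply, C.pd_mul, C.ip_mul, mul_add, Finset.sum_add_distrib, sub_mul, mul_sub,
    Finset.sum_mul, Finset.mul_sum, h, ← mul_assoc (θ _ i) (C.ip _ x)]
  abel

lemma bianchi [CharZero 𝕜] (hθ : ∀ s i, C.IsOdd (θ s i)) (r i : Fin n) :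
    C.d (C.curv θ r i) = ∑ s, C.curv θ r s * θ s i - ∑ s, θ r s * C.curv θ s i := by
  have h : ∑ s, ∑ t, θ r t * θ t s * θ s i = ∑ s, ∑ t, θ r s * (θ s t * θ t i) := by
    rw [Finset.sum_comm]; simp only [mul_assoc]
  simp only [curv, map_add, map_sum, C.d_d, C.d_mul, (hθ _ _).inv, add_mul, mul_add,
    Finset.sum_add_distrib, Finset.sum_mul, Finset.mul_sum, h, neg_mul, Finset.sum_neg_distrib]
  abel

/-- The commutator of the exterior derivative and a covariant derivative. -/
lemma d_nabla (hθ : ∀ s i, C.IsOdd (θ s i)) (i : Fin n) (x : A) :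
    C.d (C.nabla θ i x) - C.nabla θ i (C.d x) =
      ∑ s, θ s i * C.nabla θ s x - ∑ s, C.curv θ s i * C.ip s x := by
  have h1 : ∀ s, C.d (C.ip s x) = C.pd s x - C.ip s (C.d x) := fun s => by
    rw [← C.d_ip]; abel
  have h2 : ∑ s, ∑ r, θ s i * (θ r s * C.ip r x) = - ∑ s, ∑ r, θ s r * θ r i * C.ip s x := by
    rw [Finset.sum_comm, ← Finset.sum_neg_distrib]
    refine Finset.sum_congr rfl fun r _ => ?_
    rw [← Finset.sum_neg_distrib]
    refine Finset.sum_congr rfl fun s _ => ?_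
    rw [← mul_assoc, C.theta_mul_theta θ hθ, neg_mul]
  simp only [nabla_apply, map_sub, map_sum, C.d_pd, C.d_mul, (hθ _ _).inv, h1, curv, mul_sub,
    Finset.mul_sum, add_mul, Finset.sum_mul, Finset.sum_add_distrib, Finset.sum_sub_distrib, neg_mul,
    h2, Finset.sum_neg_distrib]
  abel

/-! ### The 2-forms H -/

variable (W : Fin n → Fin n → A)

/-- The forms `Hⁱʲ = -½ ωⁱˢ Fʲₛ`. -/
def hform (i j : Fin n) : A := (-1 / 2 : 𝕜) • ∑ s, W i s * C.curv θ j s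

/-- Functions `W i j = ωⁱʲ` and connection forms `θ` for which `ω` is antisymmetric and
Poisson-compatible: `dωⁱʲ = -θⁱₖ ωᵏʲ - θʲₖ ωⁱᵏ`, that is, `ω` is parallel for the connection with
forms `θ`. -/
structure Compatible : Prop where
  isOdd : ∀ s i, C.IsOdd (θ s i)
  isFun : ∀ i j, C.IsFun (W i j)
  antisymm : ∀ i j, W i j = -W j i
  d_eq : ∀ i j, C.d (W i j) = -∑ k, θ i k * W k j - ∑ k, θ j k * W i k

variable {C θ W}

namespace Compatible

/-- The curvature annihilates a parallel tensor: this is `d(dωⁱʲ) = 0`. -/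
lemma curv_W [CharZero 𝕜] (h : C.Compatible θ W) (i j : Fin n) :
    ∑ k, W k j * C.curv θ i k + ∑ k, W i k * C.curv θ j k = 0 := by
  have hWc := fun i j => (h.isFun i j).comm
  have h1 := C.d_d (W i j)
  have e1 : ∑ k, ∑ l, θ i k * (θ j l * W k l) = - ∑ k, ∑ l, θ j k * (θ i l * W l k) := by
    rw [Finset.sum_comm, ← Finset.sum_neg_distrib]
    refine Finset.sum_congr rfl fun r _ => ?_
    rw [← Finset.sum_neg_distrib]
    refine Finset.sum_congr rfl fun s _ => ?_
    rw [← mul_assoc, C.theta_mul_theta θ h.isOdd, neg_mul, mul_assoc]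
  have e2 : ∀ i j, ∑ k, ∑ l, θ i k * (θ k l * W l j) = ∑ k, ∑ l, θ i l * θ l k * W k j := by
    intro i j
    rw [Finset.sum_comm]; simp only [mul_assoc]
  have e3 : ∑ k, ∑ l, θ j k * (θ k l * W i l) = ∑ k, ∑ l, θ j l * θ l k * W i k := by
    rw [Finset.sum_comm]; simp only [mul_assoc]
  rw [h.d_eq, map_sub, map_neg, map_sum, map_sum] at h1
  simp only [C.d_mul, h.d_eq, (h.isOdd _ _).inv, mul_sub, mul_neg, neg_mul, Finset.mul_sum,
    Finset.sum_add_distrib, Finset.sum_sub_distrib, Finset.sum_neg_distrib, e1, e2, e3] at h1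
  simp only [hWc, curv, add_mul, Finset.sum_add_distrib, Finset.sum_mul]
  rw [← neg_eq_zero, ← h1]
  abel

lemma sum_W_curv_symm [CharZero 𝕜] (h : C.Compatible θ W) (i j : Fin n) :
    ∑ s, W i s * C.curv θ j s = ∑ s, W j s * C.curv θ i s := by
  have h1 := h.curv_W i j
  have h2 : ∑ k, W k j * C.curv θ i k = -∑ k, W j k * C.curv θ i k := by
    rw [← Finset.sum_neg_distrib]
    exact Finset.sum_congr rfl fun k _ => by rw [h.antisymm k j, neg_mul]
  rw [h2, neg_add_eq_zero] at h1
  exact h1.symm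

lemma hform_symm [CharZero 𝕜] (h : C.Compatible θ W) (i j : Fin n) :
    C.hform θ W i j = C.hform θ W j i := by
  rw [hform, hform, h.sum_W_curv_symm]

lemma hform_comm (h : C.Compatible θ W) (i j : Fin n) (x : A) :
    C.hform θ W i j * x = x * C.hform θ W i j := by
  simp only [hform, smul_mul_assoc, mul_smul_comm, Finset.sum_mul, Finset.mul_sum]
  congr 1
  refine Finset.sum_congr rfl fun s _ => ?_
  rw [mul_assoc, C.curv_comm θ h.isOdd, ← mul_assoc, (h.isFun i s).comm, mul_assoc]

lemma inv_hform (h : C.Compatible θ W) (i j : Fin n) :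
    C.inv (C.hform θ W i j) = C.hform θ W i j := by
  simp only [hform, map_smul, map_sum, map_mul, C.inv_curv θ h.isOdd, (h.isFun _ _).inv]

lemma d_sum_W_curv [CharZero 𝕜] (h : C.Compatible θ W) (i j : Fin n) :
    C.d (∑ s, W i s * C.curv θ j s) + ∑ r, θ i r * ∑ s, W r s * C.curv θ j s
      + ∑ r, θ j r * ∑ s, W i s * C.curv θ r s = 0 := by
  have hF := C.curv_comm θ h.isOdd
  have e1 : ∑ s, ∑ k, θ i k * (W k s * C.curv θ j s) =
      ∑ k, ∑ s, θ i k * (W k s * C.curv θ j s) := Finset.sum_comm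
  have e2 : ∑ s, ∑ k, θ s k * (W i k * C.curv θ j s) =
      ∑ s, ∑ k, W i s * (C.curv θ j k * θ k s) := by
    rw [Finset.sum_comm]
    refine Finset.sum_congr rfl fun s _ => Finset.sum_congr rfl fun k _ => ?_
    rw [← mul_assoc, ← (h.isFun _ _).comm, mul_assoc, hF]
  have e3 : ∑ s, ∑ k, W i s * (θ j k * C.curv θ k s) =
      ∑ k, ∑ s, θ j k * (W i s * C.curv θ k s) := by
    rw [Finset.sum_comm]
    refine Finset.sum_congr rfl fun s _ => Finset.sum_congr rfl fun k _ => ?_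
    rw [← mul_assoc, (h.isFun _ _).comm, mul_assoc]
  simp only [map_sum, C.d_mul, h.d_eq, (h.isFun _ _).inv, C.bianchi θ h.isOdd, sub_mul, mul_sub,
    neg_mul, Finset.sum_mul, Finset.mul_sum, Finset.sum_add_distrib, Finset.sum_sub_distrib,
    Finset.sum_neg_distrib, mul_assoc, e1, e2, e3]
  abel

/-- `H` is covariantly closed, by the Bianchi identity and because `ω` is parallel. -/
lemma d_hform [CharZero 𝕜] (h : C.Compatible θ W) (i j : Fin n) :
    C.d (C.hform θ W i j) + ∑ r, θ i r * C.hform θ W r j + ∑ r, θ j r * C.hform θ W i r = 0 := by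
  simp only [hform, map_smul, mul_smul_comm, ← Finset.smul_sum, ← smul_add]
  rw [h.d_sum_W_curv, smul_zero]

end Compatible

/-! ### The first-order deformation of the product -/

variable (C θ W)

/-- The bilinear map `½ ωⁱʲ ∇ᵢf ∧ ∇ⱼg`. -/
def brQ : A →ₗ[𝕜] A →ₗ[𝕜] A :=
  ∑ i, ∑ j, (1 / 2 : 𝕜) • (LinearMap.mul 𝕜 A).compl₁₂
    (LinearMap.mulLeft 𝕜 (W i j) ∘ₗ C.nabla θ i) (C.nabla θ j)

lemma brQ_apply (f g : A) : C.brQ θ W f g =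
    ∑ i, ∑ j, (1 / 2 : 𝕜) • (W i j * C.nabla θ i f * C.nabla θ j g) := by
  simp [brQ]

/-- The first-order term `½ ωⁱʲ ∇ᵢf ∧ ∇ⱼg + Hⁱʲ ∧ α(∂ᵢ ⌟ f) ∧ (∂ⱼ ⌟ g)` of the deformed product, where `α`
is the grade involution, which is multiplication by `(-1)ᵖ⁺¹` on `∂ᵢ ⌟ f` for `f` of degree `p`. -/
def br : A →ₗ[𝕜] A →ₗ[𝕜] A :=
  C.brQ θ W + ∑ i, ∑ j, (LinearMap.mul 𝕜 A).compl₁₂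
    (LinearMap.mulLeft 𝕜 (C.hform θ W i j) ∘ₗ C.inv.toLinearMap ∘ₗ C.ip i) (C.ip j)

lemma br_apply (f g : A) : C.br θ W f g = C.brQ θ W f g +
    ∑ i, ∑ j, C.hform θ W i j * C.inv (C.ip i f) * C.ip j g := by
  simp [br]

variable {C θ W}

namespace Compatible

lemma brQ_cocycle (h : C.Compatible θ W) (f g k : A) :
    C.brQ θ W (f * g) k + C.brQ θ W f g * k = C.brQ θ W f (g * k) + f * C.brQ θ W g k := by
  have hc : ∀ i j x, f * (W i j * x) = W i j * (f * x) := fun i j x => by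
    rw [← mul_assoc, ← (h.isFun i j).comm, mul_assoc]
  simp only [brQ_apply, C.nabla_mul θ h.isOdd, Finset.sum_mul, Finset.mul_sum, smul_mul_assoc,
    mul_smul_comm, mul_add, add_mul, mul_assoc, hc, smul_add, Finset.sum_add_distrib]
  abel

/-- Associativity to first order. The first summand is a cocycle since the `∇ᵢ` are derivations, the
second since the `∂ᵢ ⌟ ·` are antiderivations and `Hⁱʲ` is central. -/
lemma br_cocycle (h : C.Compatible θ W) (f g k : A) :
    C.br θ W (f * g) k + C.br θ W f g * k = C.br θ W f (g * k) + f * C.br θ W g k := by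
  have hc : ∀ i j x, f * (C.hform θ W i j * x) = C.hform θ W i j * (f * x) := fun i j x => by
    rw [← mul_assoc, ← h.hform_comm i j, mul_assoc]
  have h1 := h.brQ_cocycle f g k
  have h2 : ∑ i, ∑ j, C.hform θ W i j * C.inv (C.ip i (f * g)) * C.ip j k
      + (∑ i, ∑ j, C.hform θ W i j * C.inv (C.ip i f) * C.ip j g) * k
      = ∑ i, ∑ j, C.hform θ W i j * C.inv (C.ip i f) * C.ip j (g * k)
      + f * ∑ i, ∑ j, C.hform θ W i j * C.inv (C.ip i g) * C.ip j k := by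
    simp only [C.ip_mul, map_add, map_mul, C.inv_inv, Finset.sum_mul, Finset.mul_sum, mul_add,
      add_mul, mul_assoc, hc, Finset.sum_add_distrib]
    abel
  simp only [br_apply, add_mul, mul_add]
  rw [add_add_add_comm, h1, h2, add_add_add_comm]

lemma leibniz_sum [CharZero 𝕜] (h : C.Compatible θ W) (f g : A) :
    C.d (∑ i, ∑ j, W i j * C.nabla θ i f * C.nabla θ j g)
      - ∑ i, ∑ j, W i j * C.nabla θ i (C.d f) * C.nabla θ j g
      - ∑ i, ∑ j, W i j * C.nabla θ i (C.inv f) * C.nabla θ j (C.d g)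
    = ∑ i, ∑ j, (∑ s, W i s * C.curv θ j s) *
      (C.ip i f * C.nabla θ j g - C.inv (C.nabla θ i f) * C.ip j g) := by
  have hd : ∀ i x, C.d (C.nabla θ i x) = C.nabla θ i (C.d x) +
      (∑ s, θ s i * C.nabla θ s x - ∑ s, C.curv θ s i * C.ip s x) := fun i x => by
    rw [← C.d_nabla θ h.isOdd]; abel
  have e1 : ∑ i, ∑ j, ∑ k, θ i k * (W k j * (C.nabla θ i f * C.nabla θ j g)) =
      ∑ i, ∑ j, ∑ k, W i j * (θ k i * (C.nabla θ k f * C.nabla θ j g)) := by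
    have : ∀ j, ∑ i, ∑ k, θ i k * (W k j * (C.nabla θ i f * C.nabla θ j g)) =
      ∑ i, ∑ k, W i j * (θ k i * (C.nabla θ k f * C.nabla θ j g)) := fun j => by
      rw [Finset.sum_comm]
      refine Finset.sum_congr rfl fun s _ => Finset.sum_congr rfl fun k _ => ?_
      rw [← mul_assoc, ← (h.isFun _ _).comm, mul_assoc]
    rw [Finset.sum_comm, Finset.sum_congr rfl fun j _ => this j, Finset.sum_comm]
  have e2 : ∑ i, ∑ j, ∑ k, θ j k * (W i k * (C.nabla θ i f * C.nabla θ j g)) =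
      ∑ i, ∑ j, ∑ k, W i j * (C.inv (C.nabla θ i f) * (θ k j * C.nabla θ k g)) := by
    refine Finset.sum_congr rfl fun i _ => ?_
    rw [Finset.sum_comm]
    refine Finset.sum_congr rfl fun s _ => Finset.sum_congr rfl fun k _ => ?_
    rw [← mul_assoc, ← (h.isFun _ _).comm, mul_assoc, ← mul_assoc (C.inv _), ← (h.isOdd _ _).comm,
      mul_assoc]
  have e3 : ∑ i, ∑ j, ∑ s, W i j * (C.curv θ s i * (C.ip s f * C.nabla θ j g)) =
      - ∑ i, ∑ j, (∑ s, W i s * C.curv θ j s) * (C.ip i f * C.nabla θ j g) := by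
    have : ∀ i j, (∑ s, W i s * C.curv θ j s) * (C.ip i f * C.nabla θ j g) =
        - ∑ s, W s j * (C.curv θ i s * (C.ip i f * C.nabla θ j g)) := fun i j => by
      rw [h.sum_W_curv_symm, Finset.sum_mul, ← Finset.sum_neg_distrib]
      exact Finset.sum_congr rfl fun s _ => by rw [h.antisymm s j, neg_mul, neg_neg, mul_assoc]
    simp only [this, Finset.sum_neg_distrib, neg_neg]
    rw [Finset.sum_comm]
    conv_rhs => rw [Finset.sum_comm]
    refine Finset.sum_congr rfl fun j _ => ?_
    rw [Finset.sum_comm]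
  have e4 : ∑ i, ∑ j, ∑ s, W i j * (C.inv (C.nabla θ i f) * (C.curv θ s j * C.ip s g)) =
      ∑ i, ∑ j, (∑ s, W i s * C.curv θ j s) * (C.inv (C.nabla θ i f) * C.ip j g) := by
    refine Finset.sum_congr rfl fun i _ => ?_
    rw [Finset.sum_comm]
    refine Finset.sum_congr rfl fun j _ => ?_
    rw [Finset.sum_mul]
    refine Finset.sum_congr rfl fun s _ => ?_
    rw [← mul_assoc (C.inv _), ← C.curv_comm θ h.isOdd, mul_assoc, mul_assoc]
  simp only [map_sum, C.d_mul, (h.isFun _ _).inv, h.d_eq, hd, ← C.inv_nabla θ h.isOdd,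
    mul_sub, mul_add, sub_mul, add_mul, neg_mul,
    Finset.sum_mul (s := Finset.univ) (f := fun k => θ _ _ * _),
    Finset.sum_mul (s := Finset.univ) (f := fun k => C.curv θ _ _ * _),
    Finset.mul_sum, mul_assoc,
    Finset.sum_add_distrib, Finset.sum_sub_distrib, Finset.sum_neg_distrib, e1, e2, e3, e4]
  abel

/-- The failure of the Leibniz rule for `½ ωⁱʲ ∇ᵢf ∧ ∇ⱼg`. As `d` commutes with `∇ᵢ` up to the
terms in `d_nabla`, and those with `θ` cancel against `dωⁱʲ`, only the curvature contributes. -/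
lemma leibnizQ [CharZero 𝕜] (h : C.Compatible θ W) (f g : A) :
    C.d (C.brQ θ W f g) - C.brQ θ W (C.d f) g - C.brQ θ W (C.inv f) (C.d g)
    = - ∑ i, ∑ j, C.hform θ W i j *
      (C.ip i f * C.nabla θ j g - C.inv (C.nabla θ i f) * C.ip j g) := by
  have h1 := h.leibniz_sum f g
  simp only [brQ_apply, ← Finset.smul_sum, map_smul, ← smul_sub, hform, smul_mul_assoc]
  rw [h1, ← neg_smul]
  congr 1
  norm_num

/-- The Leibniz rule to first order. Because `d(∂ᵢ ⌟ x) + ∂ᵢ ⌟ dx = ∇ᵢx + θˢᵢ ∧ (∂ₛ ⌟ x)`, the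
`H`-term fails the Leibniz rule by the negative of `leibnizQ`; the terms with `θ` cancel against
`dHⁱʲ`. -/
theorem leibniz [CharZero 𝕜] (h : C.Compatible θ W) (f g : A) :
    C.d (C.br θ W f g) = C.br θ W (C.d f) g + C.br θ W (C.inv f) (C.d g) := by
  have h1 := h.leibnizQ f g
  have hl : ∀ i x, C.d (C.ip i x) = C.nabla θ i x + ∑ s, θ s i * C.ip s x - C.ip i (C.d x) :=
    fun i x => by rw [C.nabla_apply, sub_add_cancel, ← C.d_ip]; abel
  have e1 : ∑ i, ∑ j, ∑ r, θ i r * (C.hform θ W r j * (C.inv (C.ip i f) * C.ip j g)) =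
      ∑ i, ∑ j, ∑ s, C.hform θ W i j * (θ s i * (C.inv (C.ip s f) * C.ip j g)) := by
    have : ∀ j, ∑ i, ∑ r, θ i r * (C.hform θ W r j * (C.inv (C.ip i f) * C.ip j g)) =
      ∑ i, ∑ s, C.hform θ W i j * (θ s i * (C.inv (C.ip s f) * C.ip j g)) := fun j => by
      rw [Finset.sum_comm]
      refine Finset.sum_congr rfl fun s _ => Finset.sum_congr rfl fun k _ => ?_
      rw [← mul_assoc, ← h.hform_comm, mul_assoc]
    rw [Finset.sum_comm, Finset.sum_congr rfl fun j _ => this j, Finset.sum_comm]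
  have e2 : ∑ i, ∑ j, ∑ r, θ j r * (C.hform θ W i r * (C.inv (C.ip i f) * C.ip j g)) =
      ∑ i, ∑ j, ∑ s, C.hform θ W i j * (C.ip i f * (θ s j * C.ip s g)) := by
    refine Finset.sum_congr rfl fun i _ => ?_
    rw [Finset.sum_comm]
    refine Finset.sum_congr rfl fun s _ => Finset.sum_congr rfl fun k _ => ?_
    rw [← mul_assoc, ← h.hform_comm, mul_assoc, ← mul_assoc (C.ip _ _),
      ← C.inv_inv (C.ip i f), ← (h.isOdd _ _).comm, mul_assoc, C.inv_inv]
  have hH : ∀ i j, C.d (C.hform θ W i j) =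
      - ∑ r, θ i r * C.hform θ W r j - ∑ r, θ j r * C.hform θ W i r := fun i j => by
    have := h.d_hform i j
    rw [add_assoc, add_eq_zero_iff_eq_neg] at this
    rw [this]; abel
  have h2 : C.d (∑ i, ∑ j, C.hform θ W i j * C.inv (C.ip i f) * C.ip j g)
      - ∑ i, ∑ j, C.hform θ W i j * C.inv (C.ip i (C.d f)) * C.ip j g
      - ∑ i, ∑ j, C.hform θ W i j * C.inv (C.ip i (C.inv f)) * C.ip j (C.d g)
      = ∑ i, ∑ j, C.hform θ W i j *
      (C.ip i f * C.nabla θ j g - C.inv (C.nabla θ i f) * C.ip j g) := by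
    simp only [map_sum, C.d_mul, h.inv_hform, hH, C.d_inv, hl, C.inv_inv, C.inv_ip, map_neg, mul_neg,
      mul_sub, mul_add, sub_mul, add_mul, neg_mul,
      Finset.sum_mul (s := Finset.univ) (f := fun k => θ _ _ * _), Finset.mul_sum, mul_assoc,
      Finset.sum_add_distrib, Finset.sum_sub_distrib, Finset.sum_neg_distrib]
    simp only [C.inv_ip, neg_mul, mul_neg, Finset.sum_neg_distrib, C.inv_nabla θ h.isOdd] at e1 e2 ⊢
    rw [e1, neg_eq_iff_eq_neg.1 e2]
    abel
  simp only [br_apply, map_add]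
  rw [sub_sub, sub_eq_iff_eq_add] at h1 h2
  rw [h1, h2]
  abel

end Compatible

/-! ### Changes of coordinates -/

/-- The pullback `T` along a change of coordinates from a patch with forms `A` to a patch with forms
`A'`: the functions `X a` on the first patch are the pullbacks of the coordinate functions `X' a` of the
second, and `ip_T`, `pd_T` are the chain rules for the operators of the two calculi. -/
structure CoordChange {A' : Type*} [Ring A'] [Algebra 𝕜 A'] (C : CartanCalculus 𝕜 n A)
    (C' : CartanCalculus 𝕜 n A') where
  T : A' →ₐ[𝕜] A
  X : Fin n → A
  X' : Fin n → A'
  isFun_X : ∀ a, C.IsFun (X a)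
  isFun_X' : ∀ a, C'.IsFun (X' a)
  pd_X' : ∀ a b, C'.pd a (X' b) = if a = b then 1 else 0
  T_X' : ∀ a, T (X' a) = X a
  T_e : ∀ a, T (C'.e a) = C.d (X a)
  T_inv : ∀ x, T (C'.inv x) = C.inv (T x)
  ip_T : ∀ k x, C.ip k (T x) = ∑ a, C.pd k (X a) * T (C'.ip a x)
  pd_T : ∀ k x, C.pd k (T x) = ∑ a, C.pd k (X a) * T (C'.pd a x)
    + ∑ a, C.d (C.pd k (X a)) * T (C'.ip a x)

namespace CoordChange

variable {A' : Type*} [Ring A'] [Algebra 𝕜 A'] {C : CartanCalculus 𝕜 n A}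
  {C' : CartanCalculus 𝕜 n A'} (τ : CoordChange C C')

lemma T_d [CharZero 𝕜] (x : A') : τ.T (C'.d x) = C.d (τ.T x) := by
  have h1 : ∑ k, C.e k * ∑ a, C.d (C.pd k (τ.X a)) * τ.T (C'.ip a x) = 0 := by
    simp only [Finset.mul_sum, ← mul_assoc]
    rw [Finset.sum_comm]
    refine Finset.sum_eq_zero fun a _ => ?_
    rw [← Finset.sum_mul]
    simp only [C.d_pd]
    rw [← C.d_apply, C.d_d, zero_mul]
  rw [C.d_apply (τ.T x)]
  simp only [τ.pd_T, mul_add, Finset.sum_add_distrib]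
  rw [h1, add_zero, C'.d_apply, map_sum]
  simp only [Finset.mul_sum, map_mul, τ.T_e, C.d_apply, Finset.sum_mul, mul_assoc]
  exact Finset.sum_comm

variable {θ W : Fin n → Fin n → A} {θ' W' : Fin n → Fin n → A'}

/-- The transformation laws of connection forms and of a bivector under a change of coordinates. -/
structure MapsData (τ : CoordChange C C') (θ W : Fin n → Fin n → A)
    (θ' W' : Fin n → Fin n → A') : Prop where
  theta : ∀ b j, ∑ i, θ i j * C.pd i (τ.X b) =
    C.d (C.pd j (τ.X b)) + ∑ c, C.pd j (τ.X c) * τ.T (θ' b c)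
  biv : ∀ a b, τ.T (W' a b) = ∑ i, ∑ j, W i j * C.pd i (τ.X a) * C.pd j (τ.X b)

variable {τ}

namespace MapsData

lemma nabla_T (h : MapsData τ θ W θ' W') (k : Fin n) (x : A') :
    C.nabla θ k (τ.T x) = ∑ a, C.pd k (τ.X a) * τ.T (C'.nabla θ' a x) := by
  have h1 : ∑ s, ∑ a, θ s k * (C.pd s (τ.X a) * τ.T (C'.ip a x)) =
      ∑ a, C.d (C.pd k (τ.X a)) * τ.T (C'.ip a x)
        + ∑ a, ∑ s, C.pd k (τ.X a) * (τ.T (θ' s a) * τ.T (C'.ip s x)) := by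
    simp only [← mul_assoc]
    rw [Finset.sum_comm]
    simp only [← Finset.sum_mul, h.theta, add_mul, Finset.sum_add_distrib]
    congr 1
    simp only [Finset.sum_mul]
    exact Finset.sum_comm
  simp only [nabla_apply, τ.pd_T, τ.ip_T, map_sub, map_sum, map_mul, mul_sub, Finset.mul_sum,
    Finset.sum_sub_distrib, h1]
  abel

/-- Contraction of a contravariant `2`-tensor with two covectors is invariant. -/
lemma T_sum_sum (τ : CoordChange C C') {V : Fin n → Fin n → A} {V' : Fin n → Fin n → A'}
    (hV : ∀ a b, τ.T (V' a b) = ∑ i, ∑ j, V i j * C.pd i (τ.X a) * C.pd j (τ.X b))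
    (u v : Fin n → A') :
    τ.T (∑ a, ∑ b, V' a b * u a * v b) = ∑ i, ∑ j, V i j * (∑ a, C.pd i (τ.X a) * τ.T (u a)) *
      (∑ b, C.pd j (τ.X b) * τ.T (v b)) := by
  have hc : ∀ i a j b, V i j * C.pd i (τ.X a) * C.pd j (τ.X b) * τ.T (u a) * τ.T (v b)
      = V i j * (C.pd i (τ.X a) * τ.T (u a)) * (C.pd j (τ.X b) * τ.T (v b)) := fun i a j b => by
    simp only [mul_assoc]
    rw [← mul_assoc (C.pd j (τ.X b)), ((τ.isFun_X b).pd j).comm, mul_assoc]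
  simp only [map_sum, map_mul, hV, Finset.sum_mul, Finset.mul_sum, hc]
  have e1 : ∀ F : Fin n → Fin n → Fin n → Fin n → A,
      ∑ a, ∑ b, ∑ i, ∑ j, F a b i j = ∑ i, ∑ j, ∑ b, ∑ a, F a b i j := fun F => by
    calc _ = ∑ a, ∑ i, ∑ b, ∑ j, F a b i j :=
          Finset.sum_congr rfl fun a _ => Finset.sum_comm
      _ = ∑ i, ∑ a, ∑ j, ∑ b, F a b i j := by
          rw [Finset.sum_comm]
          exact Finset.sum_congr rfl fun a _ => Finset.sum_congr rfl fun b _ => Finset.sum_comm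
      _ = ∑ i, ∑ j, ∑ a, ∑ b, F a b i j := Finset.sum_congr rfl fun a _ => Finset.sum_comm
      _ = _ := Finset.sum_congr rfl fun a _ => Finset.sum_congr rfl fun b _ => Finset.sum_comm
  exact e1 _

lemma brQ_T (h : MapsData τ θ W θ' W') (f g : A') :
    τ.T (C'.brQ θ' W' f g) = C.brQ θ W (τ.T f) (τ.T g) := by
  simp only [brQ_apply, ← Finset.smul_sum, map_smul, T_sum_sum τ h.biv, h.nabla_T]

/-- The forms `Hⁱʲ` transform as a tensor. The transformation law of the curvature is not needed for
this: `leibnizQ` for `f = dXᵃ`, `g = Xᵇ` expresses `Hᵃᵇ` by `d` and `brQ`, which are invariant. -/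
lemma hform_T [CharZero 𝕜] (h : MapsData τ θ W θ' W') (hC : C.Compatible θ W)
    (hC' : C'.Compatible θ' W') (a b : Fin n) :
    τ.T (C'.hform θ' W' a b) =
      ∑ i, ∑ j, C.hform θ W i j * C.pd i (τ.X a) * C.pd j (τ.X b) := by
  have h1 := congrArg τ.T (hC'.leibnizQ (C'.e a) (τ.X' b))
  have h2 := hC.leibnizQ (C.d (τ.X a)) (τ.X b)
  simp only [map_sub, τ.T_d, h.brQ_T, τ.T_e, τ.T_inv, τ.T_X'] at h1
  rw [h2] at h1
  have i1 : ∀ i, C.ip i (C.d (τ.X a)) = C.pd i (τ.X a) := fun i => by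
    rw [← C.d_ip, (τ.isFun_X a).ip, map_zero, zero_add]
  have n1 : ∀ j, C.nabla θ j (τ.X b) = C.pd j (τ.X b) := fun j => by
    simp [nabla_apply, (τ.isFun_X b).ip]
  have n2 : ∀ j, C'.nabla θ' j (τ.X' b) = C'.pd j (τ.X' b) := fun j => by
    simp [nabla_apply, (τ.isFun_X' b).ip]
  simp only [i1, n1, n2, C'.ip_e, τ.pd_X', (τ.isFun_X b).ip, (τ.isFun_X' b).ip, mul_zero, sub_zero,
    map_neg, neg_inj, mul_ite, mul_one, Finset.sum_ite_eq', Finset.mem_univ, if_true, ← mul_assoc] at h1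
  rw [h1]

lemma br_T [CharZero 𝕜] (h : MapsData τ θ W θ' W') (hC : C.Compatible θ W)
    (hC' : C'.Compatible θ' W') (f g : A') :
    τ.T (C'.br θ' W' f g) = C.br θ W (τ.T f) (τ.T g) := by
  have hi : ∀ i, C.inv (C.ip i (τ.T f)) = ∑ a, C.pd i (τ.X a) * τ.T (C'.inv (C'.ip a f)) :=
    fun i => by simp only [τ.ip_T, map_sum, map_mul, ((τ.isFun_X _).pd i).inv, τ.T_inv]
  rw [br_apply, br_apply, map_add, h.brQ_T, T_sum_sum τ (h.hform_T hC hC')]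
  simp only [hi]
  simp only [τ.ip_T]

end MapsData

end CoordChange

end CartanCalculus

/-! ### The Grassmann algebra -/

section Grassmann

variable {d : ℕ} {𝕜 : Type*} [RCLike 𝕜]

/-- The grade involution, `(-1)ᵖ` in degree `p`. -/
abbrev gradeInv : Lam d 𝕜 →ₐ[𝕜] Lam d 𝕜 :=
  CliffordAlgebra.involute (Q := (0 : QuadraticForm 𝕜 (Fin d → 𝕜)))

lemma gradeInv_ι (v : Fin d → 𝕜) :
    gradeInv (ExteriorAlgebra.ι 𝕜 v) = -ExteriorAlgebra.ι 𝕜 v :=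
  CliffordAlgebra.involute_ι v

lemma gradeInv_gradeInv (x : Lam d 𝕜) : gradeInv (gradeInv x) = x :=
  CliffordAlgebra.involute_involute x

lemma ι_mul_eq (v : Fin d → 𝕜) (x : Lam d 𝕜) :
    ExteriorAlgebra.ι 𝕜 v * x = gradeInv x * ExteriorAlgebra.ι 𝕜 v := by
  induction x using ExteriorAlgebra.induction with
  | algebraMap r => rw [AlgHom.commutes, Algebra.commutes]
  | ι w => rw [gradeInv_ι, neg_mul, eq_neg_iff_add_eq_zero, ExteriorAlgebra.ι_add_mul_swap]
  | mul a b ha hb => rw [← mul_assoc, ha, map_mul, mul_assoc, hb, mul_assoc]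
  | add a b ha hb => rw [mul_add, ha, hb, map_add, add_mul]

lemma intProd_ι (k : Fin d) (v : Fin d → 𝕜) :
    intProd k (ExteriorAlgebra.ι 𝕜 v) = algebraMap 𝕜 _ (v k) :=
  CliffordAlgebra.contractLeft_ι _ _ v

lemma intProd_algebraMap (k : Fin d) (r : 𝕜) : intProd k (algebraMap 𝕜 (Lam d 𝕜) r) = 0 :=
  CliffordAlgebra.contractLeft_algebraMap _ _ r

lemma intProd_ι_mul (k : Fin d) (v : Fin d → 𝕜) (x : Lam d 𝕜) :
    intProd k (ExteriorAlgebra.ι 𝕜 v * x) = v k • x - ExteriorAlgebra.ι 𝕜 v * intProd k x :=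
  CliffordAlgebra.contractLeft_ι_mul _ v x

lemma intProd_mul (k : Fin d) (x y : Lam d 𝕜) :
    intProd k (x * y) = intProd k x * y + gradeInv x * intProd k y := by
  induction x using ExteriorAlgebra.induction generalizing y with
  | algebraMap r =>
    rw [← Algebra.smul_def, map_smul, intProd_algebraMap, AlgHom.commutes, ← Algebra.smul_def,
      zero_mul, zero_add]
  | ι w =>
    rw [gradeInv_ι, intProd_ι_mul, intProd_ι, ← Algebra.smul_def, neg_mul, sub_eq_add_neg]
  | mul a b ha hb => rw [mul_assoc, ha, hb, ha, map_mul]; noncomm_ring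
  | add a b ha hb => rw [add_mul, map_add, ha, hb, map_add, map_add]; noncomm_ring

lemma gradeInv_intProd (k : Fin d) (x : Lam d 𝕜) :
    gradeInv (intProd k x) = -intProd k (gradeInv x) := by
  induction x using ExteriorAlgebra.induction with
  | algebraMap r => simp only [AlgHom.commutes, intProd_algebraMap, map_zero, neg_zero]
  | ι w => simp only [gradeInv_ι, map_neg, neg_neg, intProd_ι, AlgHom.commutes]
  | mul a b ha hb =>
    simp only [intProd_mul, map_add, map_mul, ha, hb]; noncomm_ring
  | add a b ha hb => simp only [map_add, ha, hb]; abel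

lemma intProd_dx (k l : Fin d) :
    intProd k (dx l : Lam d 𝕜) = if k = l then 1 else 0 := by
  rw [dx, intProd_ι, Pi.single_apply]
  split_ifs <;> simp

lemma ι_eq_sum (v : Fin d → 𝕜) : ExteriorAlgebra.ι 𝕜 v = ∑ i, v i • dx i := by
  simp only [dx, ← map_smul, ← map_sum]
  congr 1
  ext j
  simp [Pi.single_apply]

lemma dx_mul_dx (k l : Fin d) : (dx k * dx l : Lam d 𝕜) = -(dx l * dx k) := by
  rw [eq_neg_iff_add_eq_zero, dx, dx, ExteriorAlgebra.ι_add_mul_swap]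

/-- Only the antisymmetric part of the coefficients of a `2`-form matters. -/
lemma sum_smul_dx_mul_dx_symm (c : Fin d → Fin d → 𝕜) (h : ∀ m n, c m n = c n m) :
    ∑ m, ∑ n, c m n • (dx m * dx n : Lam d 𝕜) = 0 := by
  have h1 : ∑ m, ∑ n, c m n • (dx m * dx n : Lam d 𝕜) =
      -∑ m, ∑ n, c m n • (dx m * dx n : Lam d 𝕜) := by
    conv_rhs => rw [Finset.sum_comm]
    simp only [← Finset.sum_neg_distrib]
    refine Finset.sum_congr rfl fun k _ => Finset.sum_congr rfl fun l _ => ?_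
    rw [dx_mul_dx, h, smul_neg]
  have h2 : (2 : 𝕜) • ∑ m, ∑ n, c m n • (dx m * dx n : Lam d 𝕜) = 0 := by
    rw [two_smul]; nth_rewrite 2 [h1]; exact add_neg_cancel _
  exact (smul_eq_zero_iff_right two_ne_zero).1 h2

end Grassmann

/-! ### Differentiation of forms -/

section Calculus

variable {d : ℕ} {𝕜 : Type*} [RCLike 𝕜]

open Filter Topology

lemma repr_partialForm (k : Fin d) (f : Coord d → Lam d 𝕜) (y : Coord d) (S : Finset (Fin d)) :
    (monomials d 𝕜).repr (partialForm k f y) S = partialDeriv k (coeffFn f S) y := by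
  simp [partialForm, Finsupp.single_apply, Finsupp.finsetSum_apply]

lemma lam_ext {a b : Lam d 𝕜}
    (h : ∀ S, (monomials d 𝕜).repr a S = (monomials d 𝕜).repr b S) : a = b :=
  (monomials d 𝕜).repr.injective (Finsupp.ext h)

/-- Differentiability of the coefficient functions of a form. -/
def FormDiffAt (f : Coord d → Lam d 𝕜) (y : Coord d) : Prop :=
  ∀ S, DifferentiableAt ℝ (coeffFn f S) y

lemma SmoothOn.formDiffAt {f : Coord d → Lam d 𝕜} {s : Set (Coord d)} (hf : SmoothOn f s)
    (hs : IsOpen s) {y : Coord d} (hy : y ∈ s) : FormDiffAt f y :=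
  fun S => ((hf S).differentiableOn (by simp)).differentiableAt (hs.mem_nhds hy)

lemma partialForm_congr {f g : Coord d → Lam d 𝕜} {y : Coord d} (h : f =ᶠ[𝓝 y] g) (k : Fin d) :
    partialForm k f y = partialForm k g y := by
  refine lam_ext fun S => ?_
  rw [repr_partialForm, repr_partialForm, partialDeriv, partialDeriv]
  have : coeffFn f S =ᶠ[𝓝 y] coeffFn g S := h.mono fun z hz => by simp [coeffFn, hz]
  rw [this.fderiv_eq]

lemma SmoothOn.congr {f g : Coord d → Lam d 𝕜} {s : Set (Coord d)} (hf : SmoothOn f s)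
    (h : ∀ y ∈ s, g y = f y) : SmoothOn g s :=
  fun S => (hf S).congr fun y hy => by simp [coeffFn, h y hy]

lemma partialForm_const (k : Fin d) (a : Lam d 𝕜) (y : Coord d) :
    partialForm k (fun _ => a) y = 0 := by
  refine lam_ext fun S => ?_
  rw [repr_partialForm, partialDeriv]
  have : coeffFn (fun _ : Coord d => a) S = fun _ => (monomials d 𝕜).repr a S := rfl
  simp [this]

lemma partialForm_add (k : Fin d) {f g : Coord d → Lam d 𝕜} {y : Coord d} (hf : FormDiffAt f y)
    (hg : FormDiffAt g y) :
    partialForm k (fun z => f z + g z) y = partialForm k f y + partialForm k g y := by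
  refine lam_ext fun S => ?_
  have : coeffFn (fun z => f z + g z) S = coeffFn f S + coeffFn g S := by
    funext z; simp [coeffFn]
  simp only [map_add, Finsupp.add_apply, repr_partialForm, partialDeriv, this]
  rw [fderiv_add (hf S) (hg S)]
  rfl

lemma coeffFn_map (L : Lam d 𝕜 →ₗ[𝕜] Lam d 𝕜) (f : Coord d → Lam d 𝕜) (S : Finset (Fin d)) :
    coeffFn (fun z => L (f z)) S =
      fun z => ∑ A, coeffFn f A z * (monomials d 𝕜).repr (L (monomials d 𝕜 A)) S := by
  funext z
  simp only [coeffFn]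
  conv_lhs => rw [← (monomials d 𝕜).sum_repr (f z)]
  simp only [map_sum, map_smul, Finsupp.finsetSum_apply, Finsupp.smul_apply, smul_eq_mul]

lemma SmoothOn.map (L : Lam d 𝕜 →ₗ[𝕜] Lam d 𝕜) {f : Coord d → Lam d 𝕜} {s : Set (Coord d)}
    (hf : SmoothOn f s) : SmoothOn (fun z => L (f z)) s := by
  intro S
  rw [coeffFn_map]
  exact ContDiffOn.sum fun A _ => (hf A).mul contDiffOn_const

lemma partialForm_map (L : Lam d 𝕜 →ₗ[𝕜] Lam d 𝕜) (k : Fin d) {f : Coord d → Lam d 𝕜}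
    {y : Coord d} (hf : FormDiffAt f y) :
    partialForm k (fun z => L (f z)) y = L (partialForm k f y) := by
  refine lam_ext fun S => ?_
  rw [repr_partialForm, partialDeriv, coeffFn_map, fderiv_fun_sum fun A _ => (hf A).mul_const _]
  conv_rhs => rw [← (monomials d 𝕜).sum_repr (partialForm k f y)]
  simp only [map_sum, map_smul, Finsupp.finsetSum_apply, Finsupp.smul_apply, repr_partialForm,
    partialDeriv, _root_.sum_apply, smul_eq_mul]
  refine Finset.sum_congr rfl fun A _ => ?_
  rw [fderiv_mul_const (hf A)]
  simp [mul_comm]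

lemma coeffFn_mul (f g : Coord d → Lam d 𝕜) (S : Finset (Fin d)) :
    coeffFn (fun y => f y * g y) S = fun y => ∑ A, ∑ B, coeffFn f A y * coeffFn g B y *
      (monomials d 𝕜).repr (monomials d 𝕜 A * monomials d 𝕜 B) S := by
  funext y
  have h : f y * g y = ∑ A, ∑ B, (coeffFn f A y * coeffFn g B y) •
      (monomials d 𝕜 A * monomials d 𝕜 B) := by
    conv_lhs => rw [← (monomials d 𝕜).sum_repr (f y), ← (monomials d 𝕜).sum_repr (g y)]
    rw [Finset.sum_mul_sum]
    simp only [smul_mul_smul_comm]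
    rfl
  simp [coeffFn, h, Finsupp.finsetSum_apply]

lemma partialForm_mul (k : Fin d) {f g : Coord d → Lam d 𝕜} {y : Coord d} (hf : FormDiffAt f y)
    (hg : FormDiffAt g y) :
    partialForm k (fun z => f z * g z) y = partialForm k f y * g y + f y * partialForm k g y := by
  refine lam_ext fun S => ?_
  have e : ∀ a b : Lam d 𝕜, (monomials d 𝕜).repr (a * b) S =
      ∑ A, ∑ B, (monomials d 𝕜).repr a A * (monomials d 𝕜).repr b B *
        (monomials d 𝕜).repr (monomials d 𝕜 A * monomials d 𝕜 B) S := fun a b =>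
    congrFun (coeffFn_mul (fun _ => a) (fun _ => b) S) y
  rw [map_add, Finsupp.add_apply, e, e, repr_partialForm, partialDeriv, coeffFn_mul]
  have hd : ∀ A B, DifferentiableAt ℝ (fun z => coeffFn f A z * coeffFn g B z *
      (monomials d 𝕜).repr (monomials d 𝕜 A * monomials d 𝕜 B) S) y :=
    fun A B => ((hf A).mul (hg B)).mul_const _
  rw [fderiv_fun_sum fun A _ => DifferentiableAt.fun_sum fun B _ => hd A B,
    ← Finset.sum_add_distrib, _root_.sum_apply]
  refine Finset.sum_congr rfl fun A _ => ?_
  rw [fderiv_fun_sum fun B _ => hd A B, ← Finset.sum_add_distrib, _root_.sum_apply]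
  refine Finset.sum_congr rfl fun B _ => ?_
  rw [fderiv_mul_const ((hf A).fun_mul (hg B)), fderiv_fun_mul (hf A) (hg B)]
  simp only [repr_partialForm, partialDeriv, coeffFn, _root_.add_apply,
    _root_.smul_apply, smul_eq_mul]
  ring

lemma coeffFn_smul (u : Coord d → 𝕜) (f : Coord d → Lam d 𝕜) (S : Finset (Fin d)) :
    coeffFn (fun z => u z • f z) S = fun z => u z * coeffFn f S z := by
  funext z; simp [coeffFn]

lemma SmoothOn.smul {u : Coord d → 𝕜} {f : Coord d → Lam d 𝕜} {s : Set (Coord d)}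
    (hu : ContDiffOn ℝ ∞ u s) (hf : SmoothOn f s) : SmoothOn (fun z => u z • f z) s := by
  intro S
  rw [coeffFn_smul]
  exact hu.mul (hf S)

lemma partialForm_smul (k : Fin d) {u : Coord d → 𝕜} {f : Coord d → Lam d 𝕜} {y : Coord d}
    (hu : DifferentiableAt ℝ u y) (hf : FormDiffAt f y) :
    partialForm k (fun z => u z • f z) y = partialDeriv k u y • f y + u y • partialForm k f y := by
  refine lam_ext fun S => ?_
  rw [repr_partialForm, coeffFn_smul, partialDeriv, fderiv_fun_mul hu (hf S)]
  simp only [map_add, map_smul, Finsupp.add_apply, Finsupp.smul_apply, repr_partialForm,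
    partialDeriv, coeffFn, _root_.add_apply, _root_.smul_apply,
    smul_eq_mul]
  ring

lemma SmoothOn.sum {ι : Type*} (t : Finset ι) {f : ι → Coord d → Lam d 𝕜} {s : Set (Coord d)}
    (hf : ∀ i ∈ t, SmoothOn (f i) s) : SmoothOn (fun z => ∑ i ∈ t, f i z) s := by
  classical
  induction t using Finset.induction_on with
  | empty => simpa using smoothOn_const 0 s
  | insert i t hi ih =>
    simp only [Finset.sum_insert hi]
    exact (hf i (Finset.mem_insert_self i t)).add
      (ih fun j hj => hf j (Finset.mem_insert_of_mem hj))

lemma contDiffOn_partialDeriv {F : Type*} [NormedAddCommGroup F] [NormedSpace ℝ F] (k : Fin d)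
    {g : Coord d → F} {s : Set (Coord d)} (hs : IsOpen s) (hg : ContDiffOn ℝ ∞ g s) :
    ContDiffOn ℝ ∞ (partialDeriv k g) s :=
  (hg.fderiv_of_isOpen hs (by simp)).clm_apply contDiffOn_const

lemma coeffFn_partialForm (k : Fin d) (f : Coord d → Lam d 𝕜) (S : Finset (Fin d)) :
    coeffFn (partialForm k f) S = partialDeriv k (coeffFn f S) := by
  funext y; exact repr_partialForm k f y S

lemma SmoothOn.partialForm (k : Fin d) {f : Coord d → Lam d 𝕜} {s : Set (Coord d)}
    (hs : IsOpen s) (hf : SmoothOn f s) : SmoothOn (partialForm k f) s := by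
  intro S
  rw [coeffFn_partialForm]
  exact contDiffOn_partialDeriv k hs (hf S)

lemma partialDeriv_comm {F : Type*} [NormedAddCommGroup F] [NormedSpace ℝ F] (k l : Fin d)
    {g : Coord d → F} {s : Set (Coord d)} (hs : IsOpen s) (hg : ContDiffOn ℝ ∞ g s) {y : Coord d}
    (hy : y ∈ s) : partialDeriv k (partialDeriv l g) y = partialDeriv l (partialDeriv k g) y := by
  have hd : DifferentiableAt ℝ (fderiv ℝ g) y :=
    ((hg.fderiv_of_isOpen hs (m := ∞) (by simp)).differentiableOn (by simp)).differentiableAt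
      (hs.mem_nhds hy)
  have hsymm : IsSymmSndFDerivAt ℝ g y :=
    (hg.contDiffAt (hs.mem_nhds hy)).isSymmSndFDerivAt (by
      simpa using WithTop.coe_le_coe.2 (le_top (a := (2 : ℕ∞))))
  have e : ∀ i j, partialDeriv i (partialDeriv j g) y =
      fderiv ℝ (fderiv ℝ g) y (EuclideanSpace.single i 1) (EuclideanSpace.single j 1) := by
    intro i j
    change fderiv ℝ (fun z => fderiv ℝ g z (EuclideanSpace.single j 1)) y _ = _
    rw [fderiv_clm_apply hd (differentiableAt_const _)]
    simp
  rw [e, e]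
  exact hsymm _ _

lemma partialForm_comm (k l : Fin d) {f : Coord d → Lam d 𝕜} {s : Set (Coord d)} (hs : IsOpen s)
    (hf : SmoothOn f s) {y : Coord d} (hy : y ∈ s) :
    partialForm k (partialForm l f) y = partialForm l (partialForm k f) y := by
  refine lam_ext fun S => ?_
  rw [repr_partialForm, repr_partialForm, coeffFn_partialForm, coeffFn_partialForm,
    partialDeriv_comm k l hs (hf S) hy]

end Calculus

/-! ### The algebra of smooth forms on an open set -/

section LocalForms

open TopologicalSpace Topology

variable {d : ℕ}

/-- The extension by zero of a form on an open set. -/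
def extendForm {𝕜 : Type*} [RCLike 𝕜] (U : Opens (Coord d)) (f : U → Lam d 𝕜) (y : Coord d) :
    Lam d 𝕜 :=
  open Classical in if h : y ∈ U then f ⟨y, h⟩ else 0

variable (𝕜 : Type*) [RCLike 𝕜] (U : Opens (Coord d))

variable {𝕜 U} in
lemma extendForm_apply (f : U → Lam d 𝕜) (y : U) : extendForm U f y = f y := by
  simp [extendForm]

variable {𝕜 U} in
lemma smoothOn_extendForm_iff {f : U → Lam d 𝕜} {g : Coord d → Lam d 𝕜}
    (h : ∀ y : U, f y = g y) : SmoothOn (extendForm U f) U ↔ SmoothOn g U := by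
  have : ∀ y ∈ U, extendForm U f y = g y := fun y hy => by
    rw [← h ⟨y, hy⟩]; exact extendForm_apply f ⟨y, hy⟩
  exact ⟨fun hf => hf.congr fun y hy => (this y hy).symm, fun hg => hg.congr this⟩

/-- The algebra of smooth forms on the open set `U`. Forms are functions on the subtype, so that
equality means equality on `U`; smoothness and derivatives refer to the extension by zero, which is
harmless since `U` is open. -/
def LocalForms : Subalgebra 𝕜 (U → Lam d 𝕜) where
  carrier := {f | SmoothOn (extendForm U f) U}
  mul_mem' {f g} hf hg :=
    (smoothOn_extendForm_iff (g := fun y => extendForm U f y * extendForm U g y)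
      fun y => by simp [extendForm_apply]).2 (hf.mul hg)
  add_mem' {f g} hf hg :=
    (smoothOn_extendForm_iff (g := fun y => extendForm U f y + extendForm U g y)
      fun y => by simp [extendForm_apply]).2 (hf.add hg)
  algebraMap_mem' r :=
    (smoothOn_extendForm_iff (g := fun y => algebraMap 𝕜 (Lam d 𝕜) r)
      fun y => rfl).2 (smoothOn_const _ _)

variable {𝕜 U}

namespace LocalForms

/-- The restriction to `U` of a form which is smooth on `U`. -/
def res (f : Coord d → Lam d 𝕜) (hf : SmoothOn f U) : LocalForms 𝕜 U :=
  ⟨fun y => f y, (smoothOn_extendForm_iff fun _ => rfl).2 hf⟩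

@[simp] lemma res_apply (f : Coord d → Lam d 𝕜) (hf : SmoothOn f U) (y : U) :
    (res f hf).1 y = f y := rfl

/-- A representative of a form on `U` on the whole of coordinate space. -/
def out (f : LocalForms 𝕜 U) : Coord d → Lam d 𝕜 := extendForm U f.1

lemma out_apply (f : LocalForms 𝕜 U) (y : U) : out f y = f.1 y := extendForm_apply _ _

lemma smoothOn_out (f : LocalForms 𝕜 U) : SmoothOn (out f) U := f.2

lemma formDiffAt_out (f : LocalForms 𝕜 U) (y : U) : FormDiffAt (out f) y :=
  (smoothOn_out f).formDiffAt U.2 y.2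

lemma ext {f g : LocalForms 𝕜 U} (h : ∀ y : U, f.1 y = g.1 y) : f = g :=
  Subtype.ext (funext h)

lemma partialForm_out (k : Fin d) {f : LocalForms 𝕜 U} {g : Coord d → Lam d 𝕜}
    (h : ∀ y : U, f.1 y = g y) (y : U) : partialForm k (out f) y = partialForm k g y :=
  partialForm_congr (Filter.eventuallyEq_of_mem (U.2.mem_nhds y.2) fun z hz => by
    rw [← h ⟨z, hz⟩]; exact out_apply f ⟨z, hz⟩) k

/-- Pointwise application of a linear map. -/
def mapLin (L : Lam d 𝕜 →ₗ[𝕜] Lam d 𝕜) : LocalForms 𝕜 U →ₗ[𝕜] LocalForms 𝕜 U where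
  toFun f := ⟨fun y => L (f.1 y), (smoothOn_extendForm_iff (g := fun y => L (out f y))
    fun y => by rw [out_apply]).2 ((smoothOn_out f).map L)⟩
  map_add' f g := ext fun y => map_add L _ _
  map_smul' c f := ext fun y => map_smul L _ _

@[simp] lemma mapLin_apply (L : Lam d 𝕜 →ₗ[𝕜] Lam d 𝕜) (f : LocalForms 𝕜 U) (y : U) :
    (mapLin L f).1 y = L (f.1 y) := rfl

/-- The partial derivative of forms on `U`. -/
def partialLin (k : Fin d) : LocalForms 𝕜 U →ₗ[𝕜] LocalForms 𝕜 U where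
  toFun f := res (partialForm k (out f)) ((smoothOn_out f).partialForm k U.2)
  map_add' f g := ext fun y => by
    change partialForm k (out (f + g)) y = partialForm k (out f) y + partialForm k (out g) y
    rw [← partialForm_add k (formDiffAt_out f y) (formDiffAt_out g y)]
    exact partialForm_out k (fun z => by simp [out_apply]) y
  map_smul' c f := ext fun y => by
    change partialForm k (out (c • f)) y = c • partialForm k (out f) y
    have := partialForm_map (c • LinearMap.id) k (formDiffAt_out f y)
    simp only [LinearMap.smul_apply, LinearMap.id_apply] at this
    rw [← this]
    exact partialForm_out k (fun z => by simp [out_apply]) y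

lemma partialLin_apply (k : Fin d) (f : LocalForms 𝕜 U) (y : U) :
    (partialLin k f).1 y = partialForm k (out f) y := rfl

lemma partialLin_of_eq (k : Fin d) {f : LocalForms 𝕜 U} {g : Coord d → Lam d 𝕜}
    (h : ∀ y : U, f.1 y = g y) (y : U) : (partialLin k f).1 y = partialForm k g y :=
  partialForm_out k h y

lemma partialLin_mapLin (L : Lam d 𝕜 →ₗ[𝕜] Lam d 𝕜) (k : Fin d) (f : LocalForms 𝕜 U) :
    partialLin k (mapLin L f) = mapLin L (partialLin k f) := ext fun y => by
  rw [mapLin_apply, partialLin_apply, partialLin_apply, ← partialForm_map L k (formDiffAt_out f y)]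
  exact partialForm_out k (fun z => by simp [out_apply]) y

variable (𝕜 U) in
/-- The Cartan calculus of smooth forms on an open subset of coordinate space. -/
def cartan : CartanCalculus 𝕜 d (LocalForms 𝕜 U) where
  inv := AlgHom.ofLinearMap (mapLin gradeInv.toLinearMap)
    (ext fun y => map_one (gradeInv (d := d) (𝕜 := 𝕜)))
    fun f g => ext fun y => map_mul (gradeInv (d := d) (𝕜 := 𝕜)) _ _
  pd := partialLin
  ip k := mapLin (intProd k)
  e k := res (fun _ => dx k) (smoothOn_const _ _)
  inv_inv f := ext fun y => gradeInv_gradeInv _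
  inv_e k := ext fun y => gradeInv_ι _
  e_mul k f := ext fun y => ι_mul_eq _ _
  inv_pd k f := (partialLin_mapLin _ k f).symm
  inv_ip k f := ext fun y => gradeInv_intProd _ _
  pd_mul k f g := ext fun y => by
    change partialForm k _ _ = partialForm k _ _ * g.1 y + f.1 y * partialForm k _ _
    rw [← out_apply, ← out_apply, ← partialForm_mul k (formDiffAt_out f y) (formDiffAt_out g y)]
    exact partialForm_out k (fun z => by simp [out_apply]) y
  pd_comm k l f := ext fun y => by
    rw [partialLin_of_eq k (partialLin_apply l f), partialLin_of_eq l (partialLin_apply k f)]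
    exact partialForm_comm k l U.2 (smoothOn_out f) y.2
  pd_e k l := ext fun y =>
    (partialLin_of_eq k (fun z => res_apply _ _ z) y).trans (partialForm_const k _ _)
  ip_mul k f g := ext fun y => intProd_mul _ _ _
  ip_e k l := ext fun y => by
    rw [mapLin_apply, res_apply, intProd_dx]
    split_ifs <;> rfl
  ip_pd k l f := (partialLin_mapLin _ _ _).symm

lemma pd_apply (k : Fin d) {f : LocalForms 𝕜 U} {g : Coord d → Lam d 𝕜}
    (h : ∀ y : U, f.1 y = g y) (y : U) : ((cartan 𝕜 U).pd k f).1 y = partialForm k g y :=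
  partialLin_of_eq k h y

@[simp] lemma ip_apply (k : Fin d) (f : LocalForms 𝕜 U) (y : U) :
    ((cartan 𝕜 U).ip k f).1 y = intProd k (f.1 y) := rfl

@[simp] lemma inv_apply (f : LocalForms 𝕜 U) (y : U) :
    ((cartan 𝕜 U).inv f).1 y = gradeInv (f.1 y) := rfl

@[simp] lemma e_apply (k : Fin d) (y : U) : ((cartan 𝕜 U).e k).1 y = dx k := rfl

@[simp] lemma mul_apply (f g : LocalForms 𝕜 U) (y : U) : (f * g).1 y = f.1 y * g.1 y := rfl

@[simp] lemma add_apply (f g : LocalForms 𝕜 U) (y : U) : (f + g).1 y = f.1 y + g.1 y := rfl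

@[simp] lemma sub_apply (f g : LocalForms 𝕜 U) (y : U) : (f - g).1 y = f.1 y - g.1 y := rfl

@[simp] lemma neg_apply (f : LocalForms 𝕜 U) (y : U) : (-f).1 y = -f.1 y := rfl

@[simp] lemma smul_apply (c : 𝕜) (f : LocalForms 𝕜 U) (y : U) : (c • f).1 y = c • f.1 y := rfl

variable (U) in
/-- Evaluation at a point. -/
def eval (y : U) : LocalForms 𝕜 U →ₗ[𝕜] Lam d 𝕜 :=
  LinearMap.proj y ∘ₗ (LocalForms 𝕜 U).val.toLinearMap

@[simp] lemma sum_apply {ι : Type*} (s : Finset ι) (f : ι → LocalForms 𝕜 U) (y : U) :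
    (∑ i ∈ s, f i).1 y = ∑ i ∈ s, (f i).1 y := map_sum (eval U y) f s

lemma d_apply {f : LocalForms 𝕜 U} {g : Coord d → Lam d 𝕜} (h : ∀ y : U, f.1 y = g y) (y : U) :
    ((cartan 𝕜 U).d f).1 y = extD g y := by
  rw [CartanCalculus.d_apply, sum_apply]
  exact Finset.sum_congr rfl fun k _ => by rw [mul_apply, pd_apply k h, e_apply]

end LocalForms

end LocalForms

/-! ### Connections and bivectors in coordinates -/

section Geometry

open TopologicalSpace Topology LocalForms

variable {d : ℕ} {𝕜 : Type*} [RCLike 𝕜] {U : Opens (Coord d)}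

/-- A smooth function as a form of degree zero. -/
def funForm (u : Coord d → 𝕜) (hu : ContDiffOn ℝ ∞ u U) : LocalForms 𝕜 U :=
  res (fun y => u y • 1) ((smoothOn_const 1 _).smul hu)

@[simp] lemma funForm_apply (u : Coord d → 𝕜) (hu : ContDiffOn ℝ ∞ u U) (y : U) :
    (funForm u hu).1 y = u y • 1 := rfl

lemma isFun_funForm (u : Coord d → 𝕜) (hu : ContDiffOn ℝ ∞ u U) :
    (cartan 𝕜 U).IsFun (funForm u hu) where
  comm f := LocalForms.ext fun y => by simp
  inv := LocalForms.ext fun y => by simp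
  ip k := LocalForms.ext fun y => by
    have := intProd_algebraMap k (u y)
    rw [Algebra.algebraMap_eq_smul_one] at this
    exact this

lemma pd_funForm (u : Coord d → 𝕜) (hu : ContDiffOn ℝ ∞ u U) (k : Fin d) (y : U) :
    ((cartan 𝕜 U).pd k (funForm u hu)).1 y = partialDeriv k u y • 1 := by
  rw [pd_apply k (g := fun y => u y • 1) (fun z => funForm_apply u hu z), partialForm_smul k
    ((hu.differentiableOn (by simp)).differentiableAt (U.2.mem_nhds y.2))
    ((smoothOn_const 1 _).formDiffAt U.2 y.2), partialForm_const, smul_zero, add_zero]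

lemma contDiffOn_ofReal {g : Coord d → ℝ} {s : Set (Coord d)} (hg : ContDiffOn ℝ ∞ g s) :
    ContDiffOn ℝ ∞ (fun y => ((g y : ℝ) : 𝕜)) s :=
  (RCLike.ofRealCLM (K := 𝕜)).contDiff.comp_contDiffOn hg

lemma partialDeriv_ofReal {g : Coord d → ℝ} {y : Coord d} (hg : DifferentiableAt ℝ g y)
    (k : Fin d) :
    partialDeriv k (fun y => ((g y : ℝ) : 𝕜)) y = ((partialDeriv k g y : ℝ) : 𝕜) := by
  have : fderiv ℝ (fun y => ((g y : ℝ) : 𝕜)) y = (RCLike.ofRealCLM (K := 𝕜)) ∘L fderiv ℝ g y :=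
    ((RCLike.ofRealCLM (K := 𝕜)).hasFDerivAt.comp y hg.hasFDerivAt).fderiv
  rw [partialDeriv, this]
  rfl

/-- The connection forms `θˢᵢ = Γˢᵢₜ dxᵗ`. -/
def thetaForm (Γ : ChristoffelSystem d) (s i : Fin d) (y : Coord d) : Lam d 𝕜 :=
  ∑ t, ((Γ s i t y : ℝ) : 𝕜) • dx t

variable (Γ : ChristoffelSystem d) (w : BivectorComponents d)

/-- Smoothness of Christoffel symbols, smoothness and antisymmetry of a bivector, and
Poisson-compatibility on the open set `U`. -/
structure LocalData (U : Opens (Coord d)) : Prop where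
  smooth_gamma : ∀ i j k, ContDiffOn ℝ ∞ (Γ i j k) U
  smooth_biv : ∀ i j, ContDiffOn ℝ ∞ (w i j) U
  antisymm : ∀ i j, ∀ y ∈ U, w i j y = -w j i y
  compat : ∀ y ∈ U, CompatibleAt w Γ y

variable {Γ w}

namespace LocalData

lemma smooth_theta (h : LocalData Γ w U) (s i : Fin d) :
    SmoothOn (thetaForm (𝕜 := 𝕜) Γ s i) U :=
  SmoothOn.sum _ fun t _ => (smoothOn_const _ _).smul (contDiffOn_ofReal (h.smooth_gamma s i t))

variable (𝕜) in
/-- The connection forms as elements of the Cartan calculus. -/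
def theta (h : LocalData Γ w U) (s i : Fin d) : LocalForms 𝕜 U :=
  res (thetaForm Γ s i) (h.smooth_theta s i)

variable (𝕜) in
/-- The bivector components as elements of the Cartan calculus. -/
def biv (h : LocalData Γ w U) (i j : Fin d) : LocalForms 𝕜 U :=
  funForm (fun y => ((w i j y : ℝ) : 𝕜)) (contDiffOn_ofReal (h.smooth_biv i j))

lemma theta_apply (h : LocalData Γ w U) (s i : Fin d) (y : U) :
    (h.theta 𝕜 s i).1 y = ∑ t, ((Γ s i t y : ℝ) : 𝕜) • dx t := rfl

@[simp] lemma biv_apply (h : LocalData Γ w U) (i j : Fin d) (y : U) :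
    (h.biv 𝕜 i j).1 y = ((w i j y : ℝ) : 𝕜) • 1 := rfl

lemma isOdd_theta (h : LocalData Γ w U) (s i : Fin d) :
    (cartan 𝕜 U).IsOdd (h.theta 𝕜 s i) where
  inv := LocalForms.ext fun y => by
    simp only [inv_apply, LocalForms.neg_apply, theta_apply, map_sum, map_smul, dx, gradeInv_ι,
      smul_neg, Finset.sum_neg_distrib]
  comm f := LocalForms.ext fun y => by
    simp only [mul_apply, inv_apply, theta_apply, Finset.sum_mul, Finset.mul_sum, dx,
      smul_mul_assoc, mul_smul_comm, ι_mul_eq]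

/-- Poisson-compatibility in components. -/
lemma partialDeriv_biv (h : LocalData Γ w U) (i j l : Fin d) {y : Coord d} (hy : y ∈ U) :
    partialDeriv l (w i j) y =
      -∑ k, Γ i k l y * w k j y - ∑ k, Γ j k l y * w i k y := by
  have hd : DifferentiableAt ℝ (w i j) y :=
    ((h.smooth_biv i j).differentiableOn (by simp)).differentiableAt (U.2.mem_nhds hy)
  have h1 : extD (𝕜 := ℝ) (fun z => algebraMap ℝ (Lam d ℝ) (w i j z)) y =
      ∑ l, partialDeriv l (w i j) y • dx l := by
    refine Finset.sum_congr rfl fun l _ => ?_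
    simp only [Algebra.algebraMap_eq_smul_one]
    rw [partialForm_smul l hd ((smoothOn_const 1 _).formDiffAt U.2 hy), partialForm_const]
    simp
  have h2 : ∀ k i, nablaForm (𝕜 := ℝ) Γ k (fun _ => dx i) y = -∑ l, Γ i k l y • dx l := by
    intro k i
    simp only [nablaForm, partialForm_const, zero_sub, intProd_dx, neg_inj]
    simp [Finset.sum_ite_eq']
  have h3 := h.compat y hy i j
  rw [h1] at h3
  simp only [h2, smul_neg, Finset.sum_neg_distrib, sub_neg_eq_add, Finset.smul_sum, smul_smul] at h3
  rw [Finset.sum_comm (f := fun k l => (w k j y * Γ i k l y) • dx l),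
    Finset.sum_comm (f := fun k l => (w i k y * Γ j k l y) • dx l)] at h3
  simp only [← Finset.sum_smul, ← Finset.sum_add_distrib, ← add_smul] at h3
  rw [← ι_eq_sum (fun l => partialDeriv l (w i j) y + ∑ k, w k j y * Γ i k l y +
    ∑ k, w i k y * Γ j k l y), ExteriorAlgebra.ι_eq_zero_iff] at h3
  have h4 := congrFun h3 l
  simp only [Pi.zero_apply] at h4
  simp only [mul_comm (Γ _ _ _ _)]
  linarith

lemma compatible (h : LocalData Γ w U) :
    (cartan 𝕜 U).Compatible (h.theta 𝕜) (h.biv 𝕜) where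
  isOdd := h.isOdd_theta
  isFun i j := isFun_funForm _ _
  antisymm i j := LocalForms.ext fun y => by
    simp [h.antisymm i j y y.2]
  d_eq i j := LocalForms.ext fun y => by
    have hd : DifferentiableAt ℝ (w i j) y :=
      ((h.smooth_biv i j).differentiableOn (by simp)).differentiableAt (U.2.mem_nhds y.2)
    simp only [CartanCalculus.d_apply, LocalForms.sum_apply, mul_apply, biv, pd_funForm,
      partialDeriv_ofReal hd, h.partialDeriv_biv i j _ y.2, e_apply, LocalForms.sub_apply,
      LocalForms.neg_apply, theta_apply, funForm_apply, mul_smul_one, Finset.smul_sum]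
    push_cast
    simp only [sub_smul, neg_smul, Finset.sum_smul, Finset.sum_sub_distrib, Finset.sum_neg_distrib,
      smul_smul]
    rw [Finset.sum_comm (f := fun l k => (((Γ i k l y : ℝ) : 𝕜) * ((w k j y : ℝ) : 𝕜)) • dx l),
      Finset.sum_comm (f := fun l k => (((Γ j k l y : ℝ) : 𝕜) * ((w i k y : ℝ) : 𝕜)) • dx l)]
    simp only [mul_comm]

lemma nabla_apply (h : LocalData Γ w U) (k : Fin d) {f : LocalForms 𝕜 U} {g : Coord d → Lam d 𝕜}
    (hg : ∀ y : U, f.1 y = g y) (y : U) :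
    ((cartan 𝕜 U).nabla (h.theta 𝕜) k f).1 y = nablaForm Γ k g y := by
  simp only [CartanCalculus.nabla_apply, LocalForms.sub_apply, pd_apply k hg, LocalForms.sum_apply,
    mul_apply, theta_apply, ip_apply, hg, nablaForm, Finset.sum_mul, smul_mul_assoc]

lemma curv_apply (h : LocalData Γ w U) (r i : Fin d) (y : U) :
    ((cartan 𝕜 U).curv (h.theta 𝕜) r i).1 y = ∑ m, ∑ n,
      ((partialDeriv m (Γ r i n) y + ∑ k, Γ r k m y * Γ k i n y : ℝ) : 𝕜) • (dx m * dx n) := by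
  have hd : ∀ r i n, DifferentiableAt ℝ (Γ r i n) y := fun r i n =>
      ((h.smooth_gamma r i n).differentiableOn (by simp)).differentiableAt (U.2.mem_nhds y.2)
  have h1 : ∀ m, ((cartan 𝕜 U).pd m (h.theta 𝕜 r i)).1 y =
      ∑ n, ((partialDeriv m (Γ r i n) y : ℝ) : 𝕜) • dx n := by
    intro m
    have e : h.theta 𝕜 r i = ∑ n, funForm (fun y => ((Γ r i n y : ℝ) : 𝕜))
        (contDiffOn_ofReal (h.smooth_gamma r i n)) * (cartan 𝕜 U).e n :=
      LocalForms.ext fun y => by simp [theta_apply]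
    rw [e, map_sum, LocalForms.sum_apply]
    refine Finset.sum_congr rfl fun n _ => ?_
    rw [(cartan 𝕜 U).pd_mul, (cartan 𝕜 U).pd_e, LocalForms.add_apply, mul_apply, mul_apply,
      pd_funForm, partialDeriv_ofReal (hd r i n)]
    simp
  simp only [CartanCalculus.curv, CartanCalculus.d_apply, LocalForms.add_apply,
    LocalForms.sum_apply, mul_apply, h1, e_apply, theta_apply, Finset.mul_sum, Finset.sum_mul,
    mul_smul_comm, smul_mul_assoc]
  push_cast
  simp only [add_smul, Finset.sum_add_distrib, Finset.sum_smul]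
  congr 1
  simp only [Finset.smul_sum, smul_smul]
  rw [Finset.sum_comm, Finset.sum_congr rfl fun n _ => Finset.sum_comm, Finset.sum_comm]
  simp only [mul_comm]

/-- The forms `-½ ωⁱˢ Fʲₛ` are the forms `Hⁱʲ` defined by torsion and curvature. -/
lemma hform_apply (h : LocalData Γ w U) (i j : Fin d) (y : U) :
    ((cartan 𝕜 U).hform (h.theta 𝕜) (h.biv 𝕜) i j).1 y = hForm 𝕜 w Γ i j y := by
  have hd : ∀ r i n, DifferentiableAt ℝ (Γ r i n) y := fun r i n =>
      ((h.smooth_gamma r i n).differentiableOn (by simp)).differentiableAt (U.2.mem_nhds y.2)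
  rw [eq_comm, ← sub_eq_zero]
  simp only [CartanCalculus.hform, LocalForms.smul_apply, LocalForms.sum_apply, mul_apply, biv_apply,
    h.curv_apply, hForm, smul_mul_assoc, one_mul, Finset.smul_sum, smul_smul,
    ← Finset.sum_sub_distrib, ← sub_smul]
  refine Finset.sum_eq_zero fun s _ => sum_smul_dx_mul_dx_symm _ fun m n => ?_
  -- The coefficients of `dxᵐ ∧ dxⁿ` differ by an expression which is symmetric in `m` and `n`.
  have e : torsionDeriv Γ j n m s y - 2 * curvature Γ j n m s y
      + 2 * (partialDeriv m (Γ j s n) y + ∑ k, Γ j k m y * Γ k s n y) =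
      torsionDeriv Γ j m n s y - 2 * curvature Γ j m n s y
      + 2 * (partialDeriv n (Γ j s m) y + ∑ k, Γ j k n y * Γ k s m y) := by
    have ht : ∀ a b, partialDeriv s (torsion Γ j a b) y =
        partialDeriv s (Γ j a b) y - partialDeriv s (Γ j b a) y := fun a b => by
      have : torsion Γ j a b = fun z => Γ j a b z - Γ j b a z := rfl
      rw [partialDeriv, this, fderiv_fun_sub (hd _ _ _) (hd _ _ _)]
      rfl
    simp only [torsionDeriv, curvature, ht]
    simp only [torsion, mul_sub, mul_comm (Γ _ s _ y)]
    simp only [sub_mul, Finset.sum_sub_distrib]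
    ring
  have e' := congrArg (fun x : ℝ => ((1 / 4 * (w i s y * x) : ℝ) : 𝕜)) e
  push_cast at e' ⊢
  linear_combination e'

lemma brQ_apply (h : LocalData Γ w U) {f f' : LocalForms 𝕜 U} {g g' : Coord d → Lam d 𝕜}
    (hg : ∀ y : U, f.1 y = g y) (hg' : ∀ y : U, f'.1 y = g' y) (y : U) :
    ((cartan 𝕜 U).brQ (h.theta 𝕜) (h.biv 𝕜) f f').1 y = wedgeQCoeff w Γ g g' y := by
  simp only [CartanCalculus.brQ_apply, LocalForms.sum_apply, LocalForms.smul_apply, mul_apply,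
    h.nabla_apply _ hg, h.nabla_apply _ hg', biv_apply, wedgeQCoeff, smul_mul_assoc, one_mul,
    smul_smul]
  push_cast
  rfl

lemma br_apply (h : LocalData Γ w U) {f f' : LocalForms 𝕜 U} {g g' : Coord d → Lam d 𝕜}
    (hg : ∀ y : U, f.1 y = g y) (hg' : ∀ y : U, f'.1 y = g' y) (y : U) :
    ((cartan 𝕜 U).br (h.theta 𝕜) (h.biv 𝕜) f f').1 y = wedgeQCoeff w Γ g g' y +
      ∑ i, ∑ j, hForm 𝕜 w Γ i j y * gradeInv (intProd i (g y)) * intProd j (g' y) := by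
  simp only [CartanCalculus.br_apply, LocalForms.add_apply, h.brQ_apply hg hg',
    LocalForms.sum_apply, mul_apply, h.hform_apply, inv_apply, ip_apply, hg, hg']

end LocalData

/-- The sign in the first-order term of the product, absorbed into the grade involution. -/
lemma wedgeOneCoeff_eq {p : ℕ} {w : BivectorComponents d} {Γ : ChristoffelSystem d}
    {f g : Coord d → Lam d 𝕜} {y : Coord d} (hf : gradeInv (f y) = (-1 : 𝕜) ^ p • f y) :
    wedgeOneCoeff w Γ p f g y = wedgeQCoeff w Γ f g y +
      ∑ i, ∑ j, hForm 𝕜 w Γ i j y * gradeInv (intProd i (f y)) * intProd j (g y) := by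
  simp only [wedgeOneCoeff, gradeInv_intProd, hf, map_smul, Finset.smul_sum]
  congr 1
  refine Finset.sum_congr rfl fun i _ => Finset.sum_congr rfl fun j _ => ?_
  rw [← smul_neg, mul_smul_comm, smul_mul_assoc, pow_succ, mul_neg_one, neg_smul, mul_neg, neg_mul,
    smul_neg]

end Geometry

/-! ### Pullback along a change of coordinates -/

section Pullback

open TopologicalSpace Topology LocalForms

variable {d : ℕ} {𝕜 : Type*} [RCLike 𝕜] {U V : Opens (Coord d)}

/-- A smooth map between open subsets of coordinate space. -/
structure SmoothMap (U V : Opens (Coord d)) where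
  toFun : Coord d → Coord d
  smooth : ContDiffOn ℝ ∞ toFun U
  maps : ∀ y ∈ U, toFun y ∈ V

namespace SmoothMap

variable (τ : SmoothMap U V)

lemma smooth_comp (a : Fin d) : ContDiffOn ℝ ∞ (fun y => τ.toFun y a) U :=
  (EuclideanSpace.proj (𝕜 := ℝ) a : Coord d →L[ℝ] ℝ).contDiff.comp_contDiffOn τ.smooth

/-- The matrix `∂ₖ τᵃ`. -/
def jac (k a : Fin d) (y : Coord d) : ℝ := partialDeriv k (fun z => τ.toFun z a) y

lemma smooth_jac (k a : Fin d) : ContDiffOn ℝ ∞ (τ.jac k a) U :=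
  contDiffOn_partialDeriv k U.2 (τ.smooth_comp a)

lemma differentiableAt_comp (a : Fin d) {y : Coord d} (hy : y ∈ U) :
    DifferentiableAt ℝ (fun z => τ.toFun z a) y :=
  ((τ.smooth_comp a).differentiableOn (by simp)).differentiableAt (U.2.mem_nhds hy)

lemma partialDeriv_comp {u : Coord d → 𝕜} (hu : ContDiffOn ℝ ∞ u V) (k : Fin d) {y : Coord d}
    (hy : y ∈ U) : partialDeriv k (fun z => u (τ.toFun z)) y =
      ∑ a, ((τ.jac k a y : ℝ) : 𝕜) * partialDeriv a u (τ.toFun y) := by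
  have h1 : DifferentiableAt ℝ τ.toFun y :=
    (τ.smooth.differentiableOn (by simp)).differentiableAt (U.2.mem_nhds hy)
  have h2 : DifferentiableAt ℝ u (τ.toFun y) :=
    (hu.differentiableOn (by simp)).differentiableAt (V.2.mem_nhds (τ.maps y hy))
  have h3 : ∀ a, τ.jac k a y = fderiv ℝ τ.toFun y (EuclideanSpace.single k 1) a := fun a => by
    have := ((EuclideanSpace.proj (𝕜 := ℝ) a : Coord d →L[ℝ] ℝ).hasFDerivAt.comp y
      h1.hasFDerivAt).fderiv
    change fderiv ℝ (fun z => τ.toFun z a) y _ = _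
    rw [show (fun z => τ.toFun z a) = (EuclideanSpace.proj (𝕜 := ℝ) a : Coord d →L[ℝ] ℝ) ∘ τ.toFun
      from rfl, this]
    rfl
  have h4 : fderiv ℝ τ.toFun y (EuclideanSpace.single k 1) =
      ∑ a, τ.jac k a y • EuclideanSpace.single a (1 : ℝ) := by
    ext b
    simp [h3, Pi.single_apply]
  have h5 : partialDeriv k (fun z => u (τ.toFun z)) y =
      fderiv ℝ u (τ.toFun y) (fderiv ℝ τ.toFun y (EuclideanSpace.single k 1)) := by
    rw [partialDeriv, show (fun z => u (τ.toFun z)) = u ∘ τ.toFun from rfl, fderiv_comp y h2 h1]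
    rfl
  rw [h5, h4, map_sum]
  refine Finset.sum_congr rfl fun a _ => ?_
  rw [map_smul, RCLike.real_smul_eq_coe_mul]
  rfl

variable (𝕜)

/-- The components of `τ` as elements of the Cartan calculus on `U`. -/
def coord (a : Fin d) : LocalForms 𝕜 U :=
  funForm (fun y => ((τ.toFun y a : ℝ) : 𝕜)) (contDiffOn_ofReal (τ.smooth_comp a))

lemma isFun_coord (a : Fin d) : (cartan 𝕜 U).IsFun (τ.coord 𝕜 a) := isFun_funForm _ _

lemma pd_coord (k a : Fin d) (y : U) :
    ((cartan 𝕜 U).pd k (τ.coord 𝕜 a)).1 y = ((τ.jac k a y : ℝ) : 𝕜) • 1 := by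
  rw [coord, pd_funForm, partialDeriv_ofReal (τ.differentiableAt_comp a y.2)]
  rfl

lemma pd_pd_coord (l k a : Fin d) (y : U) :
    ((cartan 𝕜 U).pd l ((cartan 𝕜 U).pd k (τ.coord 𝕜 a))).1 y =
      ((partialDeriv l (τ.jac k a) y : ℝ) : 𝕜) • 1 := by
  have : (cartan 𝕜 U).pd k (τ.coord 𝕜 a) =
      funForm (fun y => ((τ.jac k a y : ℝ) : 𝕜)) (contDiffOn_ofReal (τ.smooth_jac k a)) :=
    LocalForms.ext fun y => τ.pd_coord 𝕜 k a y
  rw [this, pd_funForm, partialDeriv_ofReal]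
  exact ((τ.smooth_jac k a).differentiableOn (by simp)).differentiableAt (U.2.mem_nhds y.2)

/-- The pullback of forms with constant coefficients: the homomorphism of algebras with
`dxᵃ ↦ dτᵃ`. -/
def pullConst : Lam d 𝕜 →ₐ[𝕜] LocalForms 𝕜 U :=
  ExteriorAlgebra.lift 𝕜 ⟨∑ a, (LinearMap.proj a : (Fin d → 𝕜) →ₗ[𝕜] 𝕜).smulRight
      ((cartan 𝕜 U).d (τ.coord 𝕜 a)), fun v => by
    have h : (cartan 𝕜 U).IsOdd (∑ a, v a • (cartan 𝕜 U).d (τ.coord 𝕜 a)) :=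
      CartanCalculus.IsOdd.sum _ fun a => (τ.isFun_coord 𝕜 a).isOdd_d.smul _
    simpa only [LinearMap.sum_apply, LinearMap.smulRight_apply, LinearMap.proj_apply] using
      h.mul_self⟩

lemma pullConst_ι (v : Fin d → 𝕜) :
    τ.pullConst 𝕜 (ExteriorAlgebra.ι 𝕜 v) = ∑ a, v a • (cartan 𝕜 U).d (τ.coord 𝕜 a) := by
  simp [pullConst]

lemma pullConst_dx (a : Fin d) : τ.pullConst 𝕜 (dx a) = (cartan 𝕜 U).d (τ.coord 𝕜 a) := by
  rw [dx, pullConst_ι]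
  simp [Pi.single_apply]

lemma pullConst_gradeInv (x : Lam d 𝕜) :
    τ.pullConst 𝕜 (gradeInv x) = (cartan 𝕜 U).inv (τ.pullConst 𝕜 x) := by
  have : (τ.pullConst 𝕜).comp gradeInv = (cartan 𝕜 U).inv.comp (τ.pullConst 𝕜) := by
    refine ExteriorAlgebra.hom_ext (LinearMap.ext fun v => ?_)
    simp only [LinearMap.comp_apply, AlgHom.toLinearMap_apply, AlgHom.comp_apply, gradeInv_ι,
      map_neg, pullConst_ι, map_sum, map_smul, (τ.isFun_coord 𝕜 _).isOdd_d.inv, smul_neg,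
      Finset.sum_neg_distrib]
  exact congrArg (fun F => F x) this

lemma ip_pullConst (k : Fin d) (x : Lam d 𝕜) :
    (cartan 𝕜 U).ip k (τ.pullConst 𝕜 x) =
      ∑ a, (cartan 𝕜 U).pd k (τ.coord 𝕜 a) * τ.pullConst 𝕜 (intProd a x) := by
  have hc : ∀ a y z, (cartan 𝕜 U).pd k (τ.coord 𝕜 a) * (y * z) =
      y * ((cartan 𝕜 U).pd k (τ.coord 𝕜 a) * z) := fun a y z => by
    rw [← mul_assoc, ((τ.isFun_coord 𝕜 a).pd k).comm, mul_assoc]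
  induction x using ExteriorAlgebra.induction with
  | algebraMap r =>
    rw [AlgHom.commutes]
    simp only [intProd_algebraMap, map_zero, mul_zero, Finset.sum_const_zero]
    exact LocalForms.ext fun y => intProd_algebraMap k r
  | ι v =>
    have h : ∀ a, (cartan 𝕜 U).ip k ((cartan 𝕜 U).d (τ.coord 𝕜 a)) =
        (cartan 𝕜 U).pd k (τ.coord 𝕜 a) := fun a => by
      rw [← CartanCalculus.d_ip, (τ.isFun_coord 𝕜 a).ip, map_zero, zero_add]
    simp only [pullConst_ι, map_sum, map_smul, h, intProd_ι, Algebra.algebraMap_eq_smul_one,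
      map_one, mul_smul_one]
  | mul x y hx hy =>
    simp only [map_mul, CartanCalculus.ip_mul, hx, hy, intProd_mul, map_add, mul_add,
      Finset.sum_add_distrib, Finset.sum_mul, Finset.mul_sum, pullConst_gradeInv, mul_assoc, hc]
  | add x y hx hy => simp only [map_add, hx, hy, mul_add, Finset.sum_add_distrib]

lemma pd_pullConst (k : Fin d) (x : Lam d 𝕜) :
    (cartan 𝕜 U).pd k (τ.pullConst 𝕜 x) =
      ∑ a, (cartan 𝕜 U).d ((cartan 𝕜 U).pd k (τ.coord 𝕜 a)) * τ.pullConst 𝕜 (intProd a x) := by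
  have hc : ∀ a y z, (cartan 𝕜 U).d ((cartan 𝕜 U).pd k (τ.coord 𝕜 a)) *
      ((cartan 𝕜 U).inv y * z) =
      y * ((cartan 𝕜 U).d ((cartan 𝕜 U).pd k (τ.coord 𝕜 a)) * z) := fun a y z => by
    rw [← mul_assoc, ((τ.isFun_coord 𝕜 a).pd k).isOdd_d.comm, CartanCalculus.inv_inv, mul_assoc]
  induction x using ExteriorAlgebra.induction with
  | algebraMap r =>
    rw [AlgHom.commutes]
    simp only [intProd_algebraMap, map_zero, mul_zero, Finset.sum_const_zero]
    exact LocalForms.ext fun y => (LocalForms.pd_apply k (g := fun _ => algebraMap 𝕜 _ r)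
      (fun z => rfl) y).trans (partialForm_const _ _ _)
  | ι v =>
    simp only [pullConst_ι, map_sum, map_smul, CartanCalculus.d_pd, intProd_ι,
      Algebra.algebraMap_eq_smul_one, map_one, mul_smul_one]
  | mul x y hx hy =>
    simp only [map_mul, CartanCalculus.pd_mul, hx, hy, intProd_mul, map_add, mul_add,
      Finset.sum_add_distrib, Finset.sum_mul, Finset.mul_sum, pullConst_gradeInv, mul_assoc, hc]
  | add x y hx hy => simp only [map_add, hx, hy, mul_add, Finset.sum_add_distrib]

variable {𝕜} in
lemma smoothOn_pull (f : LocalForms 𝕜 V) : SmoothOn (extendForm U fun y =>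
    (τ.pullConst 𝕜 (f.1 ⟨τ.toFun y, τ.maps y y.2⟩)).1 y) U := by
  have h : ∀ y : U, (τ.pullConst 𝕜 (f.1 ⟨τ.toFun y, τ.maps y y.2⟩)).1 y =
      ∑ S, coeffFn (out f) S (τ.toFun y) • out (τ.pullConst 𝕜 (monomials d 𝕜 S)) y := fun y => by
    rw [← out_apply f]
    conv_lhs => rw [← (monomials d 𝕜).sum_repr (out f _)]
    simp only [map_sum, map_smul, LocalForms.sum_apply, LocalForms.smul_apply, out_apply, coeffFn]
  exact (smoothOn_extendForm_iff h).2 (SmoothOn.sum _ fun S _ => (smoothOn_out _).smul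
    ((smoothOn_out f S).comp τ.smooth τ.maps))

/-- The pullback of forms: at `y`, the pullback of the constant form with the value at `τ y`. -/
def pull : LocalForms 𝕜 V →ₐ[𝕜] LocalForms 𝕜 U :=
  AlgHom.ofLinearMap
    { toFun f := ⟨fun y => (τ.pullConst 𝕜 (f.1 ⟨τ.toFun y, τ.maps y y.2⟩)).1 y, τ.smoothOn_pull f⟩
      map_add' f g := LocalForms.ext fun y => by
        simp only [LocalForms.add_apply, map_add]
      map_smul' c f := LocalForms.ext fun y => by
        simp only [LocalForms.smul_apply, map_smul, RingHom.id_apply] }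
    (LocalForms.ext fun y => by
      change ((τ.pullConst 𝕜) 1).1 y = 1
      rw [map_one]; rfl)
    fun f g => LocalForms.ext fun y => by
      simp only [LinearMap.coe_mk, AddHom.coe_mk, mul_apply, map_mul]

lemma pull_apply (f : LocalForms 𝕜 V) (y : U) :
    (τ.pull 𝕜 f).1 y = (τ.pullConst 𝕜 (f.1 ⟨τ.toFun y, τ.maps y y.2⟩)).1 y := rfl

end SmoothMap

variable (𝕜 U) in
/-- Forms with constant coefficients. -/
def constForm (a : Lam d 𝕜) : LocalForms 𝕜 U := res (fun _ => a) (smoothOn_const a _)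

lemma eq_sum_funForm_mul (f : LocalForms 𝕜 U) :
    f = ∑ S, funForm (coeffFn (out f) S) (smoothOn_out f S) * constForm 𝕜 U (monomials d 𝕜 S) :=
  LocalForms.ext fun y => by
    conv_lhs => rw [← (monomials d 𝕜).sum_repr (f.1 y)]
    simp only [LocalForms.sum_apply, mul_apply, funForm_apply, coeffFn, out_apply, constForm,
      res_apply, smul_mul_assoc, one_mul]

namespace SmoothMap

variable (𝕜) (τ : SmoothMap U V)

lemma pull_constForm (a : Lam d 𝕜) : τ.pull 𝕜 (constForm 𝕜 V a) = τ.pullConst 𝕜 a := rfl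

lemma pull_funForm (u : Coord d → 𝕜) (hu : ContDiffOn ℝ ∞ u V) :
    τ.pull 𝕜 (funForm u hu) = funForm (fun y => u (τ.toFun y)) (hu.comp τ.smooth τ.maps) :=
  LocalForms.ext fun y => by
    rw [pull_apply, funForm_apply, map_smul, map_one]; rfl

/-- The chain rule. By linearity it suffices to consider `u · a` for a function `u` and a form `a`
with constant coefficients. -/
lemma pd_pull (k : Fin d) (f : LocalForms 𝕜 V) : (cartan 𝕜 U).pd k (τ.pull 𝕜 f) =
    ∑ a, (cartan 𝕜 U).pd k (τ.coord 𝕜 a) * τ.pull 𝕜 ((cartan 𝕜 V).pd a f)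
    + ∑ a, (cartan 𝕜 U).d ((cartan 𝕜 U).pd k (τ.coord 𝕜 a)) * τ.pull 𝕜 ((cartan 𝕜 V).ip a f) := by
  have key : ∀ (u : Coord d → 𝕜) (hu : ContDiffOn ℝ ∞ u V) (x : Lam d 𝕜),
      (cartan 𝕜 U).pd k (τ.pull 𝕜 (funForm u hu * constForm 𝕜 V x)) =
    ∑ a, (cartan 𝕜 U).pd k (τ.coord 𝕜 a) *
        τ.pull 𝕜 ((cartan 𝕜 V).pd a (funForm u hu * constForm 𝕜 V x))
    + ∑ a, (cartan 𝕜 U).d ((cartan 𝕜 U).pd k (τ.coord 𝕜 a)) *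
        τ.pull 𝕜 ((cartan 𝕜 V).ip a (funForm u hu * constForm 𝕜 V x)) := by
    intro u hu x
    have h1 : (cartan 𝕜 U).pd k (τ.pull 𝕜 (funForm u hu)) =
        ∑ a, (cartan 𝕜 U).pd k (τ.coord 𝕜 a) * τ.pull 𝕜 ((cartan 𝕜 V).pd a (funForm u hu)) :=
      LocalForms.ext fun y => by
        rw [pull_funForm, pd_funForm, τ.partialDeriv_comp hu k y.2, LocalForms.sum_apply,
          Finset.sum_smul]
        refine Finset.sum_congr rfl fun a _ => ?_
        rw [mul_apply, τ.pd_coord 𝕜, pull_apply, pd_funForm, map_smul, map_one, smul_mul_assoc,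
          one_mul, mul_smul]
        rfl
    have h2 : ∀ a, (cartan 𝕜 V).pd a (constForm 𝕜 V x) = 0 := fun a => LocalForms.ext fun y =>
      (LocalForms.pd_apply a (g := fun _ => x) (fun z => rfl) y).trans (partialForm_const _ _ _)
    have h3 : ∀ a, (cartan 𝕜 V).ip a (funForm u hu * constForm 𝕜 V x) =
        funForm u hu * constForm 𝕜 V (intProd a x) := fun a => by
      rw [CartanCalculus.ip_mul, (isFun_funForm u hu).ip, (isFun_funForm u hu).inv, zero_mul,
        zero_add]
      rfl
    have hF : (cartan 𝕜 U).IsFun (τ.pull 𝕜 (funForm u hu)) := by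
      rw [pull_funForm]; exact isFun_funForm _ _
    have hc : ∀ y z : LocalForms 𝕜 U, y * (τ.pull 𝕜 (funForm u hu) * z) =
        τ.pull 𝕜 (funForm u hu) * (y * z) := fun y z => by
      rw [← mul_assoc, ← hF.comm, mul_assoc]
    simp only [h3, CartanCalculus.pd_mul, h2, mul_zero, add_zero, map_mul, h1, pull_constForm,
      pd_pullConst, Finset.sum_mul, Finset.mul_sum, mul_assoc, hc]
  rw [eq_sum_funForm_mul f]
  simp only [map_sum, key, Finset.mul_sum, Finset.sum_add_distrib]
  congr 1 <;> exact Finset.sum_comm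

/-- The change of coordinates of Cartan calculi given by a smooth map. -/
def coordChange : (cartan 𝕜 U).CoordChange (cartan 𝕜 V) where
  T := τ.pull 𝕜
  X := τ.coord 𝕜
  X' a := funForm (fun y => ((y a : ℝ) : 𝕜))
    (contDiffOn_ofReal (EuclideanSpace.proj (𝕜 := ℝ) a : Coord d →L[ℝ] ℝ).contDiff.contDiffOn)
  isFun_X := τ.isFun_coord 𝕜
  isFun_X' a := isFun_funForm _ _
  pd_X' a b := LocalForms.ext fun y => by
    have hd : HasFDerivAt (fun z : Coord d => z b) (EuclideanSpace.proj (𝕜 := ℝ) b) y.1 :=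
      (EuclideanSpace.proj (𝕜 := ℝ) b : Coord d →L[ℝ] ℝ).hasFDerivAt
    rw [pd_funForm, partialDeriv_ofReal hd.differentiableAt, partialDeriv, hd.fderiv]
    rw [show (EuclideanSpace.proj (𝕜 := ℝ) b : Coord d →L[ℝ] ℝ) (EuclideanSpace.single a 1) =
      if a = b then 1 else 0 by simp [eq_comm]]
    split_ifs
    · rw [RCLike.ofReal_one, one_smul]; rfl
    · rw [RCLike.ofReal_zero, zero_smul]; rfl
  T_X' a := pull_funForm ..
  T_e a := τ.pullConst_dx 𝕜 a
  T_inv f := LocalForms.ext fun y => congrArg (fun f => f.1 y) (τ.pullConst_gradeInv 𝕜 _)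
  ip_T k f := LocalForms.ext fun y => by
    rw [ip_apply, pull_apply, ← ip_apply, ip_pullConst, LocalForms.sum_apply, LocalForms.sum_apply]
    rfl
  pd_T := τ.pd_pull 𝕜

/-- The transformation laws of Christoffel symbols and bivector components, in the form in which the
Cartan calculi use them. -/
lemma mapsData {Γ Γ' : ChristoffelSystem d} {w w' : BivectorComponents d}
    (h : LocalData Γ w U) (h' : LocalData Γ' w' V)
    (hΓ : ∀ y ∈ U, ∀ b j k, ∑ i, Γ i j k y * τ.jac i b y =
      partialDeriv k (τ.jac j b) y
        + ∑ c, ∑ a, τ.jac j c y * τ.jac k a y * Γ' b c a (τ.toFun y))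
    (hw : ∀ y ∈ U, ∀ a b, w' a b (τ.toFun y) = ∑ i, ∑ j, w i j y * τ.jac i a y * τ.jac j b y) :
    (τ.coordChange 𝕜).MapsData (h.theta 𝕜) (h.biv 𝕜) (h'.theta 𝕜) (h'.biv 𝕜) where
  theta b j := LocalForms.ext fun y => by
    have hT : ∀ c, (τ.pull 𝕜 (h'.theta 𝕜 b c)).1 y =
        ∑ a, ∑ k, (((Γ' b c a (τ.toFun y) : ℝ) : 𝕜) * ((τ.jac k a y : ℝ) : 𝕜)) • dx k := by
      intro c
      rw [pull_apply, h'.theta_apply]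
      simp only [map_sum, map_smul, pullConst_dx, LocalForms.sum_apply, LocalForms.smul_apply,
        CartanCalculus.d_apply, mul_apply, pd_coord, e_apply, mul_smul_one, Finset.smul_sum,
        smul_smul]
    change (∑ i, h.theta 𝕜 i j * (cartan 𝕜 U).pd i (τ.coord 𝕜 b)).1 y =
      ((cartan 𝕜 U).d ((cartan 𝕜 U).pd j (τ.coord 𝕜 b)) +
        ∑ c, (cartan 𝕜 U).pd j (τ.coord 𝕜 c) * τ.pull 𝕜 (h'.theta 𝕜 b c)).1 y
    have e1 : (∑ i, h.theta 𝕜 i j * (cartan 𝕜 U).pd i (τ.coord 𝕜 b)).1 y =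
        ∑ k, ((∑ i, Γ i j k y * τ.jac i b y : ℝ) : 𝕜) • dx k := by
      simp only [LocalForms.sum_apply, mul_apply, h.theta_apply, pd_coord, mul_smul_one,
        Finset.smul_sum, smul_smul]
      rw [Finset.sum_comm]
      push_cast
      simp only [Finset.sum_smul, mul_comm]
    have e2 : (∑ c, (cartan 𝕜 U).pd j (τ.coord 𝕜 c) * τ.pull 𝕜 (h'.theta 𝕜 b c)).1 y =
        ∑ k, ((∑ c, ∑ a, τ.jac j c y * τ.jac k a y * Γ' b c a (τ.toFun y) : ℝ) : 𝕜) • dx k := by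
      simp only [LocalForms.sum_apply, mul_apply, hT, pd_coord, smul_mul_assoc, one_mul,
        Finset.smul_sum, smul_smul]
      push_cast
      simp only [Finset.sum_smul]
      rw [Finset.sum_congr rfl fun c _ => Finset.sum_comm, Finset.sum_comm]
      simp only [mul_comm, mul_left_comm]
    rw [e1, LocalForms.add_apply, e2, CartanCalculus.d_apply]
    simp only [LocalForms.sum_apply, mul_apply, pd_pd_coord, e_apply, mul_smul_one,
      hΓ y y.2]
    push_cast
    simp only [add_smul, Finset.sum_add_distrib]
  biv a b := LocalForms.ext fun y => by
    change (τ.pull 𝕜 (h'.biv 𝕜 a b)).1 y = (∑ i, ∑ j, h.biv 𝕜 i j *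
      (cartan 𝕜 U).pd i (τ.coord 𝕜 a) * (cartan 𝕜 U).pd j (τ.coord 𝕜 b)).1 y
    rw [pull_apply, h'.biv_apply, map_smul, map_one]
    simp only [LocalForms.sum_apply, LocalForms.smul_apply, mul_apply, h.biv_apply, pd_coord,
      mul_smul_one, smul_smul, hw y y.2]
    push_cast
    simp only [Finset.sum_smul, mul_comm]
    rfl

end SmoothMap

end Pullback

/-! ### Coordinate frames -/

section Frames

open TopologicalSpace Topology

variable {d : ℕ} {M : Type*} [TopologicalSpace M] [ChartedSpace (Coord d) M]
  [IsManifold (𝓡 d) ∞ M]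

lemma isCoordSystem_chartAt (x : M) : IsCoordSystem (chartAt (Coord d) x) :=
  IsManifold.chart_mem_maximalAtlas x

/-- Differentiability of a vector field at a point. -/
def VecDiffAt (V : Π x : M, TangentSpace (𝓡 d) x) (x : M) : Prop :=
  MDifferentiableAt (𝓡 d) (𝓡 d).tangent (fun z => (⟨z, V z⟩ : TangentBundle (𝓡 d) M)) x

lemma VecDiffAt.sum_smul {ι : Type*} (s : Finset ι) {g : ι → M → ℝ}
    {V : ι → Π x : M, TangentSpace (𝓡 d) x} {x : M}
    (hg : ∀ i, MDifferentiableAt (𝓡 d) 𝓘(ℝ, ℝ) (g i) x) (hV : ∀ i, VecDiffAt (V i) x) :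
    VecDiffAt (fun z => ∑ i ∈ s, g i z • V i z) x :=
  MDifferentiableAt.sum_section fun i _ => (hg i).smul_section (hV i)

lemma conn_sum_smul
    (conn : CovariantDerivative (𝓡 d) (Coord d) (TangentSpace (𝓡 d) : M → Type _))
    {ι : Type*} (s : Finset ι) {g : ι → M → ℝ}
    {V : ι → Π x : M, TangentSpace (𝓡 d) x} {x : M}
    (hg : ∀ i, MDifferentiableAt (𝓡 d) 𝓘(ℝ, ℝ) (g i) x) (hV : ∀ i, VecDiffAt (V i) x)
    (v : TangentSpace (𝓡 d) x) :
    conn (fun z => ∑ i ∈ s, g i z • V i z) x v =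
      ∑ i ∈ s, (g i x • conn (V i) x v + mvfderiv (𝓡 d) (g i) x v • V i x) := by
  classical
  have hcov := conn.isCovariantDerivativeOnUniv
  induction s using Finset.induction_on with
  | empty =>
    simp only [Finset.sum_empty]
    exact congrArg (fun F => F v) (hcov.zero (x := x))
  | insert i s hi ih =>
    rw [Finset.sum_insert hi, ← ih]
    have h1 : (fun z => ∑ i ∈ insert i s, g i z • V i z) =
        (g i • V i) + fun z => ∑ i ∈ s, g i z • V i z := by
      funext z; simp [Finset.sum_insert hi]
    rw [h1, hcov.add ((hg i).smul_section (hV i)) (VecDiffAt.sum_smul s hg hV),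
      hcov.leibniz (hV i) (hg i)]
    rfl

namespace IsCoordSystem

variable {φ ψ : OpenPartialHomeomorph M (Coord d)}

lemma mdifferentiable (hφ : IsCoordSystem φ) : φ.MDifferentiable (𝓡 d) (𝓡 d) :=
  ⟨(contMDiffOn_of_mem_maximalAtlas hφ).mdifferentiableOn (by simp),
    (contMDiffOn_symm_of_mem_maximalAtlas hφ).mdifferentiableOn (by simp)⟩

lemma isInvertible_mfderiv (hφ : IsCoordSystem φ) {x : M} (hx : x ∈ φ.source) :
    (mfderiv (𝓡 d) (𝓡 d) φ x).IsInvertible :=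
  ⟨hφ.mdifferentiable.mfderiv hx, rfl⟩

lemma mfderiv_coordVec (hφ : IsCoordSystem φ) {x : M} (hx : x ∈ φ.source) (k : Fin d) :
    mfderiv (𝓡 d) (𝓡 d) φ x (coordVec φ k x) =
      (NormedSpace.fromTangentSpace (𝕜 := ℝ) (φ x)).symm (EuclideanSpace.single k 1) :=
  (hφ.isInvertible_mfderiv hx).self_apply_inverse _

lemma coordCovec_coordVec (hφ : IsCoordSystem φ) {x : M} (hx : x ∈ φ.source) (i k : Fin d) :
    coordCovec φ i x (coordVec φ k x) = if i = k then 1 else 0 := by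
  simp only [coordCovec, ContinuousLinearMap.comp_apply]
  rw [hφ.mfderiv_coordVec hx]
  simp

lemma sum_coordCovec_smul (hφ : IsCoordSystem φ) {x : M} (hx : x ∈ φ.source)
    (v : TangentSpace (𝓡 d) x) : ∑ i, coordCovec φ i x v • coordVec φ i x = v := by
  apply hφ.mdifferentiable.mfderiv_injective hx
  apply (NormedSpace.fromTangentSpace (𝕜 := ℝ) (φ x)).injective
  simp only [map_sum, map_smul, hφ.mfderiv_coordVec hx]
  ext j
  simp [coordCovec, Pi.single_apply]

lemma vecDiffAt_coordVec (hφ : IsCoordSystem φ) {x : M} (hx : x ∈ φ.source) (k : Fin d) :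
    VecDiffAt (coordVec φ k) x := by
  have : IsManifold (𝓡 d) 2 M := IsManifold.of_le (n := ∞) (by
    simpa using WithTop.coe_le_coe.2 (le_top (a := (2 : ℕ∞))))
  let V : Π y : Coord d, TangentSpace (𝓡 d) y := fun y =>
    (NormedSpace.fromTangentSpace (𝕜 := ℝ) y).symm (EuclideanSpace.single k 1)
  have hV : MDifferentiableAt (𝓡 d) (𝓡 d).tangent
      (fun y => (⟨y, V y⟩ : TangentBundle (𝓡 d) (Coord d))) (φ x) :=
    ((contMDiffAt_vectorSpace_iff_contDiffAt (n := 1)).2 (contDiffAt_const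
      (c := (EuclideanSpace.single k 1 : Coord d)))).mdifferentiableAt (by simp)
  exact hV.mpullback_vectorField (n := ∞)
    ((contMDiffOn_of_mem_maximalAtlas hφ).contMDiffAt (φ.open_source.mem_nhds hx))
    (hφ.isInvertible_mfderiv hx) (by
    simpa using WithTop.coe_le_coe.2 (le_top (a := (2 : ℕ∞))))

end IsCoordSystem

/-- The domain of a coordinate system in coordinate space. -/
def coordDomain (φ : OpenPartialHomeomorph M (Coord d)) : Opens (Coord d) :=
  ⟨φ.target, φ.open_target⟩

/-- The domain of the change of coordinates from `φ` to `ψ`. -/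
def overlap (φ ψ : OpenPartialHomeomorph M (Coord d)) : Opens (Coord d) :=
  ⟨(φ.symm.trans ψ).source, (φ.symm.trans ψ).open_source⟩

lemma mem_overlap {φ ψ : OpenPartialHomeomorph M (Coord d)} {y : Coord d} :
    y ∈ overlap φ ψ ↔ y ∈ φ.target ∧ φ.symm y ∈ ψ.source := by
  change y ∈ (φ.symm.trans ψ).source ↔ _
  simp

/-- The change of coordinates from `φ` to `ψ`. -/
def transition {φ ψ : OpenPartialHomeomorph M (Coord d)} (hφ : IsCoordSystem φ)
    (hψ : IsCoordSystem ψ) : SmoothMap (overlap φ ψ) (coordDomain ψ) where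
  toFun y := ψ (φ.symm y)
  smooth := by
    have h1 := (contMDiffOn_of_mem_maximalAtlas hψ).comp' (contMDiffOn_symm_of_mem_maximalAtlas hφ)
    exact (contMDiffOn_iff_contDiffOn.1 h1).mono fun y hy => by
      obtain ⟨h, h'⟩ := mem_overlap.1 hy
      exact ⟨h, h'⟩
  maps y hy := ψ.map_source (mem_overlap.1 hy).2

section

variable {φ ψ : OpenPartialHomeomorph M (Coord d)} (hφ : IsCoordSystem φ) (hψ : IsCoordSystem ψ)

lemma coordCovec_transition {x : M} (hx : x ∈ φ.source) (hx' : x ∈ ψ.source) (k a : Fin d) :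
    coordCovec ψ a x (coordVec φ k x) = (transition hφ hψ).jac k a (φ x) := by
  have hy : φ x ∈ overlap φ ψ := mem_overlap.2 ⟨φ.map_source hx, by rwa [φ.left_inv hx]⟩
  have hd : DifferentiableAt ℝ (transition hφ hψ).toFun (φ x) :=
    ((transition hφ hψ).smooth.differentiableOn (by simp)).differentiableAt
      ((overlap φ ψ).2.mem_nhds hy)
  have h1 : (transition hφ hψ).jac k a (φ x) =
      fderiv ℝ (transition hφ hψ).toFun (φ x) (EuclideanSpace.single k 1) a := by
    have := ((EuclideanSpace.proj (𝕜 := ℝ) a : Coord d →L[ℝ] ℝ).hasFDerivAt.comp (φ x)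
      hd.hasFDerivAt).fderiv
    change fderiv ℝ ((EuclideanSpace.proj (𝕜 := ℝ) a : Coord d →L[ℝ] ℝ) ∘ _) _ _ = _
    rw [this]
    rfl
  have h2 : mfderiv (𝓡 d) (𝓡 d) ψ x =
      mfderiv (𝓡 d) (𝓡 d) ((transition hφ hψ).toFun ∘ φ) x := by
    refine Filter.EventuallyEq.mfderiv_eq ?_
    filter_upwards [φ.open_source.mem_nhds hx] with z hz
    exact congrArg ψ (φ.left_inv hz).symm
  have h3 := mfderiv_comp x hd.mdifferentiableAt (hφ.mdifferentiable.mdifferentiableAt hx)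
  have h4 : mfderiv (𝓡 d) (𝓡 d) ψ x (coordVec φ k x) =
      fderiv ℝ (transition hφ hψ).toFun (φ x) (EuclideanSpace.single k 1) := by
    refine (congrArg (fun F : TangentSpace (𝓡 d) x →L[ℝ] Coord d => F (coordVec φ k x))
      (h2.trans h3)).trans ?_
    change mfderiv (𝓡 d) (𝓡 d) (transition hφ hψ).toFun (φ x)
      (mfderiv (𝓡 d) (𝓡 d) φ x (coordVec φ k x)) = _
    rw [hφ.mfderiv_coordVec hx, mfderiv_eq_fderiv]
    rfl
  rw [h1, ← h4]
  rfl

lemma coordVec_eq_sum {x : M} (hx : x ∈ φ.source) (hx' : x ∈ ψ.source) (k : Fin d) :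
    coordVec φ k x = ∑ a, (transition hφ hψ).jac k a (φ x) • coordVec ψ a x := by
  rw [← hψ.sum_coordCovec_smul hx' (coordVec φ k x)]
  simp only [coordCovec_transition hφ hψ hx hx']

lemma coordCovec_eq_sum {x : M} (hx : x ∈ φ.source) (hx' : x ∈ ψ.source) (a : Fin d) :
    coordCovec ψ a x = ∑ k, (transition hφ hψ).jac k a (φ x) • coordCovec φ k x := by
  ext v
  conv_lhs => rw [← hφ.sum_coordCovec_smul hx v]
  simp only [map_sum, map_smul, coordCovec_transition hφ hψ hx hx', smul_eq_mul,
    _root_.sum_apply, _root_.smul_apply, mul_comm]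

/-- The transformation law of bivector components. -/
lemma components_transition (biv : Tensor20 d M) {y : Coord d} (hy : y ∈ overlap φ ψ)
    (a b : Fin d) : components biv ψ a b ((transition hφ hψ).toFun y) =
      ∑ i, ∑ j, components biv φ i j y * (transition hφ hψ).jac i a y *
        (transition hφ hψ).jac j b y := by
  obtain ⟨h1, h2⟩ := mem_overlap.1 hy
  have hs : ψ.symm ((transition hφ hψ).toFun y) = φ.symm y := ψ.left_inv h2
  have hr : φ (φ.symm y) = y := φ.right_inv h1
  have hc : ∀ x z, ψ.symm z = x → components biv ψ a b z =
      biv x (coordCovec ψ a x) (coordCovec ψ b x) := by rintro _ z rfl; rfl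
  have hc' : ∀ i j, components biv φ i j y =
      biv (φ.symm y) (coordCovec φ i (φ.symm y)) (coordCovec φ j (φ.symm y)) := fun _ _ => rfl
  rw [hc _ _ hs, coordCovec_eq_sum hφ hψ (φ.map_target h1) h2 a,
    coordCovec_eq_sum hφ hψ (φ.map_target h1) h2 b, hr]
  simp only [map_sum, map_smul, LinearMap.sum_apply, LinearMap.smul_apply, smul_eq_mul,
    Finset.mul_sum]
  rw [Finset.sum_comm]
  refine Finset.sum_congr rfl fun i _ => Finset.sum_congr rfl fun j _ => ?_
  rw [hc' i j]
  ring

/-- The transformation law of Christoffel symbols. -/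
lemma christoffel_transition
    (conn : CovariantDerivative (𝓡 d) (Coord d) (TangentSpace (𝓡 d) : M → Type _))
    {y : Coord d} (hy : y ∈ overlap φ ψ) (b j k : Fin d) :
    ∑ i, christoffel conn φ i j k y * (transition hφ hψ).jac i b y =
      partialDeriv k ((transition hφ hψ).jac j b) y
        + ∑ c, ∑ a, (transition hφ hψ).jac j c y * (transition hφ hψ).jac k a y *
          christoffel conn ψ b c a ((transition hφ hψ).toFun y) := by
  obtain ⟨h1, h2⟩ := mem_overlap.1 hy
  have hs : ψ.symm ((transition hφ hψ).toFun y) = φ.symm y := ψ.left_inv h2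
  have hr : φ (φ.symm y) = y := φ.right_inv h1
  set x := φ.symm y with hx
  have hxs : x ∈ φ.source := φ.map_target h1
  set τ := transition hφ hψ with hτ
  have hcov := conn.isCovariantDerivativeOnUniv
  have hJ : ∀ a, DifferentiableAt ℝ (τ.jac k a) y := fun a =>
    ((τ.smooth_jac k a).differentiableOn (by simp)).differentiableAt ((overlap φ ψ).2.mem_nhds hy)
  have hJ' : ∀ a, MDifferentiableAt (𝓡 d) 𝓘(ℝ, ℝ) (τ.jac k a) (φ x) := fun a => by
    rw [hr]; exact (hJ a).mdifferentiableAt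
  have hφd : MDifferentiableAt (𝓡 d) (𝓡 d) φ x := hφ.mdifferentiable.mdifferentiableAt hxs
  have hg : ∀ a, MDifferentiableAt (𝓡 d) 𝓘(ℝ, ℝ) (fun z => τ.jac k a (φ z)) x := fun a =>
    (hJ' a).comp x hφd
  have hV : ∀ a, VecDiffAt (coordVec ψ a) x := fun a => hψ.vecDiffAt_coordVec h2 a
  have e1 : conn (coordVec φ k) x =
      conn (fun z => ∑ a, τ.jac k a (φ z) • coordVec ψ a z) x := by
    refine hcov.congr_of_eventuallyEq (hφ.vecDiffAt_coordVec hxs k)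
      (VecDiffAt.sum_smul _ hg hV) Filter.univ_mem ?_
    filter_upwards [φ.open_source.mem_nhds hxs, ψ.open_source.mem_nhds h2] with z hz hz'
    exact coordVec_eq_sum hφ hψ hz hz' k
  have e2 : conn (fun z => ∑ a, τ.jac k a (φ z) • coordVec ψ a z) x (coordVec φ j x) =
      ∑ a, (τ.jac k a y • conn (coordVec ψ a) x (coordVec φ j x) +
        partialDeriv j (τ.jac k a) y • coordVec ψ a x) := by
    rw [conn_sum_smul conn _ hg hV]
    refine Finset.sum_congr rfl fun a _ => ?_
    rw [hr]
    congr 2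
    have := mfderiv_comp x (hJ' a) hφd
    change (mfderiv (𝓡 d) 𝓘(ℝ, ℝ) (τ.jac k a ∘ φ) x) (coordVec φ j x) = _
    rw [this, ContinuousLinearMap.comp_apply, hφ.mfderiv_coordVec hxs, mfderiv_eq_fderiv, hr]
    rfl
  have e3 : ∀ v, ∑ i, coordCovec φ i x v * τ.jac i b y = coordCovec ψ b x v := fun v => by
    rw [coordCovec_eq_sum hφ hψ hxs h2 b, hr]
    simp [mul_comm, hτ]
  -- The Jacobian is differentiated along `∂ⱼ`; symmetry of second derivatives exchanges `j` and `k`.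
  have e4 : partialDeriv k (τ.jac j b) y = partialDeriv j (τ.jac k b) y :=
    partialDeriv_comm k j (overlap φ ψ).2 (τ.smooth_comp b) hy
  have hc : ∀ x z b c a, ψ.symm z = x → christoffel conn ψ b c a z =
      coordCovec ψ b x (conn (coordVec ψ a) x (coordVec ψ c x)) := by rintro _ z b c a rfl; rfl
  simp only [hc _ _ _ _ _ hs]
  simp only [christoffel]
  rw [e3, e1, e2, e4]
  simp only [map_sum, map_add, map_smul, hψ.coordCovec_coordVec h2, smul_eq_mul, mul_ite, mul_one,
    mul_zero, Finset.sum_add_distrib, Finset.sum_ite_eq, Finset.mem_univ, if_true]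
  rw [add_comm]
  congr 1
  rw [Finset.sum_comm]
  refine Finset.sum_congr rfl fun a _ => ?_
  rw [coordVec_eq_sum hφ hψ hxs h2 j, hr]
  simp only [map_sum, map_smul, smul_eq_mul, Finset.mul_sum, ← hτ]
  exact Finset.sum_congr rfl fun c _ => by ring

end

end Frames

/-! ### Gluing local forms -/

section Gluing

open TopologicalSpace Topology LocalForms

variable {d : ℕ} {M : Type*} [TopologicalSpace M] [ChartedSpace (Coord d) M]
  [IsManifold (𝓡 d) ∞ M] {𝕜 : Type*} [RCLike 𝕜]
  {φ ψ : OpenPartialHomeomorph M (Coord d)}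

variable (𝕜) in
/-- The covector `∑ cᵢ dxⁱ` at `x` with given components in the coordinates `φ`. -/
def covecOfComponents (φ : OpenPartialHomeomorph M (Coord d)) (x : M) :
    (Fin d → 𝕜) →ₗ[𝕜] Cotangent (d := d) 𝕜 x :=
  ∑ i, (LinearMap.proj i : (Fin d → 𝕜) →ₗ[𝕜] 𝕜).smulRight
    ((RCLike.ofRealCLM : ℝ →L[ℝ] 𝕜) ∘L coordCovec φ i x)

lemma covecOfComponents_apply (x : M) (c : Fin d → 𝕜) (v : TangentSpace (𝓡 d) x) :
    covecOfComponents 𝕜 φ x c v = ∑ i, c i * ((coordCovec φ i x v : ℝ) : 𝕜) := by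
  simp [covecOfComponents]

lemma covecComponents_comp_covecOfComponents (hφ : IsCoordSystem φ) {x : M} (hx : x ∈ φ.source) :
    (covecComponents 𝕜 φ x) ∘ₗ (covecOfComponents 𝕜 φ x) = LinearMap.id := by
  refine LinearMap.ext fun c => funext fun k => ?_
  change covecOfComponents 𝕜 φ x c (coordVec φ k x) = c k
  rw [covecOfComponents_apply]
  simp [hφ.coordCovec_coordVec hx]

lemma covecOfComponents_comp_covecComponents (hφ : IsCoordSystem φ) {x : M} (hx : x ∈ φ.source) :
    (covecOfComponents 𝕜 φ x) ∘ₗ (covecComponents 𝕜 φ x) = LinearMap.id := by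
  refine LinearMap.ext fun α => ContinuousLinearMap.ext fun v => ?_
  rw [LinearMap.comp_apply, covecOfComponents_apply, LinearMap.id_apply]
  conv_rhs => rw [← hφ.sum_coordCovec_smul hx v]
  rw [map_sum]
  refine Finset.sum_congr rfl fun i _ => ?_
  rw [map_smul, RCLike.real_smul_eq_coe_mul, mul_comm]
  rfl

lemma map_covecOfComponents_map (hφ : IsCoordSystem φ) {x : M} (hx : x ∈ φ.source)
    (a : ExteriorAlgebra 𝕜 (Cotangent (d := d) 𝕜 x)) :
    ExteriorAlgebra.map (covecOfComponents 𝕜 φ x)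
      (ExteriorAlgebra.map (covecComponents 𝕜 φ x) a) = a := by
  rw [← AlgHom.comp_apply, ExteriorAlgebra.map_comp_map,
    covecOfComponents_comp_covecComponents hφ hx, ExteriorAlgebra.map_id]
  rfl

lemma map_covecComponents_map (hφ : IsCoordSystem φ) {x : M} (hx : x ∈ φ.source) (a : Lam d 𝕜) :
    ExteriorAlgebra.map (covecComponents 𝕜 φ x)
      (ExteriorAlgebra.map (covecOfComponents 𝕜 φ x) a) = a := by
  rw [← AlgHom.comp_apply, ExteriorAlgebra.map_comp_map,
    covecComponents_comp_covecOfComponents hφ hx, ExteriorAlgebra.map_id]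
  rfl

lemma inCoords_of_symm_eq (ξ : RawForm d M 𝕜) {x : M} {z : Coord d} (h : ψ.symm z = x) :
    inCoords ψ ξ z = ExteriorAlgebra.map (covecComponents 𝕜 ψ x) (ξ x) := by
  subst h; rfl

/-- The transformation law of covectors under a change of coordinates, extended to the Grassmann
algebra. -/
lemma pullConst_map_covecComponents (hφ : IsCoordSystem φ) (hψ : IsCoordSystem ψ)
    (y : overlap φ ψ) (a : ExteriorAlgebra 𝕜 (Cotangent (d := d) 𝕜 (φ.symm y.1))) :
    ((transition hφ hψ).pullConst 𝕜
      (ExteriorAlgebra.map (covecComponents 𝕜 ψ (φ.symm y.1)) a)).1 y =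
      ExteriorAlgebra.map (covecComponents 𝕜 φ (φ.symm y.1)) a := by
  obtain ⟨h1, h2⟩ := mem_overlap.1 y.2
  let ev : LocalForms 𝕜 (overlap φ ψ) →ₐ[𝕜] Lam d 𝕜 :=
    (Pi.evalAlgHom 𝕜 (fun _ : overlap φ ψ => Lam d 𝕜) y).comp (LocalForms 𝕜 (overlap φ ψ)).val
  have key : (ev.comp ((transition hφ hψ).pullConst 𝕜)).comp
      (ExteriorAlgebra.map (covecComponents 𝕜 ψ (φ.symm y.1))) =
      ExteriorAlgebra.map (covecComponents 𝕜 φ (φ.symm y.1)) := by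
    refine ExteriorAlgebra.hom_ext (LinearMap.ext fun α => ?_)
    change ((transition hφ hψ).pullConst 𝕜
      (ExteriorAlgebra.map (covecComponents 𝕜 ψ (φ.symm y.1)) (ExteriorAlgebra.ι 𝕜 α))).1 y =
      ExteriorAlgebra.map (covecComponents 𝕜 φ (φ.symm y.1)) (ExteriorAlgebra.ι 𝕜 α)
    rw [ExteriorAlgebra.map_apply_ι, ExteriorAlgebra.map_apply_ι, SmoothMap.pullConst_ι,
      ι_eq_sum]
    have hα : ∀ k, covecComponents 𝕜 φ (φ.symm y.1) α k =
        ∑ a, (((transition hφ hψ).jac k a y.1 : ℝ) : 𝕜) *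
          covecComponents 𝕜 ψ (φ.symm y.1) α a := fun k => by
      change α (coordVec φ k (φ.symm y.1)) = _
      rw [coordVec_eq_sum hφ hψ (φ.map_target h1) h2 k, φ.right_inv h1, map_sum]
      refine Finset.sum_congr rfl fun a _ => ?_
      rw [map_smul, RCLike.real_smul_eq_coe_mul]
      rfl
    simp only [LocalForms.sum_apply, LocalForms.smul_apply, CartanCalculus.d_apply,
      LocalForms.mul_apply, SmoothMap.pd_coord, e_apply, mul_smul_one, Finset.smul_sum, smul_smul,
      hα, Finset.sum_smul]
    rw [Finset.sum_comm]
    simp only [mul_comm]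
  exact congrArg (fun F => F a) key

variable (𝕜) in
/-- The expression of forms in a coordinate system, as a homomorphism of algebras. -/
def loc (hφ : IsCoordSystem φ) : Forms d M 𝕜 →ₐ[𝕜] LocalForms 𝕜 (coordDomain φ) where
  toFun ξ := res (inCoords φ ξ.1) (ξ.2 φ hφ)
  map_one' := LocalForms.ext fun _ => map_one _
  map_mul' _ _ := LocalForms.ext fun _ => map_mul _ _ _
  map_zero' := LocalForms.ext fun _ => map_zero _
  map_add' _ _ := LocalForms.ext fun _ => map_add _ _ _
  commutes' r := LocalForms.ext fun _ => AlgHom.commutes _ r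

lemma loc_apply (hφ : IsCoordSystem φ) (ξ : Forms d M 𝕜) (y : coordDomain φ) :
    (loc 𝕜 hφ ξ).1 y = inCoords φ ξ.1 y := rfl

lemma chartAt_mem_coordDomain (x : M) :
    chartAt (Coord d) x x ∈ coordDomain (chartAt (Coord d) x) :=
  mem_chart_target (Coord d) x

lemma map_loc_chartAt (ξ : Forms d M 𝕜) (x : M) :
    ExteriorAlgebra.map (covecOfComponents 𝕜 (chartAt (Coord d) x) x)
      ((loc 𝕜 (isCoordSystem_chartAt x) ξ).1 ⟨_, chartAt_mem_coordDomain x⟩) = ξ.1 x := by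
  rw [loc_apply, inCoords_of_symm_eq ξ.1
    ((chartAt (Coord d) x).left_inv (mem_chart_source (Coord d) x)),
    map_covecOfComponents_map (isCoordSystem_chartAt x) (mem_chart_source (Coord d) x)]

/-- Forms with the same expressions in all coordinate systems are equal. -/
lemma forms_ext {ξ η : Forms d M 𝕜}
    (h : ∀ (φ : OpenPartialHomeomorph M (Coord d)) (hφ : IsCoordSystem φ),
      loc 𝕜 hφ ξ = loc 𝕜 hφ η) : ξ = η :=
  Subtype.ext (funext fun x => by rw [← map_loc_chartAt ξ, ← map_loc_chartAt η, h])

/-- The transformation law of a form under a change of coordinates. -/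
lemma pull_loc (hφ : IsCoordSystem φ) (hψ : IsCoordSystem ψ) (ξ : Forms d M 𝕜)
    (y : overlap φ ψ) :
    ((transition hφ hψ).pull 𝕜 (loc 𝕜 hψ ξ)).1 y = inCoords φ ξ.1 y := by
  have hs : ψ.symm ((transition hφ hψ).toFun y.1) = φ.symm y.1 :=
    ψ.left_inv (mem_overlap.1 y.2).2
  rw [SmoothMap.pull_apply, loc_apply, inCoords_of_symm_eq ξ.1 hs]
  exact pullConst_map_covecComponents hφ hψ y _

/-- Local forms, one for each coordinate system, which are related by pullback along the changes of
coordinates are the expressions of a form on the manifold. -/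
theorem exists_form_of_local
    (F : ∀ φ : OpenPartialHomeomorph M (Coord d), IsCoordSystem φ → LocalForms 𝕜 (coordDomain φ))
    (hF : ∀ (φ ψ : OpenPartialHomeomorph M (Coord d)) (hφ : IsCoordSystem φ)
      (hψ : IsCoordSystem ψ) (y : overlap φ ψ),
      ((transition hφ hψ).pull 𝕜 (F ψ hψ)).1 y = (F φ hφ).1 ⟨y, (mem_overlap.1 y.2).1⟩) :
    ∃ ζ : Forms d M 𝕜, ∀ φ hφ, loc 𝕜 hφ ζ = F φ hφ := by
  let ζ : RawForm d M 𝕜 := fun x =>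
    ExteriorAlgebra.map (covecOfComponents 𝕜 (chartAt (Coord d) x) x)
      ((F _ (isCoordSystem_chartAt x)).1 ⟨_, chartAt_mem_coordDomain x⟩)
  have key : ∀ φ hφ, ∀ y : coordDomain φ, inCoords φ ζ y = (F φ hφ).1 y := by
    intro φ hφ y
    have hx := mem_chart_source (Coord d) (φ.symm y.1)
    have hy : y.1 ∈ overlap φ (chartAt (Coord d) (φ.symm y.1)) := mem_overlap.2 ⟨y.2, hx⟩
    have h := hF φ _ hφ (isCoordSystem_chartAt (φ.symm y.1)) ⟨y.1, hy⟩
    rw [SmoothMap.pull_apply] at h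
    rw [← h, ← map_covecComponents_map (isCoordSystem_chartAt (φ.symm y.1)) hx
      ((F _ (isCoordSystem_chartAt (φ.symm y.1))).1 _)]
    exact (pullConst_map_covecComponents hφ (isCoordSystem_chartAt (φ.symm y.1)) ⟨y.1, hy⟩ _).symm
  refine ⟨⟨ζ, fun φ hφ => ?_⟩, fun φ hφ => LocalForms.ext fun y => key φ hφ y⟩
  exact (smoothOn_out (F φ hφ)).congr fun y hy => by
    rw [key φ hφ ⟨y, hy⟩]; exact (out_apply (F φ hφ) ⟨y, hy⟩).symm

variable (d M 𝕜) in
/-- Exterior differentiation in coordinates defines a linear map on forms on the manifold. -/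
theorem exists_exteriorDerivative : ∃ D : Forms d M 𝕜 →ₗ[𝕜] Forms d M 𝕜, ∀ φ,
    ∀ hφ : IsCoordSystem φ, ∀ ξ, loc 𝕜 hφ (D ξ) = (cartan 𝕜 (coordDomain φ)).d (loc 𝕜 hφ ξ) := by
  have h : ∀ ξ : Forms d M 𝕜, ∃ ζ : Forms d M 𝕜, ∀ φ, ∀ hφ : IsCoordSystem φ,
      loc 𝕜 hφ ζ = (cartan 𝕜 (coordDomain φ)).d (loc 𝕜 hφ ξ) := fun ξ =>
    exists_form_of_local (fun φ hφ => (cartan 𝕜 (coordDomain φ)).d (loc 𝕜 hφ ξ))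
      fun φ ψ hφ hψ y => by
        change (((transition hφ hψ).coordChange 𝕜).T _).1 y = _
        rw [CartanCalculus.CoordChange.T_d, LocalForms.d_apply (loc_apply hφ ξ)]
        exact LocalForms.d_apply (fun z => pull_loc hφ hψ ξ z) y
  choose D hD using h
  refine ⟨⟨⟨D, fun ξ η => forms_ext fun φ hφ => ?_⟩, fun c ξ => forms_ext fun φ hφ => ?_⟩, ?_⟩
  · simp only [hD, map_add]
  · simp only [hD, map_smul, RingHom.id_apply]
  · exact fun φ hφ ξ => hD ξ φ hφ

end Gluing

/-! ### The bracket on the manifold -/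

section Bracket

open TopologicalSpace Topology LocalForms

variable {d : ℕ} {M : Type*} [TopologicalSpace M] [ChartedSpace (Coord d) M]
  [IsManifold (𝓡 d) ∞ M] {𝕜 : Type*} [RCLike 𝕜]
  {φ ψ : OpenPartialHomeomorph M (Coord d)}

lemma LocalData.mono {Γ : ChristoffelSystem d} {w : BivectorComponents d} {U V : Opens (Coord d)}
    (h : LocalData Γ w V) (hUV : U ≤ V) : LocalData Γ w U where
  smooth_gamma i j k := (h.smooth_gamma i j k).mono hUV
  smooth_biv i j := (h.smooth_biv i j).mono hUV
  antisymm i j y hy := h.antisymm i j y (hUV hy)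
  compat y hy := h.compat y (hUV hy)

lemma overlap_le (φ ψ : OpenPartialHomeomorph M (Coord d)) : overlap φ ψ ≤ coordDomain φ :=
  fun _ hy => (mem_overlap.1 hy).1

variable {biv : Tensor20 d M}
  {conn : CovariantDerivative (𝓡 d) (Coord d) (TangentSpace (𝓡 d) : M → Type _)}

/-- A bivector and a linear connection, both smooth, which are Poisson-compatible. -/
structure PoissonGeometry (biv : Tensor20 d M)
    (conn : CovariantDerivative (𝓡 d) (Coord d) (TangentSpace (𝓡 d) : M → Type _)) : Prop where
  isBivector : IsBivector biv
  smooth : SmoothConnection conn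
  compat : PoissonCompatible biv conn

namespace PoissonGeometry

lemma localData (G : PoissonGeometry biv conn) (hφ : IsCoordSystem φ) :
    LocalData (christoffel conn φ) (components biv φ) (coordDomain φ) where
  smooth_gamma := G.smooth φ hφ
  smooth_biv := G.isBivector.smooth φ hφ
  antisymm _ _ _ _ := G.isBivector.antisymm _ _ _
  compat := G.compat φ hφ

variable (𝕜) (G : PoissonGeometry biv conn)

/-- The first-order term of the deformed product in a coordinate system. -/
def localBr (hφ : IsCoordSystem φ) : LocalForms 𝕜 (coordDomain φ) →ₗ[𝕜]
    LocalForms 𝕜 (coordDomain φ) →ₗ[𝕜] LocalForms 𝕜 (coordDomain φ) :=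
  (cartan 𝕜 (coordDomain φ)).br ((G.localData hφ).theta 𝕜) ((G.localData hφ).biv 𝕜)

/-- The first-order term of the deformed product is defined globally: its expressions in different
coordinates are related by `MapsData.br_T`. -/
theorem exists_bracket : ∃ B : Forms d M 𝕜 →ₗ[𝕜] Forms d M 𝕜 →ₗ[𝕜] Forms d M 𝕜, ∀ φ,
    ∀ hφ : IsCoordSystem φ, ∀ ξ η, loc 𝕜 hφ (B ξ η) = G.localBr 𝕜 hφ (loc 𝕜 hφ ξ) (loc 𝕜 hφ η) := by
  have h : ∀ ξ η : Forms d M 𝕜, ∃ ζ : Forms d M 𝕜, ∀ φ, ∀ hφ : IsCoordSystem φ,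
      loc 𝕜 hφ ζ = G.localBr 𝕜 hφ (loc 𝕜 hφ ξ) (loc 𝕜 hφ η) := fun ξ η =>
    exists_form_of_local (fun φ hφ => G.localBr 𝕜 hφ (loc 𝕜 hφ ξ) (loc 𝕜 hφ η))
      fun φ ψ hφ hψ y => by
        have h1 := (G.localData hφ).mono (overlap_le φ ψ)
        have h2 := G.localData hψ
        have hm := (transition hφ hψ).mapsData 𝕜 h1 h2
          (fun y hy b j k => christoffel_transition hφ hψ conn hy b j k)
          (fun y hy a b => components_transition hφ hψ biv hy a b)
        change (((transition hφ hψ).coordChange 𝕜).T _).1 y = _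
        rw [localBr, hm.br_T h1.compatible h2.compatible, localBr,
          (G.localData hφ).br_apply (loc_apply hφ ξ) (loc_apply hφ η)]
        exact h1.br_apply (fun z => pull_loc hφ hψ ξ z) (fun z => pull_loc hφ hψ η z) y
  choose B hB using h
  refine ⟨LinearMap.mk₂ 𝕜 B (fun ξ ξ' η => ?_) (fun c ξ η => ?_) (fun ξ η η' => ?_)
    (fun c ξ η => ?_), fun φ hφ ξ η => hB ξ η φ hφ⟩ <;>
  · refine forms_ext fun φ hφ => ?_
    simp only [hB, map_add, map_smul, LinearMap.add_apply, LinearMap.smul_apply]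

end PoissonGeometry

end Bracket

/-! ### Degrees -/

section Degrees

open TopologicalSpace Topology LocalForms

variable {d : ℕ} {𝕜 : Type*} [RCLike 𝕜]

lemma mem_exteriorPower_succ_induction {V : Type*} [AddCommGroup V] [Module 𝕜 V] {n : ℕ}
    {p : ExteriorAlgebra 𝕜 V → Prop}
    (hmul : ∀ v : V, ∀ x ∈ ⋀[𝕜]^n V, p (ExteriorAlgebra.ι 𝕜 v * x))
    (hadd : ∀ x y, p x → p y → p (x + y)) {x : ExteriorAlgebra 𝕜 V}
    (hx : x ∈ ⋀[𝕜]^(n + 1) V) : p x := by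
  rw [ExteriorAlgebra.exteriorPower, pow_succ'] at hx
  refine Submodule.mul_induction_on hx ?_ hadd
  rintro _ ⟨v, rfl⟩ x hx
  exact hmul v x hx

lemma mem_exteriorPower_zero {V : Type*} [AddCommGroup V] [Module 𝕜 V]
    {x : ExteriorAlgebra 𝕜 V} (hx : x ∈ ⋀[𝕜]^0 V) : ∃ r, x = algebraMap 𝕜 _ r := by
  rw [ExteriorAlgebra.exteriorPower, pow_zero, Submodule.mem_one] at hx
  obtain ⟨r, rfl⟩ := hx
  exact ⟨r, rfl⟩

lemma mul_mem_exteriorPower {V : Type*} [AddCommGroup V] [Module 𝕜 V] {m n : ℕ}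
    {x y : ExteriorAlgebra 𝕜 V} (hx : x ∈ ⋀[𝕜]^m V) (hy : y ∈ ⋀[𝕜]^n V) :
    x * y ∈ ⋀[𝕜]^(m + n) V := by
  rw [ExteriorAlgebra.exteriorPower, pow_add]
  exact Submodule.mul_mem_mul hx hy

lemma ι_mem_exteriorPower {V : Type*} [AddCommGroup V] [Module 𝕜 V] (v : V) :
    ExteriorAlgebra.ι 𝕜 v ∈ ⋀[𝕜]^1 V := by
  rw [ExteriorAlgebra.exteriorPower, pow_one]
  exact ⟨v, rfl⟩

lemma map_mem_exteriorPower {V V' : Type*} [AddCommGroup V] [Module 𝕜 V] [AddCommGroup V']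
    [Module 𝕜 V'] (f : V →ₗ[𝕜] V') {n : ℕ} {x : ExteriorAlgebra 𝕜 V} (hx : x ∈ ⋀[𝕜]^n V) :
    ExteriorAlgebra.map f x ∈ ⋀[𝕜]^n V' := by
  induction n generalizing x with
  | zero =>
    obtain ⟨r, rfl⟩ := mem_exteriorPower_zero hx
    rw [AlgHom.commutes, ExteriorAlgebra.exteriorPower, pow_zero]
    exact Submodule.algebraMap_mem r
  | succ n ih =>
    refine mem_exteriorPower_succ_induction (p := fun x => ExteriorAlgebra.map f x ∈ ⋀[𝕜]^(n + 1) V')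
      (fun v x hx => ?_) (fun x y hx hy => ?_) hx
    · rw [map_mul, ExteriorAlgebra.map_apply_ι, add_comm]
      exact mul_mem_exteriorPower (ι_mem_exteriorPower _) (ih hx)
    · rw [map_add]; exact add_mem hx hy

lemma gradeInv_of_mem {n : ℕ} {x : Lam d 𝕜} (hx : x ∈ ⋀[𝕜]^n (Fin d → 𝕜)) :
    gradeInv x = (-1 : 𝕜) ^ n • x := by
  induction n generalizing x with
  | zero =>
    obtain ⟨r, rfl⟩ := mem_exteriorPower_zero hx
    rw [AlgHom.commutes, pow_zero, one_smul]
  | succ n ih =>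
    refine mem_exteriorPower_succ_induction (p := fun x => gradeInv x = (-1 : 𝕜) ^ (n + 1) • x)
      (fun v x hx => ?_) (fun x y hx hy => ?_) hx
    · rw [map_mul, gradeInv_ι, ih hx, pow_succ, mul_neg_one, neg_smul, mul_smul_comm, neg_mul,
        smul_neg]
    · rw [map_add, hx, hy, smul_add]

lemma intProd_of_mem_zero (k : Fin d) {x : Lam d 𝕜} (hx : x ∈ ⋀[𝕜]^0 (Fin d → 𝕜)) :
    intProd k x = 0 := by
  obtain ⟨r, rfl⟩ := mem_exteriorPower_zero hx
  exact intProd_algebraMap k r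

lemma intProd_mem (k : Fin d) {n : ℕ} {x : Lam d 𝕜} (hx : x ∈ ⋀[𝕜]^(n + 1) (Fin d → 𝕜)) :
    intProd k x ∈ ⋀[𝕜]^n (Fin d → 𝕜) := by
  induction n generalizing x with
  | zero =>
    refine mem_exteriorPower_succ_induction (p := fun x => intProd k x ∈ ⋀[𝕜]^0 (Fin d → 𝕜))
      (fun v x hx => ?_) (fun x y hx hy => ?_) hx
    · rw [intProd_ι_mul, intProd_of_mem_zero k hx, mul_zero, sub_zero]
      exact Submodule.smul_mem _ _ hx
    · rw [map_add]; exact add_mem hx hy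
  | succ n ih =>
    refine mem_exteriorPower_succ_induction (p := fun x => intProd k x ∈ ⋀[𝕜]^(n + 1) (Fin d → 𝕜))
      (fun v x hx => ?_) (fun x y hx hy => ?_) hx
    · rw [intProd_ι_mul]
      refine sub_mem (Submodule.smul_mem _ _ hx) ?_
      rw [add_comm n 1]
      exact mul_mem_exteriorPower (ι_mem_exteriorPower _) (ih hx)
    · rw [map_add]; exact add_mem hx hy

/-- The component of degree `n` of an element of an exterior algebra. -/
def degProj {V : Type*} [AddCommGroup V] [Module 𝕜 V] (n : ℕ) :
    ExteriorAlgebra 𝕜 V →ₗ[𝕜] ExteriorAlgebra 𝕜 V :=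
  GradedAlgebra.proj (fun i : ℕ => ⋀[𝕜]^i V) n

section

variable {V V' : Type*} [AddCommGroup V] [Module 𝕜 V] [AddCommGroup V'] [Module 𝕜 V']

lemma degProj_mem (n : ℕ) (x : ExteriorAlgebra 𝕜 V) : degProj n x ∈ ⋀[𝕜]^n V := by
  rw [degProj, GradedAlgebra.proj_apply]
  exact Subtype.prop _

lemma degProj_of_mem {n : ℕ} {x : ExteriorAlgebra 𝕜 V} (hx : x ∈ ⋀[𝕜]^n V) (m : ℕ) :
    degProj m x = if m = n then x else 0 := by
  rw [degProj, GradedAlgebra.proj_apply]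
  split_ifs with h
  · subst h; exact DirectSum.decompose_of_mem_same _ hx
  · exact DirectSum.decompose_of_mem_ne _ hx (Ne.symm h)

lemma degProj_map (f : V →ₗ[𝕜] V') (n : ℕ) (x : ExteriorAlgebra 𝕜 V) :
    degProj n (ExteriorAlgebra.map f x) = ExteriorAlgebra.map f (degProj n x) := by
  induction x using DirectSum.Decomposition.inductionOn (fun i : ℕ => ⋀[𝕜]^i V) with
  | zero => simp
  | add x y hx hy => simp only [map_add, hx, hy]
  | homogeneous x =>
    rw [degProj_of_mem x.2, degProj_of_mem (map_mem_exteriorPower f x.2)]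
    split_ifs <;> simp

end

lemma monomials_mem (S : Finset (Fin d)) : monomials d 𝕜 S ∈ ⋀[𝕜]^S.card (Fin d → 𝕜) := by
  rw [monomials, ExteriorAlgebra.basis_apply]
  exact Subtype.prop (exteriorPower.ιMulti_family 𝕜 S.card _ _)

lemma sum_degProj (x : Lam d 𝕜) : ∑ n ∈ Finset.range (d + 1), degProj n x = x := by
  have h : ∑ n ∈ Finset.range (d + 1), degProj n = (LinearMap.id : Lam d 𝕜 →ₗ[𝕜] Lam d 𝕜) := by
    refine (monomials d 𝕜).ext fun S => ?_
    simp only [LinearMap.sum_apply, degProj_of_mem (monomials_mem S), LinearMap.id_apply]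
    rw [Finset.sum_ite_eq', if_pos]
    have := S.card_le_univ
    simp at this ⊢
    omega
  simpa only [LinearMap.sum_apply, LinearMap.id_apply] using congrArg (fun F => F x) h

variable {U : Opens (Coord d)}

variable (𝕜 U) in
/-- The local forms of degree `n`. -/
def localHom (n : ℕ) : Submodule 𝕜 (LocalForms 𝕜 U) :=
  ⨅ y : U, (⋀[𝕜]^n (Fin d → 𝕜)).comap (eval U y)

lemma mem_localHom {n : ℕ} {f : LocalForms 𝕜 U} :
    f ∈ localHom 𝕜 U n ↔ ∀ y : U, f.1 y ∈ ⋀[𝕜]^n (Fin d → 𝕜) := by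
  simp only [localHom, Submodule.mem_iInf, Submodule.mem_comap]
  rfl

lemma localHom_mul {m n : ℕ} {f g : LocalForms 𝕜 U} (hf : f ∈ localHom 𝕜 U m)
    (hg : g ∈ localHom 𝕜 U n) : f * g ∈ localHom 𝕜 U (m + n) :=
  mem_localHom.2 fun y => mul_mem_exteriorPower (mem_localHom.1 hf y) (mem_localHom.1 hg y)

lemma localHom_inv {n : ℕ} {f : LocalForms 𝕜 U} (hf : f ∈ localHom 𝕜 U n) :
    (cartan 𝕜 U).inv f = (-1 : 𝕜) ^ n • f :=
  LocalForms.ext fun y => gradeInv_of_mem (mem_localHom.1 hf y)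

lemma localHom_pd (k : Fin d) {n : ℕ} {f : LocalForms 𝕜 U} (hf : f ∈ localHom 𝕜 U n) :
    (cartan 𝕜 U).pd k f ∈ localHom 𝕜 U n := by
  have h : mapLin (degProj n) f = f := LocalForms.ext fun y => by
    rw [mapLin_apply, degProj_of_mem (mem_localHom.1 hf y), if_pos rfl]
  rw [← h]
  change partialLin k _ ∈ _
  rw [partialLin_mapLin]
  exact mem_localHom.2 fun y => degProj_mem n _

lemma localHom_ip_zero (k : Fin d) {f : LocalForms 𝕜 U} (hf : f ∈ localHom 𝕜 U 0) :
    (cartan 𝕜 U).ip k f = 0 :=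
  LocalForms.ext fun y => intProd_of_mem_zero k (mem_localHom.1 hf y)

lemma localHom_ip_succ (k : Fin d) {n : ℕ} {f : LocalForms 𝕜 U} (hf : f ∈ localHom 𝕜 U (n + 1)) :
    (cartan 𝕜 U).ip k f ∈ localHom 𝕜 U n :=
  mem_localHom.2 fun y => intProd_mem k (mem_localHom.1 hf y)

lemma localHom_d {n : ℕ} {f : LocalForms 𝕜 U} (hf : f ∈ localHom 𝕜 U n) :
    (cartan 𝕜 U).d f ∈ localHom 𝕜 U (n + 1) := by
  rw [CartanCalculus.d_apply, add_comm]
  exact sum_mem fun k _ => localHom_mul (mem_localHom.2 fun y => ι_mem_exteriorPower _)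
    (localHom_pd k hf)

lemma localHom_of_isFun_mul {n : ℕ} {u f : LocalForms 𝕜 U} (hu : u ∈ localHom 𝕜 U 0)
    (hf : f ∈ localHom 𝕜 U n) : u * f ∈ localHom 𝕜 U n := by
  simpa using localHom_mul hu hf

section

variable {Γ : ChristoffelSystem d} {w : BivectorComponents d} (h : LocalData Γ w U)

lemma localHom_theta (s i : Fin d) : h.theta 𝕜 s i ∈ localHom 𝕜 U 1 :=
  mem_localHom.2 fun y => by
    rw [h.theta_apply]
    exact sum_mem fun t _ => Submodule.smul_mem _ _ (ι_mem_exteriorPower _)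

lemma localHom_biv (i j : Fin d) : h.biv 𝕜 i j ∈ localHom 𝕜 U 0 :=
  mem_localHom.2 fun y => by
    rw [h.biv_apply, ExteriorAlgebra.exteriorPower, pow_zero]
    exact Submodule.smul_mem _ _ (Submodule.one_le.1 le_rfl)

lemma localHom_hform (i j : Fin d) :
    (cartan 𝕜 U).hform (h.theta 𝕜) (h.biv 𝕜) i j ∈ localHom 𝕜 U 2 := by
  have hc : ∀ s, (cartan 𝕜 U).curv (h.theta 𝕜) j s ∈ localHom 𝕜 U (1 + 1) := fun s => by
    rw [CartanCalculus.curv]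
    exact add_mem (localHom_d (localHom_theta h j s))
      (sum_mem fun r _ => localHom_mul (localHom_theta h j r) (localHom_theta h r s))
  rw [CartanCalculus.hform]
  exact Submodule.smul_mem _ _ (sum_mem fun s _ =>
    localHom_of_isFun_mul (localHom_biv h i s) (hc s))

lemma localHom_nabla (k : Fin d) {n : ℕ} {f : LocalForms 𝕜 U} (hf : f ∈ localHom 𝕜 U n) :
    (cartan 𝕜 U).nabla (h.theta 𝕜) k f ∈ localHom 𝕜 U n := by
  rw [CartanCalculus.nabla_apply]
  refine sub_mem (localHom_pd k hf) (sum_mem fun s _ => ?_)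
  cases n with
  | zero => rw [localHom_ip_zero s hf, mul_zero]; exact zero_mem _
  | succ n => rw [add_comm]; exact localHom_mul (localHom_theta h s k) (localHom_ip_succ s hf)

lemma localHom_br {m n : ℕ} {f g : LocalForms 𝕜 U} (hf : f ∈ localHom 𝕜 U m)
    (hg : g ∈ localHom 𝕜 U n) :
    (cartan 𝕜 U).br (h.theta 𝕜) (h.biv 𝕜) f g ∈ localHom 𝕜 U (m + n) := by
  rw [CartanCalculus.br_apply, CartanCalculus.brQ_apply]
  refine add_mem (sum_mem fun i _ => sum_mem fun j _ => Submodule.smul_mem _ _ ?_)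
    (sum_mem fun i _ => sum_mem fun j _ => ?_)
  · rw [mul_assoc]
    exact localHom_of_isFun_mul (localHom_biv h i j)
      (localHom_mul (localHom_nabla h i hf) (localHom_nabla h j hg))
  · cases m with
    | zero => rw [localHom_ip_zero i hf, map_zero, mul_zero, zero_mul]; exact zero_mem _
    | succ m =>
      cases n with
      | zero => rw [localHom_ip_zero j hg, mul_zero]; exact zero_mem _
      | succ n =>
        rw [localHom_inv (localHom_ip_succ i hf), mul_smul_comm, smul_mul_assoc,
          show m + 1 + (n + 1) = 2 + m + n by omega]
        exact Submodule.smul_mem _ _ (localHom_mul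
          (localHom_mul (localHom_hform h i j) (localHom_ip_succ i hf)) (localHom_ip_succ j hg))

end

end Degrees

section FormDegrees

variable {d : ℕ} {M : Type*} [TopologicalSpace M] [ChartedSpace (Coord d) M]
  [IsManifold (𝓡 d) ∞ M] {𝕜 : Type*} [RCLike 𝕜]

open LocalForms

lemma mem_homogeneous_iff {n : ℕ} {ξ : Forms d M 𝕜} : ξ ∈ homogeneous d M 𝕜 n ↔
    ∀ (φ : OpenPartialHomeomorph M (Coord d)) (hφ : IsCoordSystem φ),
      loc 𝕜 hφ ξ ∈ localHom 𝕜 (coordDomain φ) n := by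
  refine ⟨fun h φ hφ => mem_localHom.2 fun y => map_mem_exteriorPower _ (h _), fun h x => ?_⟩
  rw [← map_loc_chartAt]
  exact map_mem_exteriorPower _ (mem_localHom.1 (h _ _) _)

variable (d M 𝕜) in
/-- The component of degree `n` of a form. -/
def projForm (n : ℕ) : Forms d M 𝕜 →ₗ[𝕜] Forms d M 𝕜 where
  toFun ξ := ⟨fun x => degProj n (ξ.1 x), fun φ hφ => by
    have : inCoords φ (fun x => degProj n (ξ.1 x)) = fun y => degProj n (inCoords φ ξ.1 y) :=
      funext fun y => (degProj_map _ _ _).symm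
    rw [this]
    exact (ξ.2 φ hφ).map _⟩
  map_add' ξ η := Subtype.ext (funext fun x => map_add (degProj n) (ξ.1 x) (η.1 x))
  map_smul' c ξ := Subtype.ext (funext fun x => map_smul (degProj n) c (ξ.1 x))

lemma projForm_mem (n : ℕ) (ξ : Forms d M 𝕜) : projForm d M 𝕜 n ξ ∈ homogeneous d M 𝕜 n :=
  fun _ => degProj_mem n _

lemma projForm_of_mem {n : ℕ} {ξ : Forms d M 𝕜} (hξ : ξ ∈ homogeneous d M 𝕜 n) (m : ℕ) :
    projForm d M 𝕜 m ξ = if m = n then ξ else 0 := by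
  refine Subtype.ext (funext fun x => ?_)
  change degProj m (ξ.1 x) = _
  rw [degProj_of_mem (hξ x)]
  split_ifs <;> rfl

lemma sum_projForm (ξ : Forms d M 𝕜) : ∑ n ∈ Finset.range (d + 1), projForm d M 𝕜 n ξ = ξ :=
  forms_ext fun φ hφ => LocalForms.ext fun y => by
    rw [map_sum, LocalForms.sum_apply, ← sum_degProj ((loc 𝕜 hφ ξ).1 y)]
    exact Finset.sum_congr rfl fun n _ => (degProj_map _ _ _).symm

end FormDegrees

/-! ### First-order deformations of differential graded algebras -/

section Deformation

variable {K : Type*} [Field K] {A : Type*} [Ring A] [Algebra K A]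

lemma dualTensor_induction {V : Type*} [AddCommGroup V] [Module K V]
    {p : DualNumber K ⊗[K] V → Prop}
    (one_tmul : ∀ v : V, p (1 ⊗ₜ v)) (smul : ∀ (a : DualNumber K) x, p x → p (a • x))
    (add : ∀ x y, p x → p y → p (x + y)) (x : DualNumber K ⊗[K] V) : p x := by
  induction x using TensorProduct.induction_on with
  | zero => simpa using smul 0 _ (one_tmul 0)
  | tmul a v => simpa [TensorProduct.smul_tmul'] using smul a _ (one_tmul v)
  | add x y hx hy => exact add x y hx hy

lemma baseChange_induction {V : Type*} [AddCommGroup V] [Module K V] {S : Submodule K V}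
    {p : DualNumber K ⊗[K] V → Prop}
    (one_tmul : ∀ v ∈ S, p (1 ⊗ₜ v)) (smul : ∀ (a : DualNumber K) x, p x → p (a • x))
    (add : ∀ x y, p x → p y → p (x + y)) {x : DualNumber K ⊗[K] V}
    (hx : x ∈ S.baseChange (DualNumber K)) : p x := by
  rw [Submodule.baseChange_eq_span] at hx
  induction hx using Submodule.span_induction with
  | mem x hx => obtain ⟨v, hv, rfl⟩ := hx; exact one_tmul v hv
  | zero => simpa using smul 0 _ (one_tmul 0 S.zero_mem)
  | add x y _ _ hx hy => exact add x y hx hy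
  | smul a x _ hx => exact smul a x hx

lemma eps_smul_eps_smul {V : Type*} [AddCommGroup V] [Module K V] (v : V) :
    (DualNumber.eps : DualNumber K) • (DualNumber.eps : DualNumber K) •
      (1 : DualNumber K) ⊗ₜ[K] v = 0 := by
  rw [smul_smul, DualNumber.eps_mul_eps, zero_smul]

/-- The `K[λ]/(λ²)`-bilinear product `ξη + λ B(ξ, η)`. -/
def deform (B : A →ₗ[K] A →ₗ[K] A) : DualNumber K ⊗[K] A →ₗ[DualNumber K]
    DualNumber K ⊗[K] A →ₗ[DualNumber K] DualNumber K ⊗[K] A :=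
  LinearMap.BilinMap.baseChange (DualNumber K) (LinearMap.mul K A) +
    (DualNumber.eps : DualNumber K) • LinearMap.BilinMap.baseChange (DualNumber K) B

lemma deform_tmul (B : A →ₗ[K] A →ₗ[K] A) (ξ η : A) :
    deform B (1 ⊗ₜ ξ) (1 ⊗ₜ η) = 1 ⊗ₜ (ξ * η) + (DualNumber.eps : DualNumber K) • 1 ⊗ₜ B ξ η := by
  simp [deform]

lemma eps_tmul (ξ : A) : (DualNumber.eps : DualNumber K) ⊗ₜ[K] ξ =
    (DualNumber.eps : DualNumber K) • 1 ⊗ₜ ξ := by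
  simp [TensorProduct.smul_tmul']

lemma bilin_ext {m m' : DualNumber K ⊗[K] A →ₗ[DualNumber K]
    DualNumber K ⊗[K] A →ₗ[DualNumber K] DualNumber K ⊗[K] A}
    (h : ∀ ξ η : A, m (1 ⊗ₜ ξ) (1 ⊗ₜ η) = m' (1 ⊗ₜ ξ) (1 ⊗ₜ η)) : m = m' := by
  refine LinearMap.ext fun x => LinearMap.ext fun y => ?_
  induction x using dualTensor_induction with
  | smul a x hx => simp only [map_smul, LinearMap.smul_apply, hx]
  | add x x' hx hx' => simp only [map_add, LinearMap.add_apply, hx, hx']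
  | one_tmul ξ =>
    induction y using dualTensor_induction with
    | smul a x hx => simp only [map_smul, hx]
    | add x x' hx hx' => simp only [map_add, hx, hx']
    | one_tmul η => exact h ξ η

/-- `A` is the direct sum of the submodules `𝒜 n`, only finitely many of which are nonzero: `P n` is
the projection to `𝒜 n`. -/
structure IsFiniteGrading (𝒜 : ℕ → Submodule K A) (P : ℕ → A →ₗ[K] A) (N : ℕ) : Prop where
  mem : ∀ n a, P n a ∈ 𝒜 n
  apply_of_mem : ∀ n, ∀ a ∈ 𝒜 n, ∀ m, P m a = if m = n then a else 0
  sum_apply : ∀ a, ∑ n ∈ Finset.range N, P n a = a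

lemma IsFiniteGrading.isInternal {𝒜 : ℕ → Submodule K A} {P : ℕ → A →ₗ[K] A} {N : ℕ}
    (h : IsFiniteGrading 𝒜 P N) :
    DirectSum.IsInternal fun n => (𝒜 n).baseChange (DualNumber K) := by
  have e1 : ∀ n x, (P n).baseChange (DualNumber K) x ∈ (𝒜 n).baseChange (DualNumber K) := by
    intro n x
    induction x using dualTensor_induction with
    | one_tmul ξ => exact Submodule.tmul_mem_baseChange_of_mem _ (h.mem n ξ)
    | smul a x hx => rw [map_smul]; exact Submodule.smul_mem _ _ hx
    | add x y hx hy => rw [map_add]; exact add_mem hx hy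
  have e2 : ∀ n m x, x ∈ (𝒜 n).baseChange (DualNumber K) →
      (P m).baseChange (DualNumber K) x = if m = n then x else 0 := by
    intro n m x hx
    refine baseChange_induction (p := fun x => (P m).baseChange (DualNumber K) x =
      if m = n then x else 0) (fun ξ hξ => ?_) (fun a x hx => ?_) (fun x y hx hy => ?_) hx
    · rw [LinearMap.baseChange_tmul, h.apply_of_mem n ξ hξ]
      split_ifs <;> simp
    · rw [map_smul, hx]; split_ifs <;> simp
    · rw [map_add, hx, hy]; split_ifs <;> simp
  have e3 : ∀ x, ∑ n ∈ Finset.range N, (P n).baseChange (DualNumber K) x = x := by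
    intro x
    induction x using dualTensor_induction with
    | one_tmul ξ =>
      simp only [LinearMap.baseChange_tmul, ← TensorProduct.tmul_sum, h.sum_apply]
    | smul a x hx => simp only [map_smul, ← Finset.smul_sum, hx]
    | add x y hx hy => simp only [map_add, Finset.sum_add_distrib, hx, hy]
  have e4 : ∀ (x : DirectSum ℕ fun n => (𝒜 n).baseChange (DualNumber K)) n,
      (P n).baseChange (DualNumber K) (DirectSum.coeAddMonoidHom _ x) = x n := by
    intro x n
    induction x using DirectSum.induction_on with
    | zero => simp
    | of i a =>
      rw [DirectSum.coeAddMonoidHom_of, e2 i n a a.2]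
      split_ifs with hi
      · subst hi; rw [DirectSum.of_eq_same]
      · rw [DirectSum.of_eq_of_ne _ _ _ hi]; rfl
    | add x y hx hy => rw [map_add, map_add, hx, hy]; rfl
  refine ⟨fun x y hxy => ?_, fun x => ?_⟩
  · refine DFinsupp.ext fun n => Subtype.ext ?_
    rw [← e4, ← e4, hxy]
  · refine ⟨∑ n ∈ Finset.range N, DirectSum.of (fun n => (𝒜 n).baseChange (DualNumber K)) n
      ⟨_, e1 n x⟩, ?_⟩
    rw [map_sum]
    simpa only [DirectSum.coeAddMonoidHom_of] using e3 x

/-- A bilinear product is determined by its values on elements `1 ⊗ ξ`, `1 ⊗ η` with `ξ`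
homogeneous. -/
lemma IsFiniteGrading.eq_deform_iff {𝒜 : ℕ → Submodule K A} {P : ℕ → A →ₗ[K] A} {N : ℕ}
    (h : IsFiniteGrading 𝒜 P N) {B : A →ₗ[K] A →ₗ[K] A} {Q : ℕ → A → A → A → Prop}
    (hQ : ∀ p, ∀ ξ ∈ 𝒜 p, ∀ η ζ, Q p ξ η ζ ↔ ζ = B ξ η)
    (m : DualNumber K ⊗[K] A →ₗ[DualNumber K] DualNumber K ⊗[K] A →ₗ[DualNumber K]
      DualNumber K ⊗[K] A) :
    (∀ p, ∀ ξ ∈ 𝒜 p, ∀ η, ∃ ζ, m (1 ⊗ₜ ξ) (1 ⊗ₜ η) =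
      1 ⊗ₜ (ξ * η) + (DualNumber.eps : DualNumber K) ⊗ₜ[K] ζ ∧ Q p ξ η ζ) ↔ m = deform B := by
  constructor
  · intro hm
    refine bilin_ext fun ξ η => ?_
    rw [← h.sum_apply ξ]
    simp only [TensorProduct.tmul_sum, map_sum, LinearMap.sum_apply]
    refine Finset.sum_congr rfl fun p _ => ?_
    obtain ⟨ζ, hζ, hζ'⟩ := hm p _ (h.mem p ξ) η
    rw [hζ, (hQ p _ (h.mem p ξ) η ζ).1 hζ', deform_tmul, eps_tmul]
  · rintro rfl p ξ hξ η
    exact ⟨B ξ η, by rw [deform_tmul, eps_tmul], (hQ p ξ hξ η _).2 rfl⟩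

/-- The bilinear map `B` is compatible with the differential graded algebra `A` to the extent that
`ξη + λ B(ξ, η)` is a first-order deformation of the product: it has degree `0`, it is a normalized
Hochschild cocycle, and it obeys the Leibniz rule. -/
structure InfinitesimalDeformation (𝒜 : ℕ → Submodule K A) (D : A →ₗ[K] A)
    (B : A →ₗ[K] A →ₗ[K] A) : Prop where
  one_mem : 1 ∈ 𝒜 0
  mul_mem : ∀ m n, ∀ a ∈ 𝒜 m, ∀ b ∈ 𝒜 n, a * b ∈ 𝒜 (m + n)
  br_mem : ∀ m n, ∀ a ∈ 𝒜 m, ∀ b ∈ 𝒜 n, B a b ∈ 𝒜 (m + n)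
  one_br : ∀ a, B 1 a = 0
  br_one : ∀ a, B a 1 = 0
  cocycle : ∀ a b c, B (a * b) c + B a b * c = B a (b * c) + a * B b c
  map_mem : ∀ n, ∀ a ∈ 𝒜 n, D a ∈ 𝒜 (n + 1)
  square_zero : ∀ a, D (D a) = 0
  leibniz : ∀ n, ∀ a ∈ 𝒜 n, ∀ b, D (a * b) = D a * b + (-1 : K) ^ n • (a * D b)
  leibniz_br : ∀ n, ∀ a ∈ 𝒜 n, ∀ b, D (B a b) = B (D a) b + (-1 : K) ^ n • B a (D b)

namespace InfinitesimalDeformation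

variable {𝒜 : ℕ → Submodule K A} {D : A →ₗ[K] A} {B : A →ₗ[K] A →ₗ[K] A}

/-- The laws of an infinitesimal deformation can be checked after applying a jointly injective
family of homomorphisms of algebras. -/
theorem of_local {ι : Type*} {L : ι → Type*} [∀ i, Ring (L i)] [∀ i, Algebra K (L i)]
    {ℒ : ∀ i, ℕ → Submodule K (L i)} {D' : ∀ i, L i →ₗ[K] L i} {B' : ∀ i, L i →ₗ[K] L i →ₗ[K] L i}
    (ℓ : ∀ i, A →ₐ[K] L i) (hℓ : ∀ a b, (∀ i, ℓ i a = ℓ i b) → a = b)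
    (hmem : ∀ n a, a ∈ 𝒜 n ↔ ∀ i, ℓ i a ∈ ℒ i n)
    (hD : ∀ i a, ℓ i (D a) = D' i (ℓ i a)) (hB : ∀ i a b, ℓ i (B a b) = B' i (ℓ i a) (ℓ i b))
    (h : ∀ i, InfinitesimalDeformation (ℒ i) (D' i) (B' i)) :
    InfinitesimalDeformation 𝒜 D B where
  one_mem := (hmem _ _).2 fun i => by rw [map_one]; exact (h i).one_mem
  mul_mem m n a ha b hb := (hmem _ _).2 fun i => by
    rw [map_mul]
    exact (h i).mul_mem m n _ ((hmem _ _).1 ha i) _ ((hmem _ _).1 hb i)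
  br_mem m n a ha b hb := (hmem _ _).2 fun i => by
    rw [hB]
    exact (h i).br_mem m n _ ((hmem _ _).1 ha i) _ ((hmem _ _).1 hb i)
  one_br a := hℓ _ _ fun i => by rw [hB, map_one, map_zero, (h i).one_br]
  br_one a := hℓ _ _ fun i => by rw [hB, map_one, map_zero, (h i).br_one]
  cocycle a b c := hℓ _ _ fun i => by simp only [map_add, map_mul, hB, (h i).cocycle]
  map_mem n a ha := (hmem _ _).2 fun i => by
    rw [hD]
    exact (h i).map_mem n _ ((hmem _ _).1 ha i)
  square_zero a := hℓ _ _ fun i => by rw [hD, hD, (h i).square_zero, map_zero]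
  leibniz n a ha b := hℓ _ _ fun i => by
    simp only [hD, map_mul, map_add, map_smul, (h i).leibniz n _ ((hmem _ _).1 ha i)]
  leibniz_br n a ha b := hℓ _ _ fun i => by
    simp only [hD, hB, map_add, map_smul, (h i).leibniz_br n _ ((hmem _ _).1 ha i)]

theorem isDGA (h : InfinitesimalDeformation 𝒜 D B) {P : ℕ → A →ₗ[K] A} {N : ℕ}
    (hP : IsFiniteGrading 𝒜 P N) :
    IsDGA (fun n => (𝒜 n).baseChange (DualNumber K)) (deform B) (1 ⊗ₜ 1)
      (D.baseChange (DualNumber K)) where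
  graded := hP.isInternal
  one_mem := Submodule.tmul_mem_baseChange_of_mem _ h.one_mem
  mul_mem m n x hx y hy := by
    refine baseChange_induction (p := fun x => deform B x y ∈ (𝒜 (m + n)).baseChange _)
      (fun ξ hξ => ?_) (fun a x hx => ?_) (fun x y hx hy => ?_) hx
    · refine baseChange_induction
        (p := fun y => deform B (1 ⊗ₜ ξ) y ∈ (𝒜 (m + n)).baseChange _)
        (fun η hη => ?_) (fun a x hx => ?_) (fun x y hx hy => ?_) hy
      · rw [deform_tmul]
        exact add_mem (Submodule.tmul_mem_baseChange_of_mem _ (h.mul_mem m n ξ hξ η hη))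
          (Submodule.smul_mem _ _
            (Submodule.tmul_mem_baseChange_of_mem _ (h.br_mem m n ξ hξ η hη)))
      · rw [map_smul]; exact Submodule.smul_mem _ _ hx
      · rw [map_add]; exact add_mem hx hy
    · rw [map_smul, LinearMap.smul_apply]; exact Submodule.smul_mem _ _ hx
    · rw [map_add, LinearMap.add_apply]; exact add_mem hx hy
  one_mul x := by
    induction x using dualTensor_induction with
    | one_tmul ξ => rw [deform_tmul, h.one_br, one_mul, TensorProduct.tmul_zero, smul_zero, add_zero]
    | smul a x hx => rw [map_smul, hx]
    | add x y hx hy => rw [map_add, hx, hy]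
  mul_one x := by
    induction x using dualTensor_induction with
    | one_tmul ξ => rw [deform_tmul, h.br_one, mul_one, TensorProduct.tmul_zero, smul_zero, add_zero]
    | smul a x hx => rw [map_smul, LinearMap.smul_apply, hx]
    | add x y hx hy => rw [map_add, LinearMap.add_apply, hx, hy]
  assoc x y z := by
    induction x using dualTensor_induction with
    | smul a x hx => simp only [map_smul, LinearMap.smul_apply, hx]
    | add x x' hx hx' => simp only [map_add, LinearMap.add_apply, hx, hx']
    | one_tmul ξ =>
    induction y using dualTensor_induction with
    | smul a x hx => simp only [map_smul, LinearMap.smul_apply, hx]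
    | add x x' hx hx' => simp only [map_add, LinearMap.add_apply, hx, hx']
    | one_tmul η =>
    induction z using dualTensor_induction with
    | smul a x hx => simp only [map_smul, hx]
    | add x x' hx hx' => simp only [map_add, hx, hx']
    | one_tmul ζ =>
    have hc := congrArg (fun v => (DualNumber.eps : DualNumber K) • (1 : DualNumber K) ⊗ₜ[K] v)
      (h.cocycle ξ η ζ)
    simp only [TensorProduct.tmul_add, smul_add] at hc
    simp only [deform_tmul, map_add, map_smul, LinearMap.add_apply, LinearMap.smul_apply, smul_add,
      eps_smul_eps_smul, add_zero, mul_assoc, add_assoc, hc]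
  map_mem n x hx := by
    refine baseChange_induction
      (p := fun x => D.baseChange (DualNumber K) x ∈ (𝒜 (n + 1)).baseChange (DualNumber K))
      (fun ξ hξ => ?_) (fun a x hx => ?_) (fun x y hx hy => ?_) hx
    · exact Submodule.tmul_mem_baseChange_of_mem _ (h.map_mem n ξ hξ)
    · rw [map_smul]; exact Submodule.smul_mem _ _ hx
    · rw [map_add]; exact add_mem hx hy
  square_zero x := by
    induction x using dualTensor_induction with
    | one_tmul ξ =>
      rw [LinearMap.baseChange_tmul, LinearMap.baseChange_tmul, h.square_zero,
        TensorProduct.tmul_zero]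
    | smul a x hx => rw [map_smul, map_smul, hx, smul_zero]
    | add x y hx hy => rw [map_add, map_add, hx, hy, add_zero]
  leibniz n x hx y := by
    have hs : ∀ v : A, (1 : DualNumber K) ⊗ₜ[K] ((-1 : K) ^ n • v) =
        (-1 : DualNumber K) ^ n • (1 : DualNumber K) ⊗ₜ[K] v := fun v => by
      rcases Nat.even_or_odd n with hn | hn
      · rw [hn.neg_one_pow, hn.neg_one_pow, one_smul, one_smul]
      · rw [hn.neg_one_pow, hn.neg_one_pow, neg_one_smul, TensorProduct.tmul_neg,
          TensorProduct.smul_tmul', smul_eq_mul, mul_one, TensorProduct.neg_tmul]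
    refine baseChange_induction (p := fun x => D.baseChange (DualNumber K) (deform B x y) =
        deform B (D.baseChange (DualNumber K) x) y +
          (-1 : DualNumber K) ^ n • deform B x (D.baseChange (DualNumber K) y))
      (fun ξ hξ => ?_) (fun a x hx => ?_) (fun x y hx hy => ?_) hx
    · induction y using dualTensor_induction with
      | one_tmul η =>
        simp only [deform_tmul, LinearMap.baseChange_tmul, map_add, map_smul, h.leibniz n ξ hξ,
          h.leibniz_br n ξ hξ, TensorProduct.tmul_add, hs, smul_add]
        rw [smul_comm (DualNumber.eps : DualNumber K) ((-1 : DualNumber K) ^ n)]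
        abel
      | smul a x hx =>
        simp only [map_smul, hx, smul_add]
        rw [smul_comm a]
      | add x y hx hy => simp only [map_add, hx, hy, smul_add]; abel
    · simp only [map_smul, LinearMap.smul_apply, hx, smul_add]
      rw [smul_comm a]
    · simp only [map_add, LinearMap.add_apply, hx, hy, smul_add]; abel

end InfinitesimalDeformation

/-- Modulo `λ` the deformed product is the undeformed one, so a submodule which contains the
generators and is closed under the deformed product contains some `ξ + λζ` for every `ξ`; then it
contains `λξ = λ(ξ + λζ)` for every `ξ`, hence also `ξ = (ξ + λζ) - λζ`. -/
theorem generatedInDegreesZeroOne_deform {𝒜 : ℕ → Submodule K A} (B : A →ₗ[K] A →ₗ[K] A)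
    (h : GeneratedInDegreesZeroOne 𝒜 (LinearMap.mul K A)) :
    GeneratedInDegreesZeroOne (fun n => (𝒜 n).baseChange (DualNumber K)) (deform B) := by
  intro W h0 h1 hmul
  let W₁ : Submodule K A :=
    { carrier := {ξ | ∃ ζ : A, (1 : DualNumber K) ⊗ₜ[K] ξ +
        (DualNumber.eps : DualNumber K) • (1 : DualNumber K) ⊗ₜ[K] ζ ∈ W}
      zero_mem' := ⟨0, by simp⟩
      add_mem' := by
        rintro ξ η ⟨ζ, hζ⟩ ⟨ζ', hζ'⟩
        refine ⟨ζ + ζ', ?_⟩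
        have := add_mem hζ hζ'
        rw [add_add_add_comm, ← smul_add, ← TensorProduct.tmul_add, ← TensorProduct.tmul_add] at this
        exact this
      smul_mem' := by
        rintro c ξ ⟨ζ, hζ⟩
        refine ⟨c • ζ, ?_⟩
        have := W.smul_of_tower_mem c hζ
        rw [smul_add, smul_comm c, ← TensorProduct.tmul_smul, ← TensorProduct.tmul_smul] at this
        exact this }
  have hle : ∀ n, (𝒜 n).baseChange (DualNumber K) ≤ W → 𝒜 n ≤ W₁ := fun n hn ξ hξ =>
    ⟨0, by simpa using hn (Submodule.tmul_mem_baseChange_of_mem 1 hξ)⟩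
  have hW₁ : W₁ = ⊤ := by
    refine h W₁ (hle 0 h0) (hle 1 h1) ?_
    rintro ξ ⟨ζ, hζ⟩ η ⟨ζ', hζ'⟩
    refine ⟨B ξ η + ξ * ζ' + ζ * η, ?_⟩
    have := hmul _ hζ _ hζ'
    simp only [deform_tmul, map_add, map_smul, LinearMap.add_apply, LinearMap.smul_apply, smul_add,
      eps_smul_eps_smul, add_zero] at this
    simp only [LinearMap.mul_apply', TensorProduct.tmul_add, smul_add]
    convert this using 1
    abel
  have hex : ∀ ξ : A, ∃ ζ : A, (1 : DualNumber K) ⊗ₜ[K] ξ +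
      (DualNumber.eps : DualNumber K) • (1 : DualNumber K) ⊗ₜ[K] ζ ∈ W := fun ξ => by
    have : ξ ∈ W₁ := hW₁ ▸ Submodule.mem_top
    exact this
  have heps : ∀ ξ : A, (DualNumber.eps : DualNumber K) • (1 : DualNumber K) ⊗ₜ[K] ξ ∈ W := by
    intro ξ
    obtain ⟨ζ, hζ⟩ := hex ξ
    simpa only [smul_add, eps_smul_eps_smul, add_zero] using
      W.smul_mem (DualNumber.eps : DualNumber K) hζ
  refine Submodule.eq_top_iff'.2 fun x => ?_
  induction x using dualTensor_induction with
  | one_tmul ξ =>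
    obtain ⟨ζ, hζ⟩ := hex ξ
    simpa using sub_mem hζ (heps ζ)
  | smul a x hx => exact W.smul_mem a hx
  | add x y hx hy => exact add_mem hx hy

end Deformation

/-! ### The deformed algebra of forms -/

section

variable {𝕜 : Type*} [Field 𝕜] {n : ℕ} {A : Type*} [Ring A] [Algebra 𝕜 A]
  (C : CartanCalculus 𝕜 n A) (θ W : Fin n → Fin n → A)

namespace CartanCalculus

lemma pd_one (k : Fin n) : C.pd k 1 = 0 := by simpa using C.pd_mul k 1 1

lemma ip_one (k : Fin n) : C.ip k 1 = 0 := by simpa using C.ip_mul k 1 1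

lemma nabla_one (k : Fin n) : C.nabla θ k 1 = 0 := by simp [nabla_apply, pd_one, ip_one]

lemma br_one_left (x : A) : C.br θ W 1 x = 0 := by
  simp [br_apply, brQ_apply, nabla_one, ip_one]

lemma br_one_right (x : A) : C.br θ W x 1 = 0 := by
  simp [br_apply, brQ_apply, nabla_one, ip_one]

end CartanCalculus

end

section Main

open LocalForms

variable {d : ℕ} {M : Type*} [TopologicalSpace M] [ChartedSpace (Coord d) M]
  [IsManifold (𝓡 d) ∞ M] {𝕜 : Type*} [RCLike 𝕜]

lemma IsExteriorDerivative.loc_eq {D : Forms d M 𝕜 →ₗ[𝕜] Forms d M 𝕜}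
    (hD : IsExteriorDerivative D) {φ : OpenPartialHomeomorph M (Coord d)} (hφ : IsCoordSystem φ)
    (ξ : Forms d M 𝕜) : loc 𝕜 hφ (D ξ) = (cartan 𝕜 (coordDomain φ)).d (loc 𝕜 hφ ξ) :=
  LocalForms.ext fun y => (hD φ hφ ξ y y.2).trans (LocalForms.d_apply (loc_apply hφ ξ) y).symm

/-- On a coordinate patch the first-order term is an infinitesimal deformation of the differential
graded algebra of forms. -/
lemma LocalData.infinitesimalDeformation {Γ : ChristoffelSystem d} {w : BivectorComponents d}
    {U : TopologicalSpace.Opens (Coord d)} (h : LocalData Γ w U) :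
    InfinitesimalDeformation (localHom 𝕜 U) (cartan 𝕜 U).d
      ((cartan 𝕜 U).br (h.theta 𝕜) (h.biv 𝕜)) where
  one_mem := mem_localHom.2 fun _ => by
    rw [ExteriorAlgebra.exteriorPower, pow_zero]
    exact Submodule.one_le.1 le_rfl
  mul_mem _ _ _ hf _ hg := localHom_mul hf hg
  br_mem _ _ _ hf _ hg := localHom_br h hf hg
  one_br := CartanCalculus.br_one_left _ _ _
  br_one := CartanCalculus.br_one_right _ _ _
  cocycle := h.compatible.br_cocycle
  map_mem _ _ hf := localHom_d hf
  square_zero := (cartan 𝕜 U).d_d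
  leibniz n f hf g := by rw [CartanCalculus.d_mul, localHom_inv hf, smul_mul_assoc]
  leibniz_br n f hf g := by
    rw [h.compatible.leibniz, localHom_inv hf, map_smul, LinearMap.smul_apply]

lemma isFiniteGrading_homogeneous :
    IsFiniteGrading (homogeneous d M 𝕜) (projForm d M 𝕜) (d + 1) :=
  ⟨projForm_mem, fun _ _ hξ m => projForm_of_mem hξ m, sum_projForm⟩

variable (d M 𝕜) in
theorem existsUnique_exteriorDerivative :
    ∃! D : Forms d M 𝕜 →ₗ[𝕜] Forms d M 𝕜, IsExteriorDerivative D := by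
  obtain ⟨D, hD⟩ := exists_exteriorDerivative d M 𝕜
  have hD' : IsExteriorDerivative D := fun φ hφ ξ y hy =>
    (congrArg (fun f => f.1 ⟨y, hy⟩) (hD φ hφ ξ)).trans
      (LocalForms.d_apply (loc_apply hφ ξ) ⟨y, hy⟩)
  exact ⟨D, hD', fun D' h => LinearMap.ext fun ξ => forms_ext fun φ hφ => by
    rw [h.loc_eq, hD'.loc_eq]⟩

variable {biv : Tensor20 d M}
  {conn : CovariantDerivative (𝓡 d) (Coord d) (TangentSpace (𝓡 d) : M → Type _)}

namespace PoissonGeometry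

variable {B : Forms d M 𝕜 →ₗ[𝕜] Forms d M 𝕜 →ₗ[𝕜] Forms d M 𝕜}

/-- In a coordinate system, the bracket on forms of degree `p` is the first-order term of the
deformed product. -/
lemma inCoords_bracket (G : PoissonGeometry biv conn)
    (hB : ∀ φ, ∀ hφ : IsCoordSystem φ, ∀ ξ η,
      loc 𝕜 hφ (B ξ η) = G.localBr 𝕜 hφ (loc 𝕜 hφ ξ) (loc 𝕜 hφ η))
    {p : ℕ} {ξ : Forms d M 𝕜} (hξ : ξ ∈ homogeneous d M 𝕜 p) (η : Forms d M 𝕜)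
    {φ : OpenPartialHomeomorph M (Coord d)} (hφ : IsCoordSystem φ) {y : Coord d}
    (hy : y ∈ φ.target) :
    inCoords φ (B ξ η).1 y = wedgeOneCoeff (components biv φ) (christoffel conn φ) p
      (inCoords φ ξ.1) (inCoords φ η.1) y := by
  rw [wedgeOneCoeff_eq (gradeInv_of_mem
    (mem_localHom.1 (mem_homogeneous_iff.1 hξ φ hφ) ⟨y, hy⟩))]
  exact (congrArg (fun f => f.1 ⟨y, hy⟩) (hB φ hφ ξ η)).trans
    ((G.localData hφ).br_apply (loc_apply hφ ξ) (loc_apply hφ η) ⟨y, hy⟩)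

/-- The product is characterized by its values on homogeneous forms, where it is `ξη + λ B(ξ, η)`. -/
lemma isWedgeOne_iff (G : PoissonGeometry biv conn)
    (hB : ∀ φ, ∀ hφ : IsCoordSystem φ, ∀ ξ η,
      loc 𝕜 hφ (B ξ η) = G.localBr 𝕜 hφ (loc 𝕜 hφ ξ) (loc 𝕜 hφ η))
    (mul : FormsOne d M 𝕜 →ₗ[DualNumber 𝕜] FormsOne d M 𝕜 →ₗ[DualNumber 𝕜] FormsOne d M 𝕜) :
    IsWedgeOne biv conn mul ↔ mul = deform B :=
  IsFiniteGrading.eq_deform_iff (A := Forms d M 𝕜) (B := B)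
    (Q := fun p ξ η ζ => ∀ φ, IsCoordSystem φ → ∀ y ∈ φ.target, inCoords φ ζ.1 y =
      wedgeOneCoeff (components biv φ) (christoffel conn φ) p (inCoords φ ξ.1) (inCoords φ η.1) y)
    isFiniteGrading_homogeneous
    (fun _ _ hξ η _ => ⟨fun h => forms_ext fun φ hφ => LocalForms.ext fun y =>
      (h φ hφ y y.2).trans (G.inCoords_bracket hB hξ η hφ y.2).symm,
    fun h _ hφ _ hy => h ▸ G.inCoords_bracket hB hξ η hφ hy⟩) mul

theorem infinitesimalDeformation (G : PoissonGeometry biv conn)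
    (hB : ∀ φ, ∀ hφ : IsCoordSystem φ, ∀ ξ η,
      loc 𝕜 hφ (B ξ η) = G.localBr 𝕜 hφ (loc 𝕜 hφ ξ) (loc 𝕜 hφ η))
    {D : Forms d M 𝕜 →ₗ[𝕜] Forms d M 𝕜} (hD : IsExteriorDerivative D) :
    InfinitesimalDeformation (homogeneous d M 𝕜) D B :=
  .of_local (ι := {φ : OpenPartialHomeomorph M (Coord d) // IsCoordSystem φ})
    (fun φ => loc 𝕜 φ.2) (fun _ _ h => forms_ext fun φ hφ => h ⟨φ, hφ⟩)
    (fun _ _ => mem_homogeneous_iff.trans ⟨fun h φ => h φ φ.2, fun h φ hφ => h ⟨φ, hφ⟩⟩)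
    (fun φ => hD.loc_eq φ.2) (fun φ => hB φ φ.2)
    (fun φ => (G.localData φ.2).infinitesimalDeformation)

lemma hForm_symm (G : PoissonGeometry biv conn) {φ : OpenPartialHomeomorph M (Coord d)}
    (hφ : IsCoordSystem φ) {y : Coord d} (hy : y ∈ φ.target) (i j : Fin d) :
    hForm 𝕜 (components biv φ) (christoffel conn φ) i j y =
      hForm 𝕜 (components biv φ) (christoffel conn φ) j i y := by
  have h := G.localData hφ
  rw [← h.hform_apply i j ⟨y, hy⟩, ← h.hform_apply j i ⟨y, hy⟩, h.compatible.hform_symm]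

lemma extD_hForm (G : PoissonGeometry biv conn) {φ : OpenPartialHomeomorph M (Coord d)}
    (hφ : IsCoordSystem φ) {y : Coord d} (hy : y ∈ φ.target) (i j : Fin d) :
    extD (hForm 𝕜 (components biv φ) (christoffel conn φ) i j) y
      + ∑ r, ∑ p, ((christoffel conn φ i r p y : ℝ) : 𝕜) • (dx p *
          hForm 𝕜 (components biv φ) (christoffel conn φ) r j y)
      + ∑ r, ∑ p, ((christoffel conn φ j r p y : ℝ) : 𝕜) • (dx p *
          hForm 𝕜 (components biv φ) (christoffel conn φ) i r y) = 0 := by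
  have h := G.localData hφ
  have hd := congrArg (fun f => f.1 ⟨y, hy⟩) (h.compatible (𝕜 := 𝕜).d_hform i j)
  simp only [LocalForms.add_apply, LocalForms.sum_apply, LocalForms.mul_apply, h.hform_apply,
    h.theta_apply, Finset.sum_mul, smul_mul_assoc] at hd
  rw [LocalForms.d_apply (fun z => h.hform_apply i j z)] at hd
  exact hd

end PoissonGeometry

end Main

end Semiquant

end

set_option maxHeartbeats 1000000 in
theorem theorem4p6 {𝕜 : Type*} [RCLike 𝕜] {d : ℕ} {M : Type*} [TopologicalSpace M]
    [ChartedSpace (EuclideanSpace ℝ (Fin d)) M] [IsManifold (𝓡 d) ∞ M]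
    (biv : Semiquant.Tensor20 d M) (hbiv : Semiquant.IsBivector biv)
    (conn : CovariantDerivative (𝓡 d) (EuclideanSpace ℝ (Fin d))
      (TangentSpace (𝓡 d) : M → Type _))
    (hconn : Semiquant.SmoothConnection conn)
    (hcompat : Semiquant.PoissonCompatible biv conn) :
    (∀ φ : OpenPartialHomeomorph M (EuclideanSpace ℝ (Fin d)), Semiquant.IsCoordSystem φ →
      ∀ y ∈ φ.target, ∀ i j,
        Semiquant.hForm 𝕜 (Semiquant.components biv φ) (Semiquant.christoffel conn φ) i j y =
          Semiquant.hForm 𝕜 (Semiquant.components biv φ) (Semiquant.christoffel conn φ) j i y) ∧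
    (∀ φ : OpenPartialHomeomorph M (EuclideanSpace ℝ (Fin d)), Semiquant.IsCoordSystem φ →
      ∀ y ∈ φ.target, ∀ i j,
        Semiquant.extD
            (Semiquant.hForm 𝕜 (Semiquant.components biv φ) (Semiquant.christoffel conn φ) i j) y
          + ∑ r, ∑ p, ((Semiquant.christoffel conn φ i r p y : ℝ) : 𝕜) • (Semiquant.dx p *
              Semiquant.hForm 𝕜 (Semiquant.components biv φ) (Semiquant.christoffel conn φ) r j y)
          + ∑ r, ∑ p, ((Semiquant.christoffel conn φ j r p y : ℝ) : 𝕜) • (Semiquant.dx p *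
              Semiquant.hForm 𝕜 (Semiquant.components biv φ) (Semiquant.christoffel conn φ) i r y)
          = 0) ∧
    (∃! D : Semiquant.Forms d M 𝕜 →ₗ[𝕜] Semiquant.Forms d M 𝕜,
      Semiquant.IsExteriorDerivative D) ∧
    (∃! mul : Semiquant.FormsOne d M 𝕜 →ₗ[DualNumber 𝕜]
        Semiquant.FormsOne d M 𝕜 →ₗ[DualNumber 𝕜] Semiquant.FormsOne d M 𝕜,
      Semiquant.IsWedgeOne biv conn mul) ∧
    ∀ D : Semiquant.Forms d M 𝕜 →ₗ[𝕜] Semiquant.Forms d M 𝕜,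
      Semiquant.IsExteriorDerivative D →
      ∀ mul : Semiquant.FormsOne d M 𝕜 →ₗ[DualNumber 𝕜]
          Semiquant.FormsOne d M 𝕜 →ₗ[DualNumber 𝕜] Semiquant.FormsOne d M 𝕜,
        Semiquant.IsWedgeOne biv conn mul →
        Semiquant.IsDGA (Semiquant.homogeneousOne d M 𝕜) mul (1 ⊗ₜ 1)
          (D.baseChange (DualNumber 𝕜)) ∧
        (Semiquant.GeneratedInDegreesZeroOne (Semiquant.homogeneous d M 𝕜)
            (LinearMap.mul 𝕜 (Semiquant.Forms d M 𝕜)) →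
          Semiquant.GeneratedInDegreesZeroOne (Semiquant.homogeneousOne d M 𝕜) mul) := by
  have G : Semiquant.PoissonGeometry biv conn := ⟨hbiv, hconn, hcompat⟩
  obtain ⟨B, hB⟩ := G.exists_bracket 𝕜
  refine ⟨fun φ hφ y hy i j => G.hForm_symm hφ hy i j, fun φ hφ y hy i j => G.extD_hForm hφ hy i j,
    Semiquant.existsUnique_exteriorDerivative d M 𝕜,
    ⟨Semiquant.deform B, (G.isWedgeOne_iff hB _).2 rfl, fun mul h => (G.isWedgeOne_iff hB _).1 h⟩,
    fun D hD mul hmul => ?_⟩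
  obtain rfl := (G.isWedgeOne_iff hB mul).1 hmul
  exact ⟨(G.infinitesimalDeformation hB hD).isDGA
      Semiquant.isFiniteGrading_homogeneous,
    fun h => Semiquant.generatedInDegreesZeroOne_deform B h⟩
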